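/- **Setting.** For each sample size $n$ let $y_i = x_i'\beta + \exp(x_i'\theta/2)\,\epsilon_i$, $i=1,\dots,n$, where $\beta,\theta\in\mathbb R^p$ and $p,\beta,\theta,\Sigma,\lambda$ may all depend on $n$; the $\epsilon_i$ are i.i.d. with mean $0$ and variance $1$ and are independent of the predictors $X=(x_1,\dots,x_n)'$. Let $S=\{j:\beta_j\ne0\}$, $s=|S|$, $T=\{j:\theta_j\neq 0\}$. For a random variable $U$ put $\|U\|_{\Psi_2}=\inf\{c>0:\mathbb E\exp(|U/c|^2)\le 2\}$. For a fixed $a>1$ (usually $a>2$) let $\rho_\lambda$ be the SCAD penalty, $\rho_\lambda(0)=0$, $\rho_\lambda'(t)=\lambda\big[I\{t\le\lambda\}+\frac{(a\lambda-t)_+}{(a-1)\lambda}I\{t>\lambda\}\big]$ for $t\geq 0$, and consider the objective $$Q(b)=\|y-Xb\|_2^2+2n\sum_{j=1}^p\rho_{\lambda}(|b_j|),\qquad b\in\mathbb R^p .$$ **Assumptions.** 1. $x_i=\Sigma^{1/2}z_i$ with $z_1,\dots,z_n$ i.i.d., $\mathbb E z_i=0$, $\mathbb E z_iz_i'=I$,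 $\|\langle z_i,w\rangle\|_{\Psi_2}\le K$ for every unit vector $w$, and all eigenvalues of the symmetric matrix $\Sigma$ lie in $[C_{\min},C_{\max}]$, where $K, C_{\min},C_{\max}$ are positive constants. 2. $\mathbb E\exp(t\epsilon_i)\le\exp(t^2/2)$ for all $t\in\mathbb R$. 3. $\|\beta\|_2\le\bar\beta$ and $\|\theta\|_2\le\bar\theta$ for constants $\bar\beta,\bar\theta$. 4. $|S|/n^{\alpha_S}\to C_S$ and $|T|/n^{\alpha_T}\to C_T$ with $\alpha_S\in(0,1)$, $\alpha_T\in(0,1/3)$, $C_S,C_T>0$. 5. Let $D_{SS}=n^{-1}X_S'\,\mathrm{diag}(\exp(X\theta))\,X_S$. There are constants $0\le D_{\min}, D_{\max}\le\infty$ with $\mathbb P[\Lambda_{\max}(D_{SS})\le D_{\max}]\to1$ and $\mathbb P[\Lambda_{\min}(D_{SS})\ge D_{\min}]\to1$, and $\|D_{SS}-\mathbb E D_{SS}\|_2=o_P(1)$ in the spectral norm. **Theorem.** There are positive constants $c_1,c_2,c_3$, depending only on $K,C_{\min},C_{\max},\bar\beta,\bar\theta$, such that the following holds. Suppose Assumptions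 1–4 hold, $\lambda\ge c_1\sqrt{\log(p)\exp(\sqrt{c_2\log n})/n}$ for all large $n$, $$\min_{j\in S}|\beta_j|\gg\lambda\gg c_3\sqrt{\log(s)\exp(\sqrt{c_2\log n})/n},$$ and $\log p=O(n^{\alpha_0})$ for some $\alpha_0\in(0,1)$. Then there are estimators $\hat\beta$ (measurable functions on the sample space, one for each $n$) such that, with probability tending to $1$ as $n\to\infty$, $\hat\beta$ is a strict local minimizer of $Q$, $\hat\beta_j=0$ for all $j\notin S$, and $$\|\hat\beta_S-\beta_S\|_\infty\le c_3\sqrt{\frac{\exp(\sqrt{c_2\log n})\,\log s}{n}} .$$ If in addition Assumption 5 holds, then, for the same $\hat\beta$ and every sequence of (non-random) vectors $v=v_n\in\mathbb R^{S}$ with $\|v\|_2=1$ for all large $n$, $$\frac{\sqrt n}{\zeta}\,v'(\hat\beta_S-\beta_S)\xrightarrow{\;D\;}\mathcal N(0,1),\qquad \zeta^2=v'\,\Sigma_{SS}^{-1}\,(\mathbb E D_{SS})\,\Sigma_{SS}^{-1}\,v .$$ -/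

import Mathlib

open MeasureTheory ProbabilityTheory Filter Topology Asymptotics
open scoped NNReal ENNReal MatrixOrder

noncomputable section

namespace Hippo

/-- The Orlicz norm `inf {c > 0 : E exp (|X / c| ^ 2) ≤ 2}` of a real random variable
(`∞` if there is no such `c`). -/
def psi2Norm {Ω : Type*} [MeasurableSpace Ω] (P : Measure Ω) (X : Ω → ℝ) : ℝ≥0∞ :=
  ⨅ (c : ℝ≥0) (_ : 0 < c)
    (_ : ∫⁻ ω, ENNReal.ofReal (Real.exp (|X ω / (c : ℝ)| ^ 2)) ∂P ≤ 2), (c : ℝ≥0∞)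

/-- The derivative of the SCAD penalty with shape parameter `a` and level `l`, for `t ≥ 0`. -/
def scadDeriv (a l t : ℝ) : ℝ :=
  l * ((if t ≤ l then 1 else 0) +
    max (a * l - t) 0 / ((a - 1) * l) * (if l < t then 1 else 0))

/-- The SCAD penalty: the primitive of `scadDeriv` that vanishes at `0`. -/
def scad (a l t : ℝ) : ℝ := ∫ u in (0 : ℝ)..t, scadDeriv a l u

/-- `b` is a strict local minimizer of `f`. -/
def IsStrictLocalMin {E : Type*} [TopologicalSpace E] (f : E → ℝ) (b : E) : Prop :=
  ∀ᶠ b' in 𝓝[≠] b, f b < f b'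

/-- The data of the heteroscedastic linear model with `n` observations and `p` predictors on a
sample space `Ω`: the covariance matrix, the mean and variance parameters, the whitened
predictors `z i` and the noise variables `eps i`. -/
structure Model (n p : ℕ) (Ω : Type*) where
  Sigma : Matrix (Fin p) (Fin p) ℝ
  beta : EuclideanSpace ℝ (Fin p)
  theta : EuclideanSpace ℝ (Fin p)
  z : Fin n → Ω → Fin p → ℝ
  eps : Fin n → Ω → ℝ

namespace Model

variable {n p : ℕ} {Ω : Type*} (M : Model n p Ω)

/-- The rows of the design matrix, `x_i = Σ^{1/2} z_i`. -/
def x (i : Fin n) (ω : Ω) : Fin p → ℝ := Matrix.mulVec (CFC.sqrt M.Sigma) (M.z i ω)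

/-- The linear predictor of the log variance, `x_i' θ`. -/
def logVar (i : Fin n) (ω : Ω) : ℝ := ∑ j, M.x i ω j * M.theta j

/-- The responses `y_i = x_i' β + exp (x_i' θ / 2) ε_i`. -/
def y (i : Fin n) (ω : Ω) : ℝ :=
  ∑ j, M.x i ω j * M.beta j + Real.exp (M.logVar i ω / 2) * M.eps i ω

/-- The SCAD-penalized least squares objective
`‖y - X b‖ ^ 2 + 2 n ∑ j, ρ_l (|b_j|)`. -/
def objective (a l : ℝ) (ω : Ω) (b : EuclideanSpace ℝ (Fin p)) : ℝ :=
  ∑ i, (M.y i ω - ∑ j, M.x i ω j * b j) ^ 2 + 2 * (n : ℝ) * ∑ j, scad a l |b j|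

open Classical in
/-- The support `S` of the mean parameter. -/
def S : Finset (Fin p) := Finset.univ.filter fun j => M.beta j ≠ 0

open Classical in
/-- The support `T` of the variance parameter. -/
def T : Finset (Fin p) := Finset.univ.filter fun j => M.theta j ≠ 0

/-- The smallest absolute value of a nonzero coordinate of the mean parameter. -/
def betaMin : ℝ := ⨅ j : M.S, |M.beta j|

/-- The block of the covariance matrix with rows and columns in `S`. -/
def SigmaSS : Matrix M.S M.S ℝ := M.Sigma.submatrix (fun j => (j : Fin p)) (fun j => (j : Fin p))

/-- `D_SS = n⁻¹ X_S' diag (exp (X θ)) X_S`. -/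
def DSS (ω : Ω) : Matrix M.S M.S ℝ :=
  Matrix.of fun j k =>
    (n : ℝ)⁻¹ * ∑ i, M.x i ω (j : Fin p) * Real.exp (M.logVar i ω) * M.x i ω (k : Fin p)

/-- The entrywise expectation of `D_SS`. -/
def meanDSS [MeasurableSpace Ω] (P : Measure Ω) : Matrix M.S M.S ℝ :=
  Matrix.of fun j k => ∫ ω, M.DSS ω j k ∂P

/-- `ζ`, the square root of the sandwich variance `a' Σ_SS⁻¹ (E D_SS) Σ_SS⁻¹ a`. -/
def zeta [MeasurableSpace Ω] (P : Measure Ω) (a : EuclideanSpace ℝ M.S) : ℝ :=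
  Real.sqrt (dotProduct (fun j => a j)
    (Matrix.mulVec (M.SigmaSS⁻¹ * M.meanDSS P * M.SigmaSS⁻¹) (fun j => a j)))

/-- The noise has i.i.d. coordinates with mean `0` and variance `1`, and is independent of the
predictors. -/
structure IsHeteroscedastic [MeasurableSpace Ω] (P : Measure Ω) : Prop where
  measurable_eps : ∀ i, Measurable (M.eps i)
  indep_eps : iIndepFun M.eps P
  ident_eps : ∀ i k, IdentDistrib (M.eps i) (M.eps k) P P
  mean_eps : ∀ i, ∫ ω, M.eps i ω ∂P = 0
  var_eps : ∀ i, ∫ ω, M.eps i ω ^ 2 ∂P = 1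
  indep_design_eps : IndepFun (fun ω i => M.x i ω) (fun ω i => M.eps i ω) P

/-- The `z i` are i.i.d. isotropic subgaussian vectors with parameter `K`, and all eigenvalues of
the (symmetric) covariance matrix lie in `[Cmin, Cmax]`. -/
structure SubgaussianDesign [MeasurableSpace Ω] (P : Measure Ω) (K Cmin Cmax : ℝ) : Prop where
  measurable_z : ∀ i, Measurable (M.z i)
  indep_z : iIndepFun M.z P
  ident_z : ∀ i k, IdentDistrib (M.z i) (M.z k) P P
  mean_z : ∀ i j, ∫ ω, M.z i ω j ∂P = 0
  cov_z : ∀ i j k, ∫ ω, M.z i ω j * M.z i ω k ∂P = if j = k then 1 else 0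
  psi2_z : ∀ i (w : EuclideanSpace ℝ (Fin p)), ‖w‖ = 1 →
    psi2Norm P (fun ω => ∑ j, M.z i ω j * w j) ≤ ENNReal.ofReal K
  symm_Sigma : M.Sigma.IsSymm
  eigenvalues_Sigma : ∀ r ∈ spectrum ℝ M.Sigma, Cmin ≤ r ∧ r ≤ Cmax

/-- The noise variables are subgaussian with parameter `1`: `E exp (t ε_i) ≤ exp (t ^ 2 / 2)`. -/
def SubgaussianNoise [MeasurableSpace Ω] (P : Measure Ω) : Prop :=
  ∀ i, HasSubgaussianMGF (M.eps i) 1 P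

/-- `b` is a strict local minimizer of the objective, vanishes outside `S`, and is within
`c₃ √(exp (√(c₂ log n)) log s / n)` of the true parameter on `S` in the sup norm, `s = |S|`. -/
def IsOracleLocalMin (a l c₂ c₃ : ℝ) (ω : Ω) (b : EuclideanSpace ℝ (Fin p)) : Prop :=
  IsStrictLocalMin (M.objective a l ω) b ∧
  (∀ j ∉ M.S, b j = 0) ∧
  ∀ j ∈ M.S, |b j - M.beta j| ≤
    c₃ * Real.sqrt (Real.exp (Real.sqrt (c₂ * Real.log n)) * Real.log (M.S.card : ℝ) / n)

end Model

/-- The regularity condition on the weighted Gram matrices `D_SS` along a sequence of models: with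
probability tending to one, all their eigenvalues lie between constants `0 ≤ Dmin` and
`Dmax ≤ ∞`, and `‖D_SS - E D_SS‖₂ = o_P(1)` in the spectral norm. -/
def WeightedGramRegular {p : ℕ → ℕ} {Ω : ℕ → Type*} [∀ n, MeasurableSpace (Ω n)]
    (P : ∀ n, Measure (Ω n)) (M : ∀ n, Model n (p n) (Ω n)) : Prop :=
  (∃ Dmin Dmax : ℝ≥0∞,
    Tendsto (fun n => P n {ω | ∀ r ∈ spectrum ℝ ((M n).DSS ω), ENNReal.ofReal r ≤ Dmax})
      atTop (𝓝 1) ∧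
    Tendsto (fun n => P n {ω | ∀ r ∈ spectrum ℝ ((M n).DSS ω), Dmin ≤ ENNReal.ofReal r})
      atTop (𝓝 1)) ∧
  ∀ δ : ℝ, 0 < δ →
    Tendsto (fun n => P n {ω | δ <
      ‖Matrix.toEuclideanCLM (𝕜 := ℝ) ((M n).DSS ω - (M n).meanDSS (P n))‖}) atTop (𝓝 0)

end Hippo

end

/-!
The estimator is the oracle: least squares on the true support `S`, zero elsewhere.

*Local minimality.* On `S` the signal exceeds `a λ` by a margin that dominates the estimation error,
so that the SCAD penalty is flat near every nonzero coordinate and the normal equations are the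
first order conditions. Off `S` the penalty has slope `λ` at the origin, hence it suffices that the
scores `x_j' (y - X b)` are smaller than `n λ` in absolute value; together with the injectivity of
`X_S` this makes the minimum strict (`isStrictLocalMin_of_score`). The residuals of the oracle are
the projection of the errors onto the orthogonal complement of the columns of `X_S`, so the score at
`j` is a weighted sum of the noise whose weights are the *projected* column `x_j` times the noise
scales (`sum_mul_residual_eq`). Projections do not increase norms, and therefore no
irrepresentability condition on the design is needed.

*Good designs.* The linear predictors `x_i' θ` are sub-Gaussian with a bounded parameter, so with
high probability all `n` error variances are at most `exp √(c₂ log n)`. This is the factor in the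
rates. Bernstein's inequality and a net with `5 ^ s` points show that `n⁻¹ X_S' X_S` is close to
`Σ_SS` in operator norm because `s / n → 0`, and that all columns have squared norm of order `n`
because `log p = o(n)` (`Model.measureReal_not_goodDesign_le`). Given a good design, which is
independent of the noise, union bounds over `S` for the errors and over all predictors for the
scores finish the proof of the first assertion (`Model.measureReal_not_isOracleLocalMin_le`).

*Asymptotic normality.* Given a good design, `v' (β̂_S - β_S)` is a weighted sum of the noise. Its
conditional variance is the sandwich of `n⁻¹ X_S' X_S` and `D_SS`, which is a small perturbation of
`ζ² / n` (`IsCoerciveMatrix.abs_sandwich_sub_le`). Here `ζ` is bounded away from zero: the mean of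
`D_SS` is coercive, since the exponential weights can only be small where `exp (-x_i' θ)` is large,
and the latter has bounded moments (`SubgaussianRows.isCoerciveMatrix_meanGram`). The largest weight
is of order `√(s log n exp √(c₂ log n) / n)`, which tends to zero as `s` is of order `n ^ α` with
`α < 1`. A third order expansion of characteristic functions
(`norm_integral_exp_sum_sub_le`) then gives a bound for fixed `n`
(`Model.norm_integral_exp_oracle_sub_le`), and Lévy's continuity theorem yields the limit.

With `L = 2 K √Cmax` and `Θ` a positive bound for `‖θ‖`, the constants are
`c₁ = 2 √(Cmax + L²)`, `c₂ = 2 (L Θ)²` and `c₃ = √(8 / Cmin)`.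
-/

namespace Hippo

/-! ### The penalty and the local minimizer -/

lemma scadDeriv_eq_min {a l : ℝ} (ha : 1 < a) (hl : 0 < l) (t : ℝ) :
    scadDeriv a l t = l * min 1 (max (a * l - t) 0 / ((a - 1) * l)) := by
  have h : 0 < (a - 1) * l := mul_pos (by linarith) hl
  unfold scadDeriv
  rcases le_or_gt t l with ht | ht
  · rw [if_pos ht, if_neg (not_lt.2 ht), min_eq_left]
    · ring
    · rw [le_div_iff₀ h]
      exact le_trans (by linarith) (le_max_left _ _)
  · rw [if_neg (not_le.2 ht), if_pos ht, min_eq_right]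
    · ring
    · rw [div_le_one h]
      exact max_le (by linarith) h.le

lemma continuous_scadDeriv {a l : ℝ} (ha : 1 < a) (hl : 0 < l) : Continuous (scadDeriv a l) := by
  rw [funext (scadDeriv_eq_min ha hl)]
  fun_prop

lemma scad_of_le {a l t : ℝ} (ht : 0 ≤ t) (htl : t ≤ l) : scad a l t = l * t := by
  have : ∫ u in (0 : ℝ)..t, scadDeriv a l u = ∫ _ in (0 : ℝ)..t, l := by
    refine intervalIntegral.integral_congr fun u hu ↦ ?_
    rw [Set.uIcc_of_le ht] at hu
    have hul : u ≤ l := hu.2.trans htl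
    simp [scadDeriv, hul, not_lt.2 hul]
  simp [scad, this, mul_comm]

lemma scad_eq_scad {a l s t : ℝ} (ha : 1 < a) (hl : 0 < l) (hs : a * l ≤ s) (ht : a * l ≤ t) :
    scad a l s = scad a l t := by
  have hi (u v : ℝ) : IntervalIntegrable (scadDeriv a l) volume u v :=
    (continuous_scadDeriv ha hl).intervalIntegrable u v
  have h0 : ∫ u in t..s, scadDeriv a l u = ∫ _ in t..s, (0 : ℝ) := by
    refine intervalIntegral.integral_congr fun u hu ↦ ?_
    have hu' : a * l ≤ u := (le_min ht hs).trans hu.1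
    change scadDeriv a l u = 0
    rw [scadDeriv_eq_min ha hl, max_eq_right (by linarith)]
    simp
  have := intervalIntegral.integral_interval_sub_left (hi 0 s) (hi 0 t)
  rw [h0, intervalIntegral.integral_zero] at this
  unfold scad
  linarith

/-- Sufficient conditions for a strict local minimizer of the SCAD objective: on `S` the point
solves the normal equations and lies in the region where the penalty is flat; off `S` it vanishes
and the score is strictly below the slope `l` of the penalty at the origin. -/
lemma isStrictLocalMin_of_score {n p : ℕ} (x : Fin n → Fin p → ℝ) (y : Fin n → ℝ) {a l : ℝ}
    (ha : 1 < a) (hl : 0 < l) (S : Finset (Fin p)) (b : EuclideanSpace ℝ (Fin p))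
    (h0 : ∀ j ∉ S, b j = 0) (hS : ∀ j ∈ S, a * l < |b j|)
    (hnormal : ∀ j ∈ S, ∑ i, x i j * (y i - ∑ k, x i k * b k) = 0)
    (hscore : ∀ j ∉ S, |∑ i, x i j * (y i - ∑ k, x i k * b k)| < n * l)
    (hinj : ∀ d : Fin p → ℝ, (∀ j ∉ S, d j = 0) → (∀ i, ∑ j, x i j * d j = 0) → d = 0) :
    IsStrictLocalMin (fun b : EuclideanSpace ℝ (Fin p) ↦
      ∑ i, (y i - ∑ j, x i j * b j) ^ 2 + 2 * (n : ℝ) * ∑ j, scad a l |b j|) b := by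
  have hcont (j : Fin p) : ContinuousAt (fun b' : EuclideanSpace ℝ (Fin p) ↦ |b' j|) b := by
    fun_prop
  have hev : ∀ᶠ b' in 𝓝 b, ∀ j, (j ∈ S → a * l < |b' j|) ∧ (j ∉ S → |b' j| < l) := by
    refine eventually_all.2 fun j ↦ ?_
    by_cases hj : j ∈ S
    · filter_upwards [(hcont j).eventually (lt_mem_nhds (hS j hj))] with b' hb'
      exact ⟨fun _ ↦ hb', fun h ↦ absurd hj h⟩
    · have : |b j| < l := by rw [h0 j hj, abs_zero]; exact hl
      filter_upwards [(hcont j).eventually (gt_mem_nhds this)] with b' hb'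
      exact ⟨fun h ↦ absurd h hj, fun _ ↦ hb'⟩
  unfold IsStrictLocalMin
  filter_upwards [nhdsWithin_le_nhds hev, self_mem_nhdsWithin] with b' hb' hne
  set r : Fin n → ℝ := fun i ↦ y i - ∑ k, x i k * b k with hr
  set d : Fin p → ℝ := fun j ↦ b' j - b j with hd
  have hres (i : Fin n) : y i - ∑ j, x i j * b' j = r i - ∑ j, x i j * d j := by
    simp only [hr, hd, mul_sub, Finset.sum_sub_distrib]
    ring
  set c : Fin p → ℝ := fun j ↦ ∑ i, x i j * r i with hc
  have hcross : ∑ i, r i * ∑ j, x i j * d j = ∑ j, d j * c j := by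
    simp only [hc, Finset.mul_sum]
    rw [Finset.sum_comm]
    exact Finset.sum_congr rfl fun j _ ↦ Finset.sum_congr rfl fun i _ ↦ by ring
  have hpen (j : Fin p) : scad a l |b' j| - scad a l |b j| = if j ∈ S then 0 else l * |d j| := by
    by_cases hj : j ∈ S
    · rw [if_pos hj, scad_eq_scad ha hl ((hb' j).1 hj).le (hS j hj).le, sub_self]
    · rw [if_neg hj, scad_of_le (abs_nonneg _) ((hb' j).2 hj).le, h0 j hj, abs_zero,
        scad_of_le le_rfl hl.le]
      simp [hd, h0 j hj]
  have hdiff : (∑ i, (y i - ∑ j, x i j * b' j) ^ 2 + 2 * (n : ℝ) * ∑ j, scad a l |b' j|) -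
      (∑ i, (r i) ^ 2 + 2 * (n : ℝ) * ∑ j, scad a l |b j|) =
      ∑ i, (∑ j, x i j * d j) ^ 2 +
        2 * ∑ j, ((n : ℝ) * (if j ∈ S then 0 else l * |d j|) - d j * c j) := by
    rw [Finset.sum_sub_distrib, ← hcross, ← Finset.mul_sum, ← Finset.sum_congr rfl
      fun j _ ↦ hpen j, Finset.sum_sub_distrib]
    have : ∑ i, (y i - ∑ j, x i j * b' j) ^ 2 = ∑ i, (r i) ^ 2 -
        2 * ∑ i, r i * ∑ j, x i j * d j + ∑ i, (∑ j, x i j * d j) ^ 2 := by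
      rw [Finset.mul_sum, ← Finset.sum_sub_distrib, ← Finset.sum_add_distrib]
      exact Finset.sum_congr rfl fun i _ ↦ by rw [hres]; ring
    rw [this]
    ring
  have hterm (j : Fin p) : 0 ≤ (n : ℝ) * (if j ∈ S then 0 else l * |d j|) - d j * c j := by
    by_cases hj : j ∈ S
    · have : c j = 0 := hnormal j hj
      simp [hj, this]
    · have h1 : |c j| ≤ n * l := (hscore j hj).le
      have h2 : d j * c j ≤ |d j| * (n * l) :=
        (le_abs_self _).trans (by rw [abs_mul]; gcongr)
      rw [if_neg hj]
      nlinarith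
  rw [← sub_pos, hdiff]
  have hq : 0 ≤ ∑ i, (∑ j, x i j * d j) ^ 2 := Finset.sum_nonneg fun i _ ↦ sq_nonneg _
  have hd0 : d ≠ 0 := by
    intro h
    apply hne
    ext j
    have := congrFun h j
    simp only [hd, Pi.zero_apply] at this
    linarith
  by_cases hsupp : ∀ j ∉ S, d j = 0
  · have : 0 < ∑ i, (∑ j, x i j * d j) ^ 2 := by
      refine lt_of_le_of_ne hq fun h ↦ hd0 (hinj d hsupp fun i ↦ ?_)
      have := (Finset.sum_eq_zero_iff_of_nonneg fun i _ ↦ sq_nonneg (∑ j, x i j * d j)).1 h.symm i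
        (Finset.mem_univ i)
      exact pow_eq_zero_iff (two_ne_zero) |>.1 this
    have := Finset.sum_nonneg fun j (_ : j ∈ Finset.univ) ↦ hterm j
    linarith
  · push Not at hsupp
    obtain ⟨j, hj, hdj⟩ := hsupp
    have : 0 < (n : ℝ) * (if j ∈ S then 0 else l * |d j|) - d j * c j := by
      have h1 : |c j| < n * l := hscore j hj
      have h2 : d j * c j < |d j| * (n * l) := (le_abs_self _).trans_lt (by
        rw [abs_mul]; exact mul_lt_mul_of_pos_left h1 (abs_pos.2 hdj))
      rw [if_neg hj]
      nlinarith
    have := Finset.sum_pos' (fun j (_ : j ∈ Finset.univ) ↦ hterm j) ⟨j, Finset.mem_univ j, this⟩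
    linarith

end Hippo

namespace Hippo

/-! ### Operator norms, nets and coercive matrices -/

section LinearAlgebra

variable {ι : Type*} [Fintype ι] [DecidableEq ι]

/-- The unit ball of a finite-dimensional space has a `1/2`-net with at most `5 ^ d` points. -/
lemma exists_finset_net (E : Type*) [NormedAddCommGroup E] [NormedSpace ℝ E]
    [FiniteDimensional ℝ E] :
    ∃ N : Finset E, N.card ≤ 5 ^ Module.finrank ℝ E ∧ (∀ c ∈ N, ‖c‖ ≤ 1) ∧
      ∀ v : E, ‖v‖ ≤ 1 → ∃ c ∈ N, ‖v - c‖ ≤ 1 / 2 := by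
  classical
  -- Maximal `1`-separated subsets of the ball of radius `2` are nets; rescale by `1/2`.
  set Q : Finset E → Prop := fun s ↦ (∀ c ∈ s, ‖c‖ ≤ 2) ∧ ∀ c ∈ s, ∀ d ∈ s, c ≠ d → 1 ≤ ‖c - d‖
    with hQ
  set R : ℕ → Prop := fun k ↦ ∃ s, Q s ∧ s.card = k with hR
  have hR0 : R 0 := ⟨∅, by simp [hQ], rfl⟩
  set k := Nat.findGreatest R (5 ^ Module.finrank ℝ E)
  obtain ⟨s, hs, hsk⟩ : R k := Nat.findGreatest_spec (Nat.zero_le _) hR0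
  have hnet (v : E) (hv : ‖v‖ ≤ 2) : ∃ c ∈ s, ‖v - c‖ ≤ 1 := by
    by_contra! h
    have hvs : v ∉ s := fun hvs ↦ by have := h v hvs; norm_num at this
    have hQ' : Q (insert v s) := by
      refine ⟨fun c hc ↦ ?_, fun c hc d hd hcd ↦ ?_⟩
      · rcases Finset.mem_insert.1 hc with rfl | hc
        exacts [hv, hs.1 c hc]
      · rcases Finset.mem_insert.1 hc with hc' | hc' <;> rcases Finset.mem_insert.1 hd with hd' | hd'
        · exact absurd (hc'.trans hd'.symm) hcd
        · rw [hc']; exact (h d hd').le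
        · rw [hd', norm_sub_rev]; exact (h c hc').le
        · exact hs.2 c hc' d hd' hcd
    have hcard := Besicovitch.card_le_of_separated _ hQ'.1 hQ'.2
    have := Nat.findGreatest_is_greatest (P := R) (k := k + 1) (Nat.lt_succ_self k)
      (by rw [Finset.card_insert_of_notMem hvs, hsk] at hcard; exact hcard)
    exact this ⟨_, hQ', by rw [Finset.card_insert_of_notMem hvs, hsk]⟩
  refine ⟨s.image fun c ↦ (1 / 2 : ℝ) • c, Finset.card_image_le.trans
    (Besicovitch.card_le_of_separated s hs.1 hs.2), fun c hc ↦ ?_, fun v hv ↦ ?_⟩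
  · obtain ⟨d, hd, rfl⟩ := Finset.mem_image.1 hc
    rw [norm_smul]
    have := hs.1 d hd
    norm_num
    linarith
  · obtain ⟨c, hc, hvc⟩ := hnet ((2 : ℝ) • v) (by rw [norm_smul]; norm_num; linarith)
    refine ⟨_, Finset.mem_image_of_mem _ hc, ?_⟩
    have : v - (1 / 2 : ℝ) • c = (1 / 2 : ℝ) • ((2 : ℝ) • v - c) := by
      rw [smul_sub, smul_smul]; norm_num
    rw [this, norm_smul]
    norm_num
    linarith

/-- The operator norm is at most four times the largest bilinear value on a `1/2`-net. -/
lemma opNorm_le_of_net {E : Type*} [NormedAddCommGroup E] [InnerProductSpace ℝ E]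
    (A : E →L[ℝ] E) (N : Finset E)
    (hnet : ∀ v : E, ‖v‖ ≤ 1 → ∃ c ∈ N, ‖v - c‖ ≤ 1 / 2) {m : ℝ} (hm : 0 ≤ m)
    (h : ∀ c ∈ N, ∀ d ∈ N, |inner ℝ c (A d)| ≤ m) : ‖A‖ ≤ 4 * m := by
  have h1 (d : E) (hd : d ∈ N) : ‖A d‖ ≤ 2 * m := by
    rcases eq_or_ne (A d) 0 with h0 | h0
    · rw [h0, norm_zero]; linarith
    have hpos : 0 < ‖A d‖ := norm_pos_iff.2 h0
    obtain ⟨c, hc, huc⟩ := hnet (‖A d‖⁻¹ • A d) (by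
      rw [norm_smul, norm_inv, norm_norm, inv_mul_cancel₀ hpos.ne'])
    have e1 : inner ℝ (‖A d‖⁻¹ • A d) (A d) = ‖A d‖ := by
      rw [real_inner_smul_left, real_inner_self_eq_norm_sq]
      field_simp
    have e2 : inner ℝ (‖A d‖⁻¹ • A d - c) (A d) ≤ 1 / 2 * ‖A d‖ :=
      (real_inner_le_norm _ _).trans (by gcongr)
    rw [inner_sub_left, e1] at e2
    have e3 := (le_abs_self _).trans (h c hc d hd)
    linarith
  have h2 : ‖A‖ ≤ 2 * m + 1 / 2 * ‖A‖ := by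
    refine A.opNorm_le_of_unit_norm (by positivity) fun v hv ↦ ?_
    obtain ⟨c, hc, hvc⟩ := hnet v hv.le
    calc ‖A v‖ = ‖A c + A (v - c)‖ := by rw [← map_add]; congr 2; abel
      _ ≤ ‖A c‖ + ‖A (v - c)‖ := norm_add_le _ _
      _ ≤ 2 * m + ‖A‖ * (1 / 2) := add_le_add (h1 c hc) (A.le_opNorm_of_le hvc)
      _ = 2 * m + 1 / 2 * ‖A‖ := by ring
  linarith

/-- The action of a square matrix on the Euclidean space. -/
noncomputable abbrev clm (A : Matrix ι ι ℝ) : EuclideanSpace ℝ ι →L[ℝ] EuclideanSpace ℝ ι :=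
  Matrix.toEuclideanCLM (𝕜 := ℝ) A

/-- All quadratic form values of `A` are at least `c` times the squared Euclidean norm. -/
def IsCoerciveMatrix (c : ℝ) (A : Matrix ι ι ℝ) : Prop :=
  ∀ q : EuclideanSpace ℝ ι, c * ‖q‖ ^ 2 ≤ inner ℝ q (clm A q)

lemma clm_mul_apply (A B : Matrix ι ι ℝ) (q : EuclideanSpace ℝ ι) :
    clm (A * B) q = clm A (clm B q) := by
  simp [clm, map_mul]

lemma abs_inner_clm_le (A : Matrix ι ι ℝ) (u v : EuclideanSpace ℝ ι) :
    |inner ℝ u (clm A v)| ≤ ‖clm A‖ * ‖u‖ * ‖v‖ := by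
  calc |inner ℝ u (clm A v)| ≤ ‖u‖ * ‖clm A v‖ := abs_real_inner_le_norm _ _
    _ ≤ ‖u‖ * (‖clm A‖ * ‖v‖) := by gcongr; exact (clm A).le_opNorm v
    _ = _ := by ring

namespace IsCoerciveMatrix

variable {c : ℝ} {A : Matrix ι ι ℝ}

lemma norm_le (h : IsCoerciveMatrix c A) (q : EuclideanSpace ℝ ι) :
    c * ‖q‖ ≤ ‖clm A q‖ := by
  rcases eq_or_ne q 0 with rfl | hq
  · simp
  have h1 := (h q).trans (real_inner_le_norm _ _)
  have hpos : 0 < ‖q‖ := norm_pos_iff.2 hq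
  refine le_of_mul_le_mul_left ?_ hpos
  nlinarith

lemma isUnit_det (h : IsCoerciveMatrix c A) (hc : 0 < c) : IsUnit A.det := by
  rw [← Matrix.isUnit_iff_isUnit_det, ← Matrix.mulVec_injective_iff_isUnit]
  intro u v huv
  have h1 := h.norm_le (WithLp.toLp 2 (u - v))
  rw [Matrix.toEuclideanCLM_toLp, Matrix.mulVec_sub, sub_eq_zero.2 huv] at h1
  have h2 : ‖(WithLp.toLp 2 (u - v) : EuclideanSpace ℝ ι)‖ ≤ 0 := by
    simp only [WithLp.toLp_zero, norm_zero] at h1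
    by_contra! hlt
    nlinarith
  have h3 := norm_le_zero_iff.1 h2
  have h4 : u - v = 0 := (WithLp.toLp_eq_zero 2).1 h3
  exact sub_eq_zero.1 h4

lemma clm_clm_inv (h : IsCoerciveMatrix c A) (hc : 0 < c) (q : EuclideanSpace ℝ ι) :
    clm A (clm A⁻¹ q) = q := by
  rw [← clm_mul_apply, Matrix.mul_nonsing_inv _ (h.isUnit_det hc)]
  simp [clm]

lemma norm_inv_le (h : IsCoerciveMatrix c A) (hc : 0 < c) (q : EuclideanSpace ℝ ι) :
    ‖clm A⁻¹ q‖ ≤ c⁻¹ * ‖q‖ := by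
  have := h.norm_le (clm A⁻¹ q)
  rw [h.clm_clm_inv hc] at this
  rw [inv_mul_eq_div, le_div_iff₀ hc]
  linarith

lemma of_close (h : IsCoerciveMatrix c A) {G : Matrix ι ι ℝ} {δ : ℝ} (hG : ‖clm (G - A)‖ ≤ δ)
    (hδ : δ ≤ c / 2) : IsCoerciveMatrix (c / 2) G := by
  intro q
  have h1 := abs_inner_clm_le (G - A) q q
  have h2 := h q
  have h3 : inner ℝ q (clm (G - A) q) = inner ℝ q (clm G q) - inner ℝ q (clm A q) := by
    simp [clm, map_sub, inner_sub_right]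
  have h4 : ‖clm (G - A)‖ * ‖q‖ * ‖q‖ ≤ c / 2 * ‖q‖ ^ 2 := by
    rw [mul_assoc, ← sq]
    gcongr
    exact hG.trans hδ
  rw [h3] at h1
  have := (abs_le.1 h1).1
  linarith

lemma norm_inv_sub_inv_le (h : IsCoerciveMatrix c A) (hc : 0 < c) {G : Matrix ι ι ℝ} {δ : ℝ}
    (hG : ‖clm (G - A)‖ ≤ δ) (hδ : δ ≤ c / 2) (q : EuclideanSpace ℝ ι) :
    ‖clm G⁻¹ q - clm A⁻¹ q‖ ≤ 2 / c ^ 2 * δ * ‖q‖ := by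
  have hcG := h.of_close hG hδ
  have hc2 : 0 < c / 2 := by linarith
  have hid : clm G⁻¹ q - clm A⁻¹ q = - clm G⁻¹ (clm (G - A) (clm A⁻¹ q)) := by
    have e1 : clm (G - A) (clm A⁻¹ q) = clm G (clm A⁻¹ q) - q := by
      conv_rhs => rw [← h.clm_clm_inv hc q]
      rw [h.clm_clm_inv hc]
      simp [clm, map_sub]
      exact h.clm_clm_inv hc q
    rw [e1, map_sub, ← clm_mul_apply, Matrix.nonsing_inv_mul _ (hcG.isUnit_det hc2)]
    simp [clm]
  rw [hid, norm_neg]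
  calc _ ≤ (c / 2)⁻¹ * ‖clm (G - A) (clm A⁻¹ q)‖ := hcG.norm_inv_le hc2 _
    _ ≤ (c / 2)⁻¹ * (δ * (c⁻¹ * ‖q‖)) := by
        gcongr
        exact (ContinuousLinearMap.le_of_opNorm_le _ hG _).trans
          (mul_le_mul_of_nonneg_left (h.norm_inv_le hc q) ((norm_nonneg _).trans hG))
    _ = _ := by field_simp

/-- Stability of the sandwich quadratic form `q' A⁻¹ B A⁻¹ q` under perturbation of both matrices. -/
lemma abs_sandwich_sub_le (h : IsCoerciveMatrix c A) (hc : 0 < c) {G B D : Matrix ι ι ℝ} {δ b : ℝ}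
    (hG : ‖clm (G - A)‖ ≤ δ) (hδ : δ ≤ c / 2) (hD : ‖clm (D - B)‖ ≤ δ) (hB : ‖clm B‖ ≤ b)
    {v : EuclideanSpace ℝ ι} (hv : ‖v‖ = 1) :
    |inner ℝ (clm G⁻¹ v) (clm D (clm G⁻¹ v)) - inner ℝ (clm A⁻¹ v) (clm B (clm A⁻¹ v))| ≤
      (4 / c ^ 2 + 6 * b / c ^ 3) * δ := by
  set q := clm G⁻¹ v
  set r := clm A⁻¹ v
  have hb : 0 ≤ b := (norm_nonneg _).trans hB
  have hδ0 : 0 ≤ δ := (norm_nonneg _).trans hG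
  have hq : ‖q‖ ≤ 2 / c := by
    have := (h.of_close hG hδ).norm_inv_le (by linarith) v
    rwa [hv, mul_one, inv_div] at this
  have hr : ‖r‖ ≤ 1 / c := by
    have := h.norm_inv_le hc v
    rwa [hv, mul_one, inv_eq_one_div c] at this
  have hqr : ‖q - r‖ ≤ 2 / c ^ 2 * δ := by
    have := h.norm_inv_sub_inv_le hc hG hδ v
    rwa [hv, mul_one] at this
  have hid : inner ℝ q (clm D q) - inner ℝ r (clm B r) =
      inner ℝ q (clm (D - B) q) + (inner ℝ (q - r) (clm B q) + inner ℝ r (clm B (q - r))) := by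
    simp only [clm, map_sub, inner_sub_right, inner_sub_left, _root_.sub_apply]
    ring
  rw [hid]
  have t1 : |inner ℝ q (clm (D - B) q)| ≤ δ * (2 / c) * (2 / c) :=
    (abs_inner_clm_le _ _ _).trans (by gcongr)
  have t2 : |inner ℝ (q - r) (clm B q)| ≤ b * (2 / c ^ 2 * δ) * (2 / c) :=
    (abs_inner_clm_le _ _ _).trans (by gcongr)
  have t3 : |inner ℝ r (clm B (q - r))| ≤ b * (1 / c) * (2 / c ^ 2 * δ) :=
    (abs_inner_clm_le _ _ _).trans (by gcongr)
  calc _ ≤ _ := (abs_add_le _ _).trans (add_le_add_right (abs_add_le _ _) _)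
    _ ≤ δ * (2 / c) * (2 / c) + (b * (2 / c ^ 2 * δ) * (2 / c) + b * (1 / c) * (2 / c ^ 2 * δ)) :=
        add_le_add t1 (add_le_add t2 t3)
    _ = _ := by field_simp; ring

end IsCoerciveMatrix

end LinearAlgebra

end Hippo

namespace Hippo

/-! ### Weighted Gram matrices and least squares -/

section LeastSquares

variable {ι : Type*} {n : ℕ}

/-- The weighted Gram matrix `n⁻¹ ∑ i, w_i r_i r_i'` of the rows `r_i`. -/
noncomputable def gram (r : Fin n → ι → ℝ) (w : Fin n → ℝ) : Matrix ι ι ℝ :=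
  Matrix.of fun j k ↦ (n : ℝ)⁻¹ * ∑ i, r i j * w i * r i k

/-- The vector `n⁻¹ ∑ i, y_i r_i`. -/
noncomputable def crossMoment (r : Fin n → ι → ℝ) (y : Fin n → ℝ) : EuclideanSpace ℝ ι :=
  WithLp.toLp 2 fun k ↦ (n : ℝ)⁻¹ * ∑ i, r i k * y i

lemma gram_isSymm (r : Fin n → ι → ℝ) (w : Fin n → ℝ) : (gram r w).IsSymm := by
  ext j k
  simp only [gram, Matrix.transpose_apply, Matrix.of_apply]
  congr 1
  exact Finset.sum_congr rfl fun i _ ↦ by ring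

variable [Fintype ι]

lemma inner_crossMoment (r : Fin n → ι → ℝ) (y : Fin n → ℝ) (u : EuclideanSpace ℝ ι) :
    inner ℝ u (crossMoment r y) = (n : ℝ)⁻¹ * ∑ i, (∑ j, r i j * u j) * y i := by
  simp only [crossMoment, PiLp.inner_apply, RCLike.inner_apply, conj_trivial, Finset.mul_sum,
    Finset.sum_mul]
  rw [Finset.sum_comm]
  exact Finset.sum_congr rfl fun i _ ↦ Finset.sum_congr rfl fun j _ ↦ by ring

variable [DecidableEq ι]

/-- The least squares coefficients of the responses `y` on the rows `r` (a junk value if the Gram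
matrix is singular). -/
noncomputable def leastSquares (r : Fin n → ι → ℝ) (y : Fin n → ℝ) : EuclideanSpace ℝ ι :=
  clm (gram r 1)⁻¹ (crossMoment r y)

lemma inner_clm_gram (r : Fin n → ι → ℝ) (w : Fin n → ℝ) (u v : EuclideanSpace ℝ ι) :
    inner ℝ u (clm (gram r w) v) =
      (n : ℝ)⁻¹ * ∑ i, (∑ j, r i j * u j) * w i * ∑ k, r i k * v k := by
  rw [Matrix.inner_toEuclideanCLM]
  simp only [dotProduct, Matrix.mulVec, gram, Matrix.of_apply, Finset.mul_sum, Finset.sum_mul]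
  rw [Finset.sum_comm' (s := Finset.univ) (t := fun _ ↦ Finset.univ) (t' := Finset.univ)
    (s' := fun _ ↦ Finset.univ) (by simp)]
  simp_rw [Finset.sum_comm (s := (Finset.univ : Finset ι)) (t := (Finset.univ : Finset (Fin n)))]
  refine Finset.sum_congr rfl fun i _ ↦ Finset.sum_congr rfl fun j _ ↦
    Finset.sum_congr rfl fun k _ ↦ by ring

lemma inner_clm_comm {A : Matrix ι ι ℝ} (hA : A.IsSymm) (u v : EuclideanSpace ℝ ι) :
    inner ℝ u (clm A v) = inner ℝ (clm A u) v := by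
  rw [real_inner_comm v, Matrix.inner_toEuclideanCLM, Matrix.inner_toEuclideanCLM,
    Matrix.dotProduct_mulVec, ← Matrix.mulVec_transpose, hA, dotProduct_comm]

lemma isSymm_inv {A : Matrix ι ι ℝ} (hA : A.IsSymm) : A⁻¹.IsSymm := by
  rw [Matrix.IsSymm, Matrix.transpose_nonsing_inv, hA]

lemma inner_clm_inv_comm {A : Matrix ι ι ℝ} (hA : A.IsSymm) (u v : EuclideanSpace ℝ ι) :
    inner ℝ u (clm A⁻¹ v) = inner ℝ (clm A⁻¹ u) v :=
  inner_clm_comm (isSymm_inv hA) u v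

lemma clm_leastSquares {r : Fin n → ι → ℝ} (hr : IsUnit (gram r 1).det) (y : Fin n → ℝ) :
    clm (gram r 1) (leastSquares r y) = crossMoment r y := by
  rw [leastSquares, ← clm_mul_apply, Matrix.mul_nonsing_inv _ hr]
  simp [clm]

/-- The normal equations. -/
lemma sum_mul_residual_leastSquares {r : Fin n → ι → ℝ} (hn : n ≠ 0) (hr : IsUnit (gram r 1).det)
    (y : Fin n → ℝ) (u : EuclideanSpace ℝ ι) :
    ∑ i, (∑ j, r i j * u j) * (y i - ∑ k, r i k * leastSquares r y k) = 0 := by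
  have h := congrArg (inner ℝ u) (clm_leastSquares hr y)
  rw [inner_clm_gram, inner_crossMoment] at h
  have h2 := mul_left_cancel₀ (inv_ne_zero (Nat.cast_ne_zero.2 hn)) h
  simp only [mul_sub, Finset.sum_sub_distrib]
  rw [← h2]
  simp

lemma leastSquares_add {r : Fin n → ι → ℝ} (hr : IsUnit (gram r 1).det)
    (b : EuclideanSpace ℝ ι) (e : Fin n → ℝ) :
    leastSquares r (fun i ↦ ∑ j, r i j * b j + e i) = b + leastSquares r e := by
  have h1 : crossMoment r (fun i ↦ ∑ j, r i j * b j + e i) =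
      clm (gram r 1) b + crossMoment r e := by
    refine ext_inner_left ℝ fun u ↦ ?_
    rw [inner_add_right, inner_clm_gram, inner_crossMoment, inner_crossMoment, ← mul_add,
      ← Finset.sum_add_distrib]
    congr 1
    exact Finset.sum_congr rfl fun i _ ↦ by simp [mul_add]
  rw [leastSquares, h1, map_add, ← clm_mul_apply, Matrix.nonsing_inv_mul _ hr]
  simp [clm, leastSquares]

lemma inner_leastSquares (r : Fin n → ι → ℝ) (e : Fin n → ℝ) (v : EuclideanSpace ℝ ι) :
    inner ℝ v (leastSquares r e) =
      ∑ i, (n : ℝ)⁻¹ * (∑ j, r i j * clm (gram r 1)⁻¹ v j) * e i := by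
  rw [leastSquares, inner_clm_inv_comm (gram_isSymm r 1), inner_crossMoment, Finset.mul_sum]
  exact Finset.sum_congr rfl fun i _ ↦ by ring

lemma sum_sq_coeff (r : Fin n → ι → ℝ) (s : Fin n → ℝ) (q : EuclideanSpace ℝ ι) :
    ∑ i, ((n : ℝ)⁻¹ * (∑ j, r i j * q j) * s i) ^ 2 =
      (n : ℝ)⁻¹ * inner ℝ q (clm (gram r fun i ↦ s i ^ 2) q) := by
  rw [inner_clm_gram, Finset.mul_sum, Finset.mul_sum]
  exact Finset.sum_congr rfl fun i _ ↦ by ring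

/-- The scores of the least squares residuals against a further column `ξ` are linear in the
responses, with the residuals of `ξ` as coefficients. -/
lemma sum_mul_residual_eq {r : Fin n → ι → ℝ} (hn : n ≠ 0) (ξ e : Fin n → ℝ) :
    ∑ i, ξ i * (e i - ∑ k, r i k * leastSquares r e k) =
      ∑ i, (ξ i - ∑ k, r i k * leastSquares r ξ k) * e i := by
  have h1 := inner_crossMoment r ξ (leastSquares r e)
  have h2 := inner_crossMoment r e (leastSquares r ξ)
  have h3 : inner ℝ (leastSquares r e) (crossMoment r ξ) =
      inner ℝ (leastSquares r ξ) (crossMoment r e) := by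
    rw [leastSquares, ← inner_clm_inv_comm (gram_isSymm r 1), real_inner_comm]
    rfl
  rw [h1, h2] at h3
  have h4 := mul_left_cancel₀ (inv_ne_zero (Nat.cast_ne_zero.2 hn)) h3
  simp only [mul_sub, sub_mul, Finset.sum_sub_distrib]
  rw [← h4]
  congr 1
  exact Finset.sum_congr rfl fun i _ ↦ by ring

lemma sum_sq_residual_le {r : Fin n → ι → ℝ} (hn : n ≠ 0) (hr : IsUnit (gram r 1).det)
    (ξ : Fin n → ℝ) :
    ∑ i, (ξ i - ∑ k, r i k * leastSquares r ξ k) ^ 2 ≤ ∑ i, ξ i ^ 2 := by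
  have h := sum_mul_residual_leastSquares hn hr ξ (leastSquares r ξ)
  have h2 : ∑ i, ξ i ^ 2 = ∑ i, (ξ i - ∑ k, r i k * leastSquares r ξ k) ^ 2 +
      2 * ∑ i, (∑ j, r i j * leastSquares r ξ j) * (ξ i - ∑ k, r i k * leastSquares r ξ k) +
      ∑ i, (∑ k, r i k * leastSquares r ξ k) ^ 2 := by
    rw [Finset.mul_sum, ← Finset.sum_add_distrib, ← Finset.sum_add_distrib]
    exact Finset.sum_congr rfl fun i _ ↦ by ring
  rw [h2, h, mul_zero, add_zero]
  exact le_add_of_nonneg_right (Finset.sum_nonneg fun i _ ↦ sq_nonneg _)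

end LeastSquares

namespace Model

variable {n p : ℕ} {Ω : Type*} (M : Model n p Ω)

/-- The rows of the design restricted to the support of the mean parameter. -/
noncomputable def xS (ω : Ω) (i : Fin n) (j : M.S) : ℝ := M.x i ω j

/-- The heteroscedastic errors `exp (x_i' θ / 2) ε_i`. -/
noncomputable def err (ω : Ω) (i : Fin n) : ℝ := Real.exp (M.logVar i ω / 2) * M.eps i ω

/-- The mean parameter restricted to its support. -/
noncomputable def betaS : EuclideanSpace ℝ M.S := WithLp.toLp 2 fun j ↦ M.beta j

open Classical in
/-- The oracle estimator: least squares on the true support, zero elsewhere. -/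
noncomputable def oracle (ω : Ω) : EuclideanSpace ℝ (Fin p) :=
  WithLp.toLp 2 fun j ↦
    if h : j ∈ M.S then leastSquares (M.xS ω) (fun i ↦ M.y i ω) ⟨j, h⟩ else 0

lemma oracle_of_mem (ω : Ω) (j : M.S) :
    M.oracle ω j = leastSquares (M.xS ω) (fun i ↦ M.y i ω) j := by
  simp [oracle]

lemma oracle_of_notMem (ω : Ω) {j : Fin p} (h : j ∉ M.S) : M.oracle ω j = 0 := by
  simp [oracle, h]

lemma sum_eq_sum_S {f : Fin p → ℝ} (g : Fin p → ℝ) (hf : ∀ j ∉ M.S, f j = 0) :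
    ∑ j, g j * f j = ∑ j : M.S, g j * f j := by
  rw [Finset.sum_coe_sort M.S fun j ↦ g j * f j]
  exact (Finset.sum_subset (Finset.subset_univ M.S) fun j _ hj ↦ by rw [hf j hj, mul_zero]).symm

lemma y_eq (ω : Ω) (i : Fin n) : M.y i ω = ∑ j, M.xS ω i j * M.betaS j + M.err ω i := by
  have h : ∀ j ∉ M.S, M.beta j = 0 := fun j hj ↦ by simpa [S] using hj
  rw [y, M.sum_eq_sum_S (M.x i ω) h]
  rfl

lemma leastSquares_y (ω : Ω) (hr : IsUnit (gram (M.xS ω) 1).det) :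
    leastSquares (M.xS ω) (fun i ↦ M.y i ω) = M.betaS + leastSquares (M.xS ω) (M.err ω) := by
  rw [funext (M.y_eq ω), leastSquares_add hr]

lemma oracle_sub (ω : Ω) (hr : IsUnit (gram (M.xS ω) 1).det) (j : M.S) :
    M.oracle ω j - M.beta j = leastSquares (M.xS ω) (M.err ω) j := by
  rw [oracle_of_mem, leastSquares_y _ _ hr]
  simp [betaS]

/-- Deterministic part of the oracle property: the oracle estimator is a strict local minimizer
as soon as its errors on the support and the residual scores off the support are small. -/
lemma isOracleLocalMin_oracle (ω : Ω) {a l c₂ c₃ : ℝ} (ha : 1 < a) (hl : 0 < l) (hn : n ≠ 0)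
    (hr : IsUnit (gram (M.xS ω) 1).det)
    (hτ : ∀ j : M.S, |leastSquares (M.xS ω) (M.err ω) j| ≤
      c₃ * Real.sqrt (Real.exp (Real.sqrt (c₂ * Real.log n)) * Real.log (M.S.card : ℝ) / n))
    (hβ : ∀ j ∈ M.S, a * l + c₃ * Real.sqrt (Real.exp (Real.sqrt (c₂ * Real.log n)) *
      Real.log (M.S.card : ℝ) / n) < |M.beta j|)
    (hscore : ∀ j ∉ M.S, |∑ i, (M.x i ω j - ∑ k, M.xS ω i k *
      leastSquares (M.xS ω) (fun i ↦ M.x i ω j) k) * M.err ω i| < n * l) :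
    M.IsOracleLocalMin a l c₂ c₃ ω (M.oracle ω) := by
  have hsum (i : Fin n) : ∑ k, M.x i ω k * M.oracle ω k =
      ∑ k, M.xS ω i k * leastSquares (M.xS ω) (fun i ↦ M.y i ω) k := by
    rw [M.sum_eq_sum_S (M.x i ω) fun j hj ↦ M.oracle_of_notMem ω hj]
    exact Finset.sum_congr rfl fun k _ ↦ by rw [oracle_of_mem]; rfl
  have hdev (j : M.S) := hτ j
  simp_rw [← M.oracle_sub ω hr] at hdev
  refine ⟨isStrictLocalMin_of_score (fun i ↦ M.x i ω) (fun i ↦ M.y i ω) ha hl M.S _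
    (fun j hj ↦ M.oracle_of_notMem ω hj) (fun j hj ↦ ?_) (fun j hj ↦ ?_) (fun j hj ↦ ?_)
    (fun d hd hxd ↦ ?_), fun j hj ↦ M.oracle_of_notMem ω hj, fun j hj ↦ hdev ⟨j, hj⟩⟩
  · have h1 := hdev ⟨j, hj⟩
    have h2 := abs_sub_abs_le_abs_sub (M.beta j) (M.oracle ω j)
    rw [abs_sub_comm] at h2
    have h3 := hβ j hj
    dsimp only at h1
    linarith
  · have h := sum_mul_residual_leastSquares hn hr (fun i ↦ M.y i ω)
      (EuclideanSpace.single (⟨j, hj⟩ : M.S) 1)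
    simp_rw [hsum]
    rw [← h]
    refine Finset.sum_congr rfl fun i _ ↦ ?_
    congr 1
    rw [Finset.sum_eq_single (⟨j, hj⟩ : M.S)]
    · simp [xS]
    · intro k _ hk
      simp [hk]
    · simp
  · convert hscore j hj using 2
    rw [← sum_mul_residual_eq hn]
    refine Finset.sum_congr rfl fun i _ ↦ ?_
    congr 1
    rw [hsum, leastSquares_y _ _ hr, M.y_eq]
    simp only [PiLp.add_apply, mul_add, Finset.sum_add_distrib]
    ring
  · set q : EuclideanSpace ℝ M.S := WithLp.toLp 2 fun j ↦ d j with hq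
    have hz : clm (gram (M.xS ω) 1) q = 0 := by
      refine ext_inner_left ℝ fun u ↦ ?_
      rw [inner_clm_gram, inner_zero_right]
      refine mul_eq_zero_of_right _ (Finset.sum_eq_zero fun i _ ↦ mul_eq_zero_of_right _ ?_)
      rw [← hxd i, M.sum_eq_sum_S (M.x i ω) hd]
      rfl
    have hq0 : q = 0 := by
      have := congrArg (clm (gram (M.xS ω) 1)⁻¹) hz
      rw [← clm_mul_apply, Matrix.nonsing_inv_mul _ hr, map_zero] at this
      simpa [clm] using this
    ext j
    by_cases hj : j ∈ M.S
    · exact congrFun (congrArg WithLp.ofLp hq0) (⟨j, hj⟩ : M.S)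
    · exact hd j hj

end Model

end Hippo

namespace Hippo

/-! ### Conditioning on the design -/

section Conditioning

variable {Ω 𝓧 𝓨 : Type*} [MeasurableSpace Ω] [MeasurableSpace 𝓧] [MeasurableSpace 𝓨]
  {P : Measure Ω} [IsProbabilityMeasure P] {X : Ω → 𝓧} {e : Ω → 𝓨}

/-- If `X` and `e` are independent and every section of `B` over `G` has small probability under
the law of `e`, then `(X, e)` is unlikely to lie in `B`. The set `G` need not be measurable. -/
lemma measureReal_prodMk_mem_le (hX : Measurable X) (he : Measurable e) (h : IndepFun X e P)
    {B : Set (𝓧 × 𝓨)} (hB : MeasurableSet B) {G : Set 𝓧} {r : ℝ} (hr0 : 0 ≤ r)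
    (hr : ∀ x ∈ G, P.real {ω | (x, e ω) ∈ B} ≤ r) :
    P.real {ω | (X ω, e ω) ∈ B} ≤ r + P.real {ω | X ω ∉ G} := by
  have hprod := (indepFun_iff_map_prod_eq_prod_map_map hX.aemeasurable he.aemeasurable).1 h
  have h1 : P {ω | (X ω, e ω) ∈ B} = ∫⁻ ω, P {ω' | (X ω, e ω') ∈ B} ∂P := by
    calc P {ω | (X ω, e ω) ∈ B} = P.map (fun ω ↦ (X ω, e ω)) B :=
          (Measure.map_apply (hX.prodMk he) hB).symm
      _ = ∫⁻ x, P.map e (Prod.mk x ⁻¹' B) ∂(P.map X) := by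
          have := Measure.isProbabilityMeasure_map (μ := P) he.aemeasurable
          rw [hprod, Measure.prod_apply hB]
      _ = ∫⁻ ω, P.map e (Prod.mk (X ω) ⁻¹' B) ∂P := by
          have := Measure.isProbabilityMeasure_map (μ := P) he.aemeasurable
          rw [lintegral_map (measurable_measure_prodMk_left hB) hX]
      _ = _ := by
          refine lintegral_congr fun ω ↦ ?_
          rw [Measure.map_apply he (measurable_prodMk_left hB)]
          rfl
  set N := toMeasurable P {ω | X ω ∉ G} with hN
  have hNm : MeasurableSet N := measurableSet_toMeasurable _ _
  have h2 : P {ω | (X ω, e ω) ∈ B} ≤ ENNReal.ofReal r + P {ω | X ω ∉ G} := by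
    calc _ = ∫⁻ ω, P {ω' | (X ω, e ω') ∈ B} ∂P := h1
      _ ≤ ∫⁻ ω, (ENNReal.ofReal r + N.indicator 1 ω) ∂P := by
          refine lintegral_mono fun ω ↦ ?_
          by_cases hω : X ω ∈ G
          · refine le_add_right ?_
            rw [← ENNReal.ofReal_toReal (measure_ne_top P {ω' | (X ω, e ω') ∈ B})]
            exact ENNReal.ofReal_le_ofReal (hr _ hω)
          · have : ω ∈ N := subset_toMeasurable P _ hω
            rw [Set.indicator_of_mem this]
            exact le_add_left prob_le_one
      _ = _ := by
          rw [lintegral_add_left measurable_const, lintegral_indicator_one hNm, hN,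
            measure_toMeasurable]
          simp
  have h3 := ENNReal.toReal_mono (by finiteness) h2
  rwa [ENNReal.toReal_add (by finiteness) (by finiteness), ENNReal.toReal_ofReal hr0] at h3

/-- The analogue of `measureReal_prodMk_mem_le` for bounded complex expectations. -/
lemma norm_integral_prodMk_sub_le (hX : Measurable X) (he : Measurable e) (h : IndepFun X e P)
    {F : 𝓧 × 𝓨 → ℂ} (hF : Measurable F) (hF1 : ∀ z, ‖F z‖ ≤ 1) {c : ℂ} (hc : ‖c‖ ≤ 1)
    {G : Set 𝓧} {r : ℝ} (hr0 : 0 ≤ r) (hr : ∀ x ∈ G, ‖∫ ω, F (x, e ω) ∂P - c‖ ≤ r) :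
    ‖∫ ω, F (X ω, e ω) ∂P - c‖ ≤ r + 2 * P.real {ω | X ω ∉ G} := by
  have hprod := (indepFun_iff_map_prod_eq_prod_map_map hX.aemeasurable he.aemeasurable).1 h
  have := Measure.isProbabilityMeasure_map (μ := P) he.aemeasurable
  have := Measure.isProbabilityMeasure_map (μ := P) hX.aemeasurable
  have hint : Integrable F ((P.map X).prod (P.map e)) :=
    Integrable.of_bound hF.aestronglyMeasurable 1 (ae_of_all _ hF1)
  have hm : StronglyMeasurable fun x ↦ ∫ y, F (x, y) ∂(P.map e) :=
    hF.stronglyMeasurable.integral_prod_right'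
  have hinner (x : 𝓧) : ∫ y, F (x, y) ∂(P.map e) = ∫ ω', F (x, e ω') ∂P :=
    integral_map he.aemeasurable (hF.comp measurable_prodMk_left).aestronglyMeasurable
  have h1 : ∫ ω, F (X ω, e ω) ∂P = ∫ ω, (∫ ω', F (X ω, e ω') ∂P) ∂P := by
    rw [← integral_map (hX.prodMk he).aemeasurable hF.aestronglyMeasurable, hprod,
      integral_prod _ hint, integral_map hX.aemeasurable hm.aestronglyMeasurable]
    simp_rw [hinner]
  set N := toMeasurable P {ω | X ω ∉ G} with hN
  have hNm : MeasurableSet N := measurableSet_toMeasurable _ _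
  have hmeas : Measurable fun ω ↦ ∫ ω', F (X ω, e ω') ∂P := by
    simp_rw [← hinner]
    exact hm.measurable.comp hX
  have hle1 (ω : Ω) : ‖∫ ω', F (X ω, e ω') ∂P‖ ≤ 1 := by
    have := norm_integral_le_of_norm_le_const (μ := P) (f := fun ω' ↦ F (X ω, e ω'))
      (ae_of_all _ fun ω' ↦ hF1 _)
    simpa using this
  have hint2 : Integrable (fun ω ↦ ∫ ω', F (X ω, e ω') ∂P) P :=
    Integrable.of_bound hmeas.aestronglyMeasurable 1 (ae_of_all _ hle1)
  have h2 : ∫ ω, F (X ω, e ω) ∂P - c = ∫ ω, ((∫ ω', F (X ω, e ω') ∂P) - c) ∂P := by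
    rw [integral_sub hint2 (integrable_const _), h1]
    simp
  have hbd : Integrable (fun ω ↦ r + 2 * N.indicator (1 : Ω → ℝ) ω) P :=
    (integrable_const _).add (((integrable_const (1 : ℝ)).indicator hNm).const_mul 2)
  rw [h2]
  refine (norm_integral_le_of_norm_le hbd (ae_of_all _ fun ω ↦ ?_)).trans_eq ?_
  · by_cases hω : X ω ∈ G
    · exact (hr _ hω).trans (le_add_of_nonneg_right
        (mul_nonneg zero_le_two (Set.indicator_nonneg (fun _ _ ↦ zero_le_one) _)))
    · have : ω ∈ N := subset_toMeasurable P _ hω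
      rw [Set.indicator_of_mem this]
      calc _ ≤ _ := norm_sub_le _ _
        _ ≤ 1 + 1 := add_le_add (hle1 ω) hc
        _ ≤ _ := by simp; linarith
  · have hN2 : Integrable (fun ω ↦ 2 * N.indicator (1 : Ω → ℝ) ω) P :=
      ((integrable_const (1 : ℝ)).indicator hNm).const_mul 2
    rw [integral_add (integrable_const _) hN2,
      integral_const_mul, integral_indicator_one hNm, hN, measureReal_def P (toMeasurable _ _),
      measure_toMeasurable]
    simp [measureReal_def]

end Conditioning

/-! ### Weighted sums of the noise -/

section Noise

variable {Ω : Type*} [MeasurableSpace Ω] {P : Measure Ω} [IsProbabilityMeasure P] {n : ℕ}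
  {eps : Fin n → Ω → ℝ}

/-- Sub-Gaussian tail of a weighted sum of independent sub-Gaussian variables. -/
lemma measureReal_abs_sum_ge_le (hind : iIndepFun eps P) (hsub : ∀ i, HasSubgaussianMGF (eps i) 1 P)
    {a : Fin n → ℝ} {σ2 : ℝ} (hσ : 0 < σ2) (ha : ∑ i, a i ^ 2 ≤ σ2) {t : ℝ} (ht : 0 ≤ t) :
    P.real {ω | t ≤ |∑ i, a i * eps i ω|} ≤ 2 * Real.exp (-t ^ 2 / (2 * σ2)) := by
  have key (a : Fin n → ℝ) (ha : ∑ i, a i ^ 2 ≤ σ2) :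
      P.real {ω | t ≤ ∑ i, a i * eps i ω} ≤ Real.exp (-t ^ 2 / (2 * σ2)) := by
    have hind' : iIndepFun (fun i ω ↦ a i * eps i ω) P :=
      hind.comp (fun i x ↦ a i * x) fun i ↦ measurable_const_mul _
    have hterm (i : Fin n) :
        HasSubgaussianMGF (fun ω ↦ a i * eps i ω) (a i ^ 2).toNNReal P := by
      convert (hsub i).const_mul (a i) using 1
      refine NNReal.eq ?_
      rw [Real.coe_toNNReal _ (sq_nonneg _)]
      exact (mul_one _).symm
    have h1 := HasSubgaussianMGF.sum_of_iIndepFun hind' (s := Finset.univ) fun i _ ↦ hterm i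
    have hc : ∑ i, (a i ^ 2).toNNReal ≤ σ2.toNNReal := by
      rw [← Real.toNNReal_sum_of_nonneg fun i _ ↦ sq_nonneg (a i)]
      exact Real.toNNReal_le_toNNReal ha
    have h2 : HasSubgaussianMGF (fun ω ↦ ∑ i, a i * eps i ω) σ2.toNNReal P :=
      ⟨h1.integrable_exp_mul, fun s ↦ (h1.mgf_le s).trans (by gcongr)⟩
    have h3 := h2.measure_ge_le ht
    rwa [Real.coe_toNNReal _ hσ.le] at h3
  have hneg := key (fun i ↦ - a i) (by simpa using ha)
  have hsubset : {ω | t ≤ |∑ i, a i * eps i ω|} ⊆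
      {ω | t ≤ ∑ i, a i * eps i ω} ∪ {ω | t ≤ ∑ i, -a i * eps i ω} := by
    intro ω hω
    rcases le_abs.1 (show t ≤ |∑ i, a i * eps i ω| from hω) with h | h
    · exact Or.inl h
    · exact Or.inr (by simpa using h)
  calc _ ≤ _ := measureReal_mono hsubset
    _ ≤ _ := measureReal_union_le _ _
    _ ≤ _ := by linarith [key a ha]

/-- Conditional union bound: weighted sums of the noise whose weights depend on an independent
design are uniformly small if the sums of squared weights are small for good designs. -/
lemma measureReal_exists_abs_sum_ge_le {𝓧 κ : Type*} [MeasurableSpace 𝓧] [Fintype κ] {X : Ω → 𝓧}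
    (hX : Measurable X) (hmeas : ∀ i, Measurable (eps i))
    (hXe : IndepFun X (fun ω i ↦ eps i ω) P)
    (hind : iIndepFun eps P) (hsub : ∀ i, HasSubgaussianMGF (eps i) 1 P)
    {A : κ → 𝓧 → Fin n → ℝ} (hA : ∀ k i, Measurable fun x ↦ A k x i) {G : Set 𝓧} {σ2 : ℝ}
    (hσ : 0 < σ2) (hG : ∀ x ∈ G, ∀ k, ∑ i, A k x i ^ 2 ≤ σ2) {t : ℝ} (ht : 0 ≤ t) :
    P.real {ω | ∃ k, t ≤ |∑ i, A k (X ω) i * eps i ω|} ≤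
      Fintype.card κ * (2 * Real.exp (-t ^ 2 / (2 * σ2))) + P.real {ω | X ω ∉ G} := by
  refine measureReal_prodMk_mem_le (B := {z | ∃ k, t ≤ |∑ i, A k z.1 i * z.2 i|}) hX
    (measurable_pi_lambda _ hmeas) hXe ?_ (by positivity) fun x hx ↦ ?_
  · rw [Set.ofPred_exists]
    refine MeasurableSet.iUnion fun k ↦ measurableSet_le measurable_const ?_
    refine (Finset.measurable_fun_sum _ fun i _ ↦ ?_).abs
    exact ((hA k i).comp measurable_fst).mul ((measurable_pi_apply i).comp measurable_snd)
  · have : {ω | (x, fun i ↦ eps i ω) ∈ {z : 𝓧 × (Fin n → ℝ) |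
        ∃ k, t ≤ |∑ i, A k z.1 i * z.2 i|}} = ⋃ k, {ω | t ≤ |∑ i, A k x i * eps i ω|} := by
      ext ω; simp
    rw [this]
    refine (measureReal_iUnion_fintype_le _).trans ?_
    refine (Finset.sum_le_sum fun k _ ↦ measureReal_abs_sum_ge_le hind hsub hσ (hG x hx k) ht).trans
      (by simp)

end Noise

/-! ### A quantitative central limit theorem -/

section CLT

lemma norm_exp_mul_I_sub_le (x : ℝ) :
    ‖Complex.exp (x * Complex.I) - (1 + x * Complex.I - x ^ 2 / 2)‖ ≤ 4 * |x| ^ 3 := by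
  rcases le_or_gt |x| 1 with hx | hx
  · have h := Complex.exp_bound (x := x * Complex.I) (by simpa using hx) (n := 3) (by norm_num)
    have e1 : ∑ m ∈ Finset.range 3, (x * Complex.I) ^ m / (m.factorial : ℂ) =
        1 + x * Complex.I - x ^ 2 / 2 := by
      simp [Finset.sum_range_succ, mul_pow, Nat.factorial]
      ring
    rw [e1] at h
    refine h.trans ?_
    simp only [norm_mul, Complex.norm_real, Complex.norm_I, mul_one, Real.norm_eq_abs]
    rw [mul_comm]
    gcongr
    norm_num [Nat.factorial]
  · have e1 : ‖(1 + x * Complex.I - x ^ 2 / 2 : ℂ)‖ ≤ 1 + |x| + |x| ^ 2 / 2 := by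
      refine (norm_sub_le _ _).trans (add_le_add ((norm_add_le _ _).trans ?_) ?_)
      · simp
      · simp
    have e2 : ‖Complex.exp (x * Complex.I)‖ = 1 := Complex.norm_exp_ofReal_mul_I x
    refine (norm_sub_le _ _).trans ?_
    rw [e2]
    nlinarith [sq_nonneg (|x| - 1), sq_nonneg |x|, mul_pos (sub_pos.2 hx) (sub_pos.2 hx),
      mul_nonneg (abs_nonneg x) (sq_nonneg (|x| - 1))]

lemma abs_pow_three_le_exp (x : ℝ) : |x| ^ 3 ≤ 6 * (Real.exp x + Real.exp (-x)) := by
  have h1 := Real.pow_div_factorial_le_exp |x| (abs_nonneg x) 3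
  have h2 : Real.exp |x| ≤ Real.exp x + Real.exp (-x) := by
    rcases abs_cases x with ⟨h, _⟩ | ⟨h, _⟩ <;> rw [h] <;> linarith [Real.exp_pos x, Real.exp_pos (-x)]
  norm_num [Nat.factorial] at h1
  linarith

lemma abs_exp_neg_sub_exp_neg_le {x y : ℝ} (hx : 0 ≤ x) (hy : 0 ≤ y) :
    |Real.exp (-x) - Real.exp (-y)| ≤ |x - y| := by
  wlog h : x ≤ y generalizing x y
  · rw [abs_sub_comm, abs_sub_comm x]
    exact this hy hx (le_of_not_ge h)
  have h1 : Real.exp (-y) ≤ Real.exp (-x) := Real.exp_le_exp.2 (by linarith)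
  rw [abs_of_nonneg (by linarith), abs_of_nonpos (by linarith)]
  have h2 : Real.exp (-y) = Real.exp (-x) * Real.exp (-(y - x)) := by rw [← Real.exp_add]; ring_nf
  have h3 := Real.add_one_le_exp (-(y - x))
  have h4 : Real.exp (-x) ≤ 1 := Real.exp_le_one_iff.2 (by linarith)
  rw [h2]
  nlinarith [Real.exp_pos (-x)]

lemma norm_prod_sub_prod_le {ι : Type*} (s : Finset ι) (z w : ι → ℂ) (hz : ∀ i, ‖z i‖ ≤ 1)
    (hw : ∀ i, ‖w i‖ ≤ 1) : ‖∏ i ∈ s, z i - ∏ i ∈ s, w i‖ ≤ ∑ i ∈ s, ‖z i - w i‖ := by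
  classical
  induction s using Finset.induction_on with
  | empty => simp
  | insert i s hi ih =>
    rw [Finset.prod_insert hi, Finset.prod_insert hi, Finset.sum_insert hi]
    have h1 : z i * ∏ j ∈ s, z j - w i * ∏ j ∈ s, w j =
        (z i - w i) * ∏ j ∈ s, z j + w i * (∏ j ∈ s, z j - ∏ j ∈ s, w j) := by ring
    have h2 : ‖∏ j ∈ s, z j‖ ≤ 1 := by
      rw [norm_prod]
      exact Finset.prod_le_one (fun _ _ ↦ norm_nonneg _) fun j _ ↦ hz j
    rw [h1]
    refine (norm_add_le _ _).trans (add_le_add ?_ ?_)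
    · rw [norm_mul]
      exact mul_le_of_le_one_right (norm_nonneg _) h2
    · rw [norm_mul]
      exact (mul_le_of_le_one_left (norm_nonneg _) (hw i)).trans ih

variable {Ω : Type*} [MeasurableSpace Ω] {P : Measure Ω} [IsProbabilityMeasure P]

/-- Third order expansion of the characteristic function of a standardized sub-Gaussian variable,
with a constant that does not depend on the distribution. -/
lemma norm_integral_exp_sub_le {Y : Ω → ℝ} (hY : Measurable Y) (hsub : HasSubgaussianMGF Y 1 P)
    (h0 : ∫ ω, Y ω ∂P = 0) (h1 : ∫ ω, Y ω ^ 2 ∂P = 1) (s : ℝ) :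
    ‖∫ ω, Complex.exp ((s * Y ω : ℝ) * Complex.I) ∂P - Real.exp (-(s ^ 2 / 2))‖ ≤
      200 * |s| ^ 3 := by
  have hiY : Integrable Y P := hsub.integrable
  have hiY2 : Integrable (fun ω ↦ Y ω ^ 2) P := by
    have := hsub.memLp 2
    exact this.integrable_sq
  have hexp (u : ℝ) : Integrable (fun ω ↦ Real.exp (u * Y ω)) P := hsub.integrable_exp_mul u
  have hie : Integrable (fun ω ↦ 6 * (Real.exp (Y ω) + Real.exp (-Y ω))) P := by
    have a1 := hexp 1
    have a2 := hexp (-1)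
    simp only [one_mul, neg_mul] at a1 a2
    exact (a1.add a2).const_mul 6
  have h3 : ∫ ω, 6 * (Real.exp (Y ω) + Real.exp (-Y ω)) ∂P ≤ 36 := by
    have a1 := hexp 1
    have a2 := hexp (-1)
    have b1 := hsub.mgf_le 1
    have b2 := hsub.mgf_le (-1)
    simp only [mgf, one_mul, neg_mul] at a1 a2 b1 b2
    rw [integral_const_mul, integral_add a1 a2]
    have e : Real.exp ((1 : ℝ≥0) * 1 ^ 2 / 2) ≤ 3 := by
      have := Real.exp_one_lt_d9
      exact (Real.exp_le_exp.2 (by norm_num)).trans (this.le.trans (by norm_num))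
    have e' : Real.exp ((1 : ℝ≥0) * (-1) ^ 2 / 2) ≤ 3 := by simpa using e
    linarith
  have hF : Integrable (fun ω ↦ Complex.exp ((s * Y ω : ℝ) * Complex.I)) P :=
    Integrable.of_bound (by fun_prop) 1
      (ae_of_all _ fun ω ↦ (Complex.norm_exp_ofReal_mul_I _).le)
  have hT : Integrable (fun ω ↦ (1 + (s * Y ω : ℝ) * Complex.I - (s * Y ω : ℝ) ^ 2 / 2 : ℂ)) P := by
    refine ((integrable_const _).add ((hiY.const_mul s).ofReal.mul_const _)).sub ?_
    have := (hiY2.const_mul (s ^ 2 / 2)).ofReal (𝕜 := ℂ)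
    refine this.congr (ae_of_all _ fun ω ↦ ?_)
    change ((s ^ 2 / 2 * Y ω ^ 2 : ℝ) : ℂ) = _
    push_cast
    ring
  have hTint : ∫ ω, (1 + (s * Y ω : ℝ) * Complex.I - (s * Y ω : ℝ) ^ 2 / 2 : ℂ) ∂P =
      ((1 - s ^ 2 / 2 : ℝ) : ℂ) := by
    have e1 : ∀ ω, (1 + (s * Y ω : ℝ) * Complex.I - (s * Y ω : ℝ) ^ 2 / 2 : ℂ) =
        1 + ((s * Y ω : ℝ) : ℂ) * Complex.I - ((s ^ 2 / 2 * Y ω ^ 2 : ℝ) : ℂ) := by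
      intro ω; push_cast; ring
    simp_rw [e1]
    rw [integral_sub ((integrable_const _).add ((hiY.const_mul s).ofReal.mul_const _))
      (hiY2.const_mul (s ^ 2 / 2)).ofReal, integral_add (integrable_const _)
      ((hiY.const_mul s).ofReal.mul_const _), integral_mul_const, integral_complex_ofReal,
      integral_complex_ofReal, integral_const_mul, integral_const_mul, h0, h1]
    simp
  have hbound : ‖∫ ω, Complex.exp ((s * Y ω : ℝ) * Complex.I) ∂P - ((1 - s ^ 2 / 2 : ℝ) : ℂ)‖ ≤
      144 * |s| ^ 3 := by
    rw [← hTint, ← integral_sub hF hT]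
    calc _ ≤ ∫ ω, 4 * |s| ^ 3 * (6 * (Real.exp (Y ω) + Real.exp (-Y ω))) ∂P := by
          refine norm_integral_le_of_norm_le (hie.const_mul _) (ae_of_all _ fun ω ↦ ?_)
          refine (norm_exp_mul_I_sub_le (s * Y ω)).trans ?_
          rw [abs_mul, mul_pow, mul_assoc]
          gcongr
          exact abs_pow_three_le_exp _
      _ ≤ 4 * |s| ^ 3 * 36 := by rw [integral_const_mul]; gcongr
      _ = _ := by ring
  have hgauss : |1 - s ^ 2 / 2 - Real.exp (-(s ^ 2 / 2))| ≤ 4 * |s| ^ 3 := by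
    have e0 : s ^ 2 = |s| ^ 2 := (sq_abs s).symm
    have e1 := Real.add_one_le_exp (-(s ^ 2 / 2))
    rw [abs_sub_comm, abs_of_nonneg (by linarith)]
    rcases le_or_gt |s| 1 with hs | hs
    · have e2 : |-(s ^ 2 / 2)| ≤ 1 := by
        rw [abs_neg, abs_of_nonneg (by positivity), e0]
        nlinarith [abs_nonneg s]
      have e3 := (abs_le.1 (Real.abs_exp_sub_one_sub_id_le e2)).2
      have e4 : (-(s ^ 2 / 2)) ^ 2 ≤ |s| ^ 3 := by
        rw [e0]
        have : (-(|s| ^ 2 / 2)) ^ 2 = |s| ^ 3 * (|s| / 4) := by ring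
        rw [this]
        exact mul_le_of_le_one_right (by positivity) (by linarith)
      have : 0 ≤ |s| ^ 3 := by positivity
      linarith
    · have e2 : Real.exp (-(s ^ 2 / 2)) ≤ 1 := Real.exp_le_one_iff.2 (by
        have := sq_nonneg s; linarith)
      have e3 : |s| ^ 2 ≤ |s| ^ 3 := pow_le_pow_right₀ hs.le (by norm_num)
      rw [e0] at *
      have : 0 ≤ |s| ^ 3 := by positivity
      linarith
  have hsplit : ∫ ω, Complex.exp ((s * Y ω : ℝ) * Complex.I) ∂P - Real.exp (-(s ^ 2 / 2)) =
      (∫ ω, Complex.exp ((s * Y ω : ℝ) * Complex.I) ∂P - ((1 - s ^ 2 / 2 : ℝ) : ℂ)) +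
      ((1 - s ^ 2 / 2 - Real.exp (-(s ^ 2 / 2)) : ℝ) : ℂ) := by push_cast; ring
  rw [hsplit]
  refine (norm_add_le _ _).trans ?_
  rw [Complex.norm_real, Real.norm_eq_abs]
  have : 0 ≤ |s| ^ 3 := by positivity
  linarith

/-- Lindeberg's argument for a weighted sum of standardized sub-Gaussian variables: its
characteristic function is Gaussian up to an error controlled by the largest weight and by the
distance of the variance to `1`. -/
lemma norm_integral_exp_sum_sub_le {n : ℕ} {eps : Fin n → Ω → ℝ} (hmeas : ∀ i, Measurable (eps i))
    (hind : iIndepFun eps P) (hsub : ∀ i, HasSubgaussianMGF (eps i) 1 P)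
    (h0 : ∀ i, ∫ ω, eps i ω ∂P = 0) (h1 : ∀ i, ∫ ω, eps i ω ^ 2 ∂P = 1) (t : ℝ)
    {a : Fin n → ℝ} {A η : ℝ} (hA : ∀ i, |a i| ≤ A) (hA0 : 0 ≤ A) (hη : |∑ i, a i ^ 2 - 1| ≤ η) :
    ‖∫ ω, Complex.exp ((t * ∑ i, a i * eps i ω : ℝ) * Complex.I) ∂P - Real.exp (-(t ^ 2 / 2))‖ ≤
      200 * |t| ^ 3 * A * (1 + η) + t ^ 2 / 2 * η := by
  have hprod : ∫ ω, Complex.exp ((t * ∑ i, a i * eps i ω : ℝ) * Complex.I) ∂P =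
      ∏ i, ∫ ω, Complex.exp ((t * a i * eps i ω : ℝ) * Complex.I) ∂P := by
    have hind' : iIndepFun (fun i ω ↦ a i * eps i ω) P :=
      hind.comp (fun i x ↦ a i * x) fun i ↦ measurable_const_mul _
    have hm (i : Fin n) : Measurable fun ω ↦ a i * eps i ω := (hmeas i).const_mul _
    have h := congrFun (hind'.charFun_map_fun_sum_eq_prod fun i ↦ (hm i).aemeasurable) t
    rw [charFun_apply_real, integral_map (Finset.measurable_fun_sum _ fun i _ ↦ hm i).aemeasurable
      (by fun_prop), Finset.prod_apply] at h
    convert h using 1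
    · refine integral_congr_ae (ae_of_all _ fun ω ↦ ?_)
      simp
    · refine Finset.prod_congr rfl fun i _ ↦ ?_
      rw [charFun_apply_real, integral_map (hm i).aemeasurable (by fun_prop)]
      refine integral_congr_ae (ae_of_all _ fun ω ↦ ?_)
      push_cast
      ring_nf
  have hgauss : (Real.exp (-(t ^ 2 / 2 * ∑ i, a i ^ 2)) : ℂ) =
      ∏ i, (Real.exp (-((t * a i) ^ 2 / 2)) : ℂ) := by
    rw [← Complex.ofReal_prod, ← Real.exp_sum, Finset.mul_sum, ← Finset.sum_neg_distrib]
    congr 2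
    exact Finset.sum_congr rfl fun i _ ↦ by ring
  have hsum : 0 ≤ ∑ i, a i ^ 2 := Finset.sum_nonneg fun i _ ↦ sq_nonneg _
  have hsum' : ∑ i, a i ^ 2 ≤ 1 + η := by linarith [(abs_le.1 hη).2]
  have hstep1 : ‖∏ i, ∫ ω, Complex.exp ((t * a i * eps i ω : ℝ) * Complex.I) ∂P -
      ∏ i, (Real.exp (-((t * a i) ^ 2 / 2)) : ℂ)‖ ≤ 200 * |t| ^ 3 * A * (1 + η) := by
    refine (norm_prod_sub_prod_le _ _ _ (fun i ↦ ?_) fun i ↦ ?_).trans ?_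
    · have := norm_integral_le_of_norm_le_const (μ := P)
        (f := fun ω ↦ Complex.exp ((t * a i * eps i ω : ℝ) * Complex.I)) (C := 1)
        (ae_of_all _ fun ω ↦ (Complex.norm_exp_ofReal_mul_I _).le)
      simpa using this
    · rw [Complex.norm_real, Real.norm_of_nonneg (Real.exp_pos _).le, Real.exp_le_one_iff]
      have := sq_nonneg (t * a i)
      linarith
    · calc _ ≤ ∑ i, 200 * |t| ^ 3 * A * a i ^ 2 := by
            refine Finset.sum_le_sum fun i _ ↦
              (norm_integral_exp_sub_le (hmeas i) (hsub i) (h0 i) (h1 i) (t * a i)).trans ?_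
            have : |t * a i| ^ 3 = |t| ^ 3 * |a i| * a i ^ 2 := by
              rw [abs_mul, ← sq_abs (a i)]; ring
            rw [this]
            have : |t| ^ 3 * |a i| * a i ^ 2 ≤ |t| ^ 3 * A * a i ^ 2 := by
              gcongr
              exact hA i
            linarith
        _ = 200 * |t| ^ 3 * A * ∑ i, a i ^ 2 := by rw [Finset.mul_sum]
        _ ≤ _ := by gcongr
  have hstep2 : ‖(Real.exp (-(t ^ 2 / 2 * ∑ i, a i ^ 2)) : ℂ) - Real.exp (-(t ^ 2 / 2))‖ ≤
      t ^ 2 / 2 * η := by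
    rw [← Complex.ofReal_sub, Complex.norm_real, Real.norm_eq_abs]
    refine (abs_exp_neg_sub_exp_neg_le (by positivity) (by positivity)).trans ?_
    have : t ^ 2 / 2 * ∑ i, a i ^ 2 - t ^ 2 / 2 = t ^ 2 / 2 * (∑ i, a i ^ 2 - 1) := by ring
    rw [this, abs_mul, abs_of_nonneg (by positivity)]
    gcongr
  rw [hprod]
  refine (norm_sub_le_norm_sub_add_norm_sub _ (∏ i, (Real.exp (-((t * a i) ^ 2 / 2)) : ℂ)) _).trans
    (add_le_add hstep1 ?_)
  rw [← hgauss]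
  exact hstep2

end CLT

end Hippo

namespace Hippo

/-! ### Sub-Gaussian variables and Bernstein's inequality -/

section SubGaussian

variable {Ω : Type*} [MeasurableSpace Ω] {P : Measure Ω}

/-- The bound `E exp ((Y / L) ^ 2) ≤ 2` (including integrability), i.e. `L` is an upper bound for
the Orlicz norm of `Y` that is attained. -/
def ExpSqLE (P : Measure Ω) (L : ℝ) (Y : Ω → ℝ) : Prop :=
  Integrable (fun ω ↦ Real.exp ((Y ω / L) ^ 2)) P ∧ ∫ ω, Real.exp ((Y ω / L) ^ 2) ∂P ≤ 2

/-- A variable dominated by one with a bounded exponential square moment has one too. -/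
lemma ExpSqLE.mono {L L' : ℝ} {Y Z : Ω → ℝ} (hZ : ExpSqLE P L' Z) (hY : Measurable Y)
    (h : ∀ ω, (Y ω / L) ^ 2 ≤ (Z ω / L') ^ 2) : ExpSqLE P L Y := by
  have hi : Integrable (fun ω ↦ Real.exp ((Y ω / L) ^ 2)) P := by
    refine hZ.1.mono' (by fun_prop) (ae_of_all _ fun ω ↦ ?_)
    rw [Real.norm_of_nonneg (Real.exp_pos _).le]
    exact Real.exp_le_exp.2 (h ω)
  exact ⟨hi, (integral_mono hi hZ.1 fun ω ↦ Real.exp_le_exp.2 (h ω)).trans hZ.2⟩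

lemma expSqLE_of_psi2Norm_le {Y : Ω → ℝ} (hY : Measurable Y) {K : ℝ} (hK : 0 < K)
    (h : psi2Norm P Y ≤ ENNReal.ofReal K) : ExpSqLE P (2 * K) Y := by
  have h1 : psi2Norm P Y < ENNReal.ofReal (2 * K) :=
    h.trans_lt ((ENNReal.ofReal_lt_ofReal_iff (by linarith)).2 (by linarith))
  simp only [psi2Norm, iInf_lt_iff] at h1
  obtain ⟨c, hc, hcY, hlt⟩ := h1
  have hcK : (c : ℝ) < 2 * K := by
    rw [← ENNReal.ofReal_coe_nnreal] at hlt
    exact (ENNReal.ofReal_lt_ofReal_iff (by linarith)).1 hlt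
  have hc0 : (0 : ℝ) < c := hc
  have hZ : ExpSqLE P c Y := by
    simp only [sq_abs] at hcY
    have hm : AEStronglyMeasurable (fun ω ↦ Real.exp ((Y ω / c) ^ 2)) P := by fun_prop
    have hi : Integrable (fun ω ↦ Real.exp ((Y ω / c) ^ 2)) P :=
      (lintegral_ofReal_ne_top_iff_integrable hm (ae_of_all _ fun ω ↦ (Real.exp_pos _).le)).1
        (ne_top_of_le_ne_top (by finiteness) hcY)
    refine ⟨hi, ?_⟩
    rw [integral_eq_lintegral_of_nonneg_ae (ae_of_all _ fun ω ↦ (Real.exp_pos _).le) hm]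
    exact ENNReal.toReal_le_of_le_ofReal zero_le_two (by simpa using hcY)
  refine hZ.mono hY fun ω ↦ ?_
  rw [div_pow, div_pow]
  gcongr

lemma sq_le_mul_exp {y L : ℝ} (hL : 0 < L) : y ^ 2 ≤ L ^ 2 * Real.exp ((y / L) ^ 2) := by
  have h := Real.add_one_le_exp ((y / L) ^ 2)
  have h2 : y ^ 2 = L ^ 2 * (y / L) ^ 2 := by field_simp
  rw [h2]
  gcongr
  linarith

lemma exp_mul_exp_half_le (a b : ℝ) :
    Real.exp (a / 2) * Real.exp (b / 2) ≤ (Real.exp a + Real.exp b) / 2 := by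
  have h1 : Real.exp a = Real.exp (a / 2) ^ 2 := by rw [← Real.exp_nat_mul]; ring_nf
  have h2 : Real.exp b = Real.exp (b / 2) ^ 2 := by rw [← Real.exp_nat_mul]; ring_nf
  rw [h1, h2]
  nlinarith [sq_nonneg (Real.exp (a / 2) - Real.exp (b / 2))]

namespace ExpSqLE

variable {L : ℝ} {Y : Ω → ℝ}

lemma integrable_sq (h : ExpSqLE P L Y) (hL : 0 < L) (hY : Measurable Y) :
    Integrable (fun ω ↦ Y ω ^ 2) P := by
  refine (h.1.const_mul (L ^ 2)).mono' (by fun_prop) (ae_of_all _ fun ω ↦ ?_)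
  rw [Real.norm_of_nonneg (sq_nonneg _)]
  exact sq_le_mul_exp hL

lemma memLp_two (h : ExpSqLE P L Y) (hL : 0 < L) (hY : Measurable Y) : MemLp Y 2 P :=
  (memLp_two_iff_integrable_sq hY.aestronglyMeasurable).2 (h.integrable_sq hL hY)

lemma measureReal_le (h : ExpSqLE P L Y) (hL : 0 < L) (s : ℝ) :
    P.real {ω | L ^ 2 * s ≤ Y ω ^ 2} ≤ 2 * Real.exp (-s) := by
  have h1 := mul_meas_ge_le_integral_of_nonneg (ae_of_all P fun ω ↦ (Real.exp_pos ((Y ω / L) ^ 2)).le)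
    h.1 (Real.exp s)
  have h2 : {ω | L ^ 2 * s ≤ Y ω ^ 2} = {ω | Real.exp s ≤ Real.exp ((Y ω / L) ^ 2)} := by
    ext ω
    simp only [Set.mem_ofPred_eq, Real.exp_le_exp, div_pow]
    rw [le_div_iff₀ (by positivity), mul_comm]
  rw [h2, Real.exp_neg, ← div_eq_mul_inv, le_div_iff₀ (Real.exp_pos s), mul_comm]
  exact h1.trans h.2

lemma integrable_exp_abs_mul (h : ExpSqLE P L Y) {Z : Ω → ℝ} (hZ : ExpSqLE P L Z)
    (hY : Measurable Y) (hZm : Measurable Z) :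
    Integrable (fun ω ↦ Real.exp |Y ω * Z ω / L ^ 2|) P ∧
      ∫ ω, Real.exp |Y ω * Z ω / L ^ 2| ∂P ≤ 2 := by
  have hle (ω : Ω) : Real.exp |Y ω * Z ω / L ^ 2| ≤
      (Real.exp ((Y ω / L) ^ 2) + Real.exp ((Z ω / L) ^ 2)) / 2 := by
    refine le_trans ?_ (exp_mul_exp_half_le _ _)
    rw [← Real.exp_add]
    refine Real.exp_le_exp.2 ?_
    have : Y ω * Z ω / L ^ 2 = (Y ω / L) * (Z ω / L) := by ring
    rw [this, abs_mul, ← sq_abs (Y ω / L), ← sq_abs (Z ω / L)]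
    nlinarith [sq_nonneg (|Y ω / L| - |Z ω / L|)]
  have hbd := (h.1.add hZ.1).div_const 2
  have hi : Integrable (fun ω ↦ Real.exp |Y ω * Z ω / L ^ 2|) P := by
    refine hbd.mono' (by fun_prop) (ae_of_all _ fun ω ↦ ?_)
    rw [Real.norm_of_nonneg (Real.exp_pos _).le]
    exact hle ω
  refine ⟨hi, (integral_mono hi hbd hle).trans ?_⟩
  simp only [Pi.add_apply]
  rw [integral_div, integral_add h.1 hZ.1]
  linarith [h.2, hZ.2]

/-- Second moments of a sub-Gaussian variable under an exponentially tilted measure. -/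
lemma integrable_sq_mul_exp (h : ExpSqLE P L Y) (hL : 0 < L) (hY : Measurable Y) {L' : ℝ}
    {T : Ω → ℝ} (hT : ExpSqLE P L' T) (hL' : 0 < L') (hTm : Measurable T) :
    Integrable (fun ω ↦ Y ω ^ 2 * Real.exp (T ω)) P ∧
      ∫ ω, Y ω ^ 2 * Real.exp (T ω) ∂P ≤ 4 * L ^ 2 * Real.exp (L' ^ 2 / 2) := by
  have hle (ω : Ω) : Y ω ^ 2 * Real.exp (T ω) ≤ L ^ 2 * Real.exp (L' ^ 2 / 2) *
      (Real.exp ((Y ω / L) ^ 2) + Real.exp ((T ω / L') ^ 2)) := by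
    set a := (Y ω / L) ^ 2 with ha
    set b := (T ω / L') ^ 2 with hb
    have h1 : Y ω ^ 2 ≤ L ^ 2 * (2 * Real.exp (a / 2)) := by
      have e1 := Real.add_one_le_exp (a / 2)
      have e2 : Y ω ^ 2 = L ^ 2 * a := by rw [ha]; field_simp
      rw [e2]
      gcongr
      linarith
    have h2 : Real.exp (T ω) ≤ Real.exp (L' ^ 2 / 2) * Real.exp (b / 2) := by
      rw [← Real.exp_add]
      refine Real.exp_le_exp.2 ?_
      have e1 : T ω = L' * (T ω / L') := by field_simp
      rw [hb]
      nlinarith [sq_nonneg (L' - T ω / L')]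
    calc _ ≤ L ^ 2 * (2 * Real.exp (a / 2)) * (Real.exp (L' ^ 2 / 2) * Real.exp (b / 2)) := by
          gcongr
      _ = 2 * L ^ 2 * Real.exp (L' ^ 2 / 2) * (Real.exp (a / 2) * Real.exp (b / 2)) := by ring
      _ ≤ 2 * L ^ 2 * Real.exp (L' ^ 2 / 2) * ((Real.exp a + Real.exp b) / 2) := by
          gcongr
          exact exp_mul_exp_half_le a b
      _ = _ := by ring
  have hbd := (h.1.add hT.1).const_mul (L ^ 2 * Real.exp (L' ^ 2 / 2))
  have hi : Integrable (fun ω ↦ Y ω ^ 2 * Real.exp (T ω)) P := by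
    refine hbd.mono' (by fun_prop) (ae_of_all _ fun ω ↦ ?_)
    rw [Real.norm_of_nonneg (by positivity)]
    exact hle ω
  refine ⟨hi, (integral_mono hi hbd hle).trans ?_⟩
  simp only [Pi.add_apply]
  rw [integral_const_mul, integral_add h.1 hT.1]
  have : 0 < L ^ 2 * Real.exp (L' ^ 2 / 2) := by positivity
  nlinarith [h.2, hT.2]

lemma neg {T : Ω → ℝ} (hT : ExpSqLE P L T) : ExpSqLE P L (fun ω ↦ - T ω) := by
  simpa [ExpSqLE, neg_div] using hT

end ExpSqLE

lemma exp_mul_le_of_abs_le_half {t : ℝ} (ht : |t| ≤ 1 / 2) (y : ℝ) :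
    Real.exp (t * y) ≤ 1 + t * y + 8 * t ^ 2 * Real.exp |y| := by
  -- The remainder is at most `(t y) ^ 2 * exp |t y|`, and `y ^ 2 ≤ 8 exp (|y| / 2)`.
  have h1 : Real.exp (t * y) - (1 + t * y) ≤ (t * y) ^ 2 * Real.exp |t * y| := by
    have h := Complex.norm_exp_sub_sum_le_norm_mul_exp ((t * y : ℝ) : ℂ) 2
    have e : Complex.exp ((t * y : ℝ) : ℂ) -
        ∑ m ∈ Finset.range 2, ((t * y : ℝ) : ℂ) ^ m / (m.factorial : ℂ) =
        ((Real.exp (t * y) - (1 + t * y) : ℝ) : ℂ) := by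
      simp [Finset.sum_range_succ]
    rw [e, Complex.norm_real, Complex.norm_real, Real.norm_eq_abs, Real.norm_eq_abs, sq_abs] at h
    exact (le_abs_self _).trans h
  have h2 : Real.exp |t * y| ≤ Real.exp (|y| / 2) := by
    refine Real.exp_le_exp.2 ?_
    rw [abs_mul]
    nlinarith [abs_nonneg y]
  have h3 : y ^ 2 ≤ 8 * Real.exp (|y| / 2) := by
    have h := Real.pow_div_factorial_le_exp (|y| / 2) (by positivity) 2
    norm_num [Nat.factorial] at h
    rw [← sq_abs y]
    nlinarith
  have h4 : (t * y) ^ 2 * Real.exp |t * y| ≤ 8 * t ^ 2 * Real.exp |y| := by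
    calc (t * y) ^ 2 * Real.exp |t * y| = t ^ 2 * (y ^ 2 * Real.exp |t * y|) := by ring
      _ ≤ t ^ 2 * ((8 * Real.exp (|y| / 2)) * Real.exp (|y| / 2)) := by gcongr
      _ = 8 * t ^ 2 * (Real.exp (|y| / 2 + |y| / 2)) := by rw [Real.exp_add]; ring
      _ = _ := by rw [add_halves]
  linarith

variable [IsProbabilityMeasure P]

/-- Sub-exponential variables have Gaussian moment generating functions near zero. -/
lemma mgf_centered_le {Y : Ω → ℝ} (hY : Measurable Y) (hi : Integrable (fun ω ↦ Real.exp |Y ω|) P)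
    (hle : ∫ ω, Real.exp |Y ω| ∂P ≤ 2) {t : ℝ} (ht : |t| ≤ 1 / 2) :
    Integrable (fun ω ↦ Real.exp (t * (Y ω - ∫ ω', Y ω' ∂P))) P ∧
      mgf (fun ω ↦ Y ω - ∫ ω', Y ω' ∂P) P t ≤ Real.exp (16 * t ^ 2) := by
  have hiY : Integrable Y P := by
    refine hi.mono' hY.aestronglyMeasurable (ae_of_all _ fun ω ↦ ?_)
    have := Real.add_one_le_exp |Y ω|
    rw [Real.norm_eq_abs]
    linarith
  have hit : Integrable (fun ω ↦ Real.exp (t * Y ω)) P := by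
    refine hi.mono' (by fun_prop) (ae_of_all _ fun ω ↦ ?_)
    rw [Real.norm_of_nonneg (Real.exp_pos _).le]
    refine Real.exp_le_exp.2 ((le_abs_self _).trans ?_)
    rw [abs_mul]
    nlinarith [abs_nonneg (Y ω)]
  set m := ∫ ω', Y ω' ∂P
  have heq : (fun ω ↦ Real.exp (t * (Y ω - m))) =
      fun ω ↦ Real.exp (-(t * m)) * Real.exp (t * Y ω) := by
    ext ω; rw [← Real.exp_add]; ring_nf
  refine ⟨by rw [heq]; exact hit.const_mul _, ?_⟩
  have hle2 : ∫ ω, Real.exp (t * Y ω) ∂P ≤ 1 + t * m + 8 * t ^ 2 * 2 := by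
    have hbd : Integrable (fun ω ↦ 1 + t * Y ω + 8 * t ^ 2 * Real.exp |Y ω|) P :=
      ((integrable_const _).add (hiY.const_mul t)).add (hi.const_mul _)
    refine (integral_mono hit hbd fun ω ↦ exp_mul_le_of_abs_le_half ht (Y ω)).trans ?_
    have hbd1 : Integrable (fun ω ↦ 1 + t * Y ω) P := (integrable_const _).add (hiY.const_mul t)
    rw [integral_add hbd1 (hi.const_mul _), integral_add (integrable_const _) (hiY.const_mul t),
      integral_const_mul, integral_const_mul]
    simp only [integral_const, probReal_univ, smul_eq_mul, one_mul]
    gcongr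
  rw [mgf, heq, integral_const_mul]
  calc _ ≤ Real.exp (-(t * m)) * Real.exp (t * m + 16 * t ^ 2) := by
        gcongr
        have := Real.add_one_le_exp (t * m + 16 * t ^ 2)
        linarith
    _ = _ := by rw [← Real.exp_add]; ring_nf

/-- Bernstein's inequality for small deviations of sums of independent sub-exponential
variables. -/
lemma bernstein {n : ℕ} {Y : Fin n → Ω → ℝ} (hY : ∀ i, Measurable (Y i)) (hind : iIndepFun Y P)
    (hi : ∀ i, Integrable (fun ω ↦ Real.exp |Y i ω|) P) (hle : ∀ i, ∫ ω, Real.exp |Y i ω| ∂P ≤ 2)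
    {δ : ℝ} (hδ0 : 0 ≤ δ) (hδ : δ ≤ 16) :
    P.real {ω | n * δ ≤ |∑ i, (Y i ω - ∫ ω', Y i ω' ∂P)|} ≤ 2 * Real.exp (-(n * δ ^ 2 / 64)) := by
  set V : Fin n → Ω → ℝ := fun i ω ↦ Y i ω - ∫ ω', Y i ω' ∂P with hV
  have hVm (i : Fin n) : Measurable (V i) := (hY i).sub_const _
  have hVind : iIndepFun V P := hind.comp (fun i x ↦ x - ∫ ω', Y i ω' ∂P) fun i ↦ by fun_prop
  have hmgf (t : ℝ) (ht : |t| ≤ 1 / 2) : mgf (∑ i, V i) P t ≤ Real.exp (n * (16 * t ^ 2)) := by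
    rw [hVind.mgf_sum hVm]
    calc ∏ i, mgf (V i) P t ≤ ∏ _i : Fin n, Real.exp (16 * t ^ 2) :=
          Finset.prod_le_prod (fun _ _ ↦ mgf_nonneg)
            fun i _ ↦ (mgf_centered_le (hY i) (hi i) (hle i) ht).2
      _ = _ := by simp [← Real.exp_nat_mul]
  have hint (t : ℝ) (ht : |t| ≤ 1 / 2) : Integrable (fun ω ↦ Real.exp (t * (∑ i, V i) ω)) P :=
    hVind.integrable_exp_mul_sum hVm fun i _ ↦ (mgf_centered_le (hY i) (hi i) (hle i) ht).1
  -- `δ / 32` minimizes the exponent `16 t ^ 2 - t δ`.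
  have ht : |δ / 32| ≤ 1 / 2 := by rw [abs_of_nonneg (by positivity)]; linarith
  have ht' : |-(δ / 32)| ≤ 1 / 2 := by rwa [abs_neg]
  have hup := measure_ge_le_exp_mul_mgf (n * δ) (by positivity) (hint _ ht)
  have hlo := measure_le_le_exp_mul_mgf (-(n * δ)) (by linarith [hδ0]) (hint _ ht')
  have hexp1 : Real.exp (-(δ / 32) * (n * δ)) * Real.exp (n * (16 * (δ / 32) ^ 2)) =
      Real.exp (-(n * δ ^ 2 / 64)) := by rw [← Real.exp_add]; ring_nf
  have hsubset : {ω | n * δ ≤ |∑ i, V i ω|} ⊆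
      {ω | n * δ ≤ (∑ i, V i) ω} ∪ {ω | (∑ i, V i) ω ≤ -(n * δ)} := by
    intro ω hω
    simp only [Set.mem_union, Set.mem_ofPred_eq, Finset.sum_apply]
    rcases le_abs.1 (show n * δ ≤ |∑ i, V i ω| from hω) with h | h
    · exact Or.inl h
    · exact Or.inr (by linarith)
  have hlo' : P.real {ω | (∑ i, V i) ω ≤ -(n * δ)} ≤ Real.exp (-(n * δ ^ 2 / 64)) := by
    refine hlo.trans ?_
    rw [← hexp1]
    have e : -(-(δ / 32)) * -(n * δ) = -(δ / 32) * (n * δ) := by ring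
    rw [e]
    gcongr
    refine (hmgf _ ht').trans_eq ?_
    ring_nf
  have hup' : P.real {ω | n * δ ≤ (∑ i, V i) ω} ≤ Real.exp (-(n * δ ^ 2 / 64)) := by
    refine hup.trans ?_
    rw [← hexp1]
    gcongr
    exact hmgf _ ht
  calc _ ≤ _ := measureReal_mono hsubset
    _ ≤ _ := measureReal_union_le _ _
    _ ≤ _ := by linarith

end SubGaussian

end Hippo

namespace Hippo

/-! ### Sub-Gaussian designs -/

section ExtendZero

variable {p : ℕ} {S : Finset (Fin p)}

/-- Extension by zero of a vector indexed by a subset of the coordinates. -/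
noncomputable def extendZero (q : EuclideanSpace ℝ S) : EuclideanSpace ℝ (Fin p) :=
  WithLp.toLp 2 fun j ↦ if hj : j ∈ S then q ⟨j, hj⟩ else 0

lemma sum_mul_extendZero (q : EuclideanSpace ℝ S) (f : Fin p → ℝ) :
    ∑ j, f j * extendZero q j = ∑ j : S, f j * q j := by
  rw [← Finset.sum_subset (Finset.subset_univ S) fun j _ hj ↦ by simp [extendZero, hj],
    ← Finset.sum_coe_sort S]
  exact Finset.sum_congr rfl fun j _ ↦ by simp [extendZero]

lemma norm_extendZero (q : EuclideanSpace ℝ S) : ‖extendZero q‖ = ‖q‖ := by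
  rw [EuclideanSpace.norm_eq, EuclideanSpace.norm_eq]
  congr 1
  have h1 := sum_mul_extendZero q fun j ↦ extendZero q j
  simp only [Real.norm_eq_abs, sq_abs]
  simp only [sq]
  rw [h1]
  exact Finset.sum_congr rfl fun j _ ↦ by simp [extendZero]

lemma inner_clm_submatrix (A : Matrix (Fin p) (Fin p) ℝ) (u v : EuclideanSpace ℝ S) :
    inner ℝ u (clm (A.submatrix (fun j : S ↦ (j : Fin p)) fun j : S ↦ (j : Fin p)) v) =
      inner ℝ (extendZero u) (clm A (extendZero v)) := by
  rw [Matrix.inner_toEuclideanCLM, Matrix.inner_toEuclideanCLM, dotProduct_comm,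
    dotProduct_comm (extendZero u).ofLp]
  simp only [dotProduct]
  rw [sum_mul_extendZero u]
  refine Finset.sum_congr rfl fun j _ ↦ ?_
  simp only [Matrix.mulVec, dotProduct, Matrix.submatrix_apply]
  rw [sum_mul_extendZero v]

end ExtendZero

section Rows

variable {Ω : Type*} [MeasurableSpace Ω] {P : Measure Ω} {n : ℕ} {ι : Type*} [Fintype ι]
  [DecidableEq ι]

/-- Independent random rows with second moment matrix `A` whose marginals in directions of norm at
most one have Orlicz norm at most `L`. -/
structure SubgaussianRows (P : Measure Ω) (ξ : Fin n → Ω → ι → ℝ) (A : Matrix ι ι ℝ) (L : ℝ) :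
    Prop where
  measurable : ∀ i, Measurable (ξ i)
  indep : iIndepFun ξ P
  expSq : ∀ i (q : EuclideanSpace ℝ ι), ‖q‖ ≤ 1 → ExpSqLE P L (fun ω ↦ ∑ j, ξ i ω j * q j)
  cov : ∀ i (u v : EuclideanSpace ℝ ι),
    ∫ ω, (∑ j, ξ i ω j * u j) * (∑ j, ξ i ω j * v j) ∂P = inner ℝ u (clm A v)

/-- The entrywise expectation of the Gram matrices with weights `exp (T i)`. -/
noncomputable def meanGram (P : Measure Ω) (ξ : Fin n → Ω → ι → ℝ) (T : Fin n → Ω → ℝ) :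
    Matrix ι ι ℝ :=
  Matrix.of fun j k ↦ ∫ ω, gram (fun i ↦ ξ i ω) (fun i ↦ Real.exp (T i ω)) j k ∂P

namespace SubgaussianRows

variable {ξ : Fin n → Ω → ι → ℝ} {A : Matrix ι ι ℝ} {L : ℝ}

lemma measurable_sum (h : SubgaussianRows P ξ A L) (i : Fin n) (q : EuclideanSpace ℝ ι) :
    Measurable fun ω ↦ ∑ j, ξ i ω j * q j :=
  Finset.measurable_fun_sum _ fun j _ ↦
    ((measurable_pi_apply j).comp (h.measurable i)).mul_const _

/-- Marginals in an arbitrary direction, by homogeneity. -/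
lemma expSq_of_norm_le (h : SubgaussianRows P ξ A L) (i : Fin n) {q : EuclideanSpace ℝ ι} {R : ℝ}
    (hR : 0 < R) (hq : ‖q‖ ≤ R) : ExpSqLE P (L * R) (fun ω ↦ ∑ j, ξ i ω j * q j) := by
  have h1 := h.expSq i (R⁻¹ • q) (by
    rw [norm_smul, norm_inv, Real.norm_of_nonneg hR.le, inv_mul_le_iff₀ hR]; linarith)
  refine h1.mono (h.measurable_sum i q) fun ω ↦ le_of_eq ?_
  congr 1
  simp only [PiLp.smul_apply, smul_eq_mul]
  rw [div_mul_eq_div_div, div_right_comm, div_eq_inv_mul (∑ j, _) R, Finset.mul_sum]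
  congr 1
  exact Finset.sum_congr rfl fun j _ ↦ by ring

/-- Concentration of one bilinear form of the Gram matrix. -/
lemma measureReal_inner_gram_sub_ge_le [IsProbabilityMeasure P] (h : SubgaussianRows P ξ A L)
    (hL : 0 < L) (hn : n ≠ 0) {δ : ℝ} (hδ0 : 0 ≤ δ) (hδ : δ ≤ 16) {u v : EuclideanSpace ℝ ι}
    (hu : ‖u‖ ≤ 1) (hv : ‖v‖ ≤ 1) :
    P.real {ω | L ^ 2 * δ ≤ |inner ℝ u (clm (gram (fun i ↦ ξ i ω) 1 - A) v)|} ≤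
      2 * Real.exp (-(n * δ ^ 2 / 64)) := by
  set Y : Fin n → Ω → ℝ := fun i ω ↦ (∑ j, ξ i ω j * u j) * (∑ j, ξ i ω j * v j) / L ^ 2 with hY
  have hYm (i : Fin n) : Measurable (Y i) :=
    ((h.measurable_sum i u).mul (h.measurable_sum i v)).div_const _
  have hYind : iIndepFun Y P := h.indep.comp
    (fun i x ↦ (∑ j, x j * u j) * (∑ j, x j * v j) / L ^ 2) fun i ↦ by fun_prop
  have hYexp (i : Fin n) := (h.expSq i u hu).integrable_exp_abs_mul (h.expSq i v hv)
    (h.measurable_sum i u) (h.measurable_sum i v)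
  have hYint (i : Fin n) : ∫ ω, Y i ω ∂P = inner ℝ u (clm A v) / L ^ 2 := by
    rw [hY, ← h.cov i u v, integral_div]
  have hb := bernstein hYm hYind (fun i ↦ (hYexp i).1) (fun i ↦ (hYexp i).2) hδ0 hδ
  refine (measureReal_mono fun ω hω ↦ ?_).trans hb
  simp only [Set.mem_ofPred_eq] at hω ⊢
  have hn0 : (0 : ℝ) < n := Nat.cast_pos.2 (Nat.pos_of_ne_zero hn)
  have hid : ∑ i, (Y i ω - ∫ ω', Y i ω' ∂P) =
      n / L ^ 2 * inner ℝ u (clm (gram (fun i ↦ ξ i ω) 1 - A) v) := by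
    have e1 : inner ℝ u (clm (gram (fun i ↦ ξ i ω) 1 - A) v) =
        inner ℝ u (clm (gram (fun i ↦ ξ i ω) 1) v) - inner ℝ u (clm A v) := by
      simp only [clm, map_sub, _root_.sub_apply, inner_sub_right]
    rw [e1, inner_clm_gram, Finset.sum_sub_distrib, Finset.sum_congr rfl fun i _ ↦ hYint i]
    simp only [hY, Finset.sum_const, Finset.card_univ, Fintype.card_fin, nsmul_eq_mul,
      Pi.one_apply, mul_one, ← Finset.sum_div]
    field_simp
  rw [hid, abs_mul, abs_of_nonneg (by positivity)]
  calc (n : ℝ) * δ = n / L ^ 2 * (L ^ 2 * δ) := by field_simp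
    _ ≤ _ := by gcongr

/-- Concentration of the Gram matrix in operator norm, by a union bound over a net. -/
lemma measureReal_norm_gram_sub_gt_le [IsProbabilityMeasure P] (h : SubgaussianRows P ξ A L)
    (hL : 0 < L) (hn : n ≠ 0) {δ : ℝ} (hδ0 : 0 ≤ δ) (hδ : δ ≤ 16) :
    P.real {ω | 4 * (L ^ 2 * δ) < ‖clm (gram (fun i ↦ ξ i ω) 1 - A)‖} ≤
      25 ^ Fintype.card ι * (2 * Real.exp (-(n * δ ^ 2 / 64))) := by
  obtain ⟨N, hNcard, hN1, hNnet⟩ := exists_finset_net (EuclideanSpace ℝ ι)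
  have hsub : {ω | 4 * (L ^ 2 * δ) < ‖clm (gram (fun i ↦ ξ i ω) 1 - A)‖} ⊆
      ⋃ z ∈ N ×ˢ N, {ω | L ^ 2 * δ ≤ |inner ℝ z.1 (clm (gram (fun i ↦ ξ i ω) 1 - A) z.2)|} := by
    intro ω hω
    by_contra hcon
    simp only [Set.mem_iUnion, Set.mem_ofPred_eq, not_exists, not_le] at hcon
    exact absurd (opNorm_le_of_net _ N hNnet (by positivity) fun c hc d hd ↦
      (hcon (c, d) (Finset.mk_mem_product hc hd)).le) (not_le.2 hω)
  refine (measureReal_mono hsub (measure_ne_top _ _)).trans ((measureReal_biUnion_finset_le _ _).trans ?_)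
  refine (Finset.sum_le_sum fun z hz ↦ h.measureReal_inner_gram_sub_ge_le hL hn hδ0 hδ
    (hN1 _ (Finset.mem_product.1 hz).1) (hN1 _ (Finset.mem_product.1 hz).2)).trans ?_
  rw [Finset.sum_const, nsmul_eq_mul, Finset.card_product]
  gcongr
  rw [finrank_euclideanSpace] at hNcard
  have h25 : (25 : ℝ) ^ Fintype.card ι = 5 ^ Fintype.card ι * 5 ^ Fintype.card ι := by
    rw [← mul_pow]; norm_num
  rw [h25]
  push_cast
  have : (N.card : ℝ) ≤ 5 ^ Fintype.card ι := by exact_mod_cast hNcard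
  gcongr

/-- Passing to a subset of the predictors. -/
lemma restrict {p : ℕ} {ξ : Fin n → Ω → Fin p → ℝ} {A : Matrix (Fin p) (Fin p) ℝ}
    (h : SubgaussianRows P ξ A L) (S : Finset (Fin p)) :
    SubgaussianRows P (fun i ω (j : S) ↦ ξ i ω j)
      (A.submatrix (fun j : S ↦ (j : Fin p)) fun j : S ↦ (j : Fin p)) L := by
  refine ⟨fun i ↦ measurable_pi_lambda _ fun j ↦ (measurable_pi_apply _).comp (h.measurable i),
    h.indep.comp (fun i x (j : S) ↦ x j) fun i ↦ by fun_prop, fun i q hq ↦ ?_, fun i u v ↦ ?_⟩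
  · have := h.expSq i (extendZero q) ((norm_extendZero q).trans_le hq)
    simpa only [sum_mul_extendZero] using this
  · have := h.cov i (extendZero u) (extendZero v)
    simpa only [sum_mul_extendZero, inner_clm_submatrix] using this

section MeanGram

variable {T : Fin n → Ω → ℝ} {L' : ℝ}

lemma integral_sq_mul_exp_le (h : SubgaussianRows P ξ A L) (hL : 0 < L) (hL' : 0 < L')
    {i : Fin n} {τ : Ω → ℝ} (hτ : ExpSqLE P L' τ) (hτm : Measurable τ) (q : EuclideanSpace ℝ ι) :
    Integrable (fun ω ↦ (∑ j, ξ i ω j * q j) ^ 2 * Real.exp (τ ω)) P ∧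
      ∫ ω, (∑ j, ξ i ω j * q j) ^ 2 * Real.exp (τ ω) ∂P ≤
        4 * L ^ 2 * Real.exp (L' ^ 2 / 2) * ‖q‖ ^ 2 := by
  rcases eq_or_ne q 0 with rfl | hq
  · simp
  have h1 := (h.expSq_of_norm_le i (norm_pos_iff.2 hq) le_rfl).integrable_sq_mul_exp
    (mul_pos hL (norm_pos_iff.2 hq)) (h.measurable_sum i q) hτ hL' hτm
  refine ⟨h1.1, h1.2.trans_eq (by ring)⟩

lemma integrable_mul_exp (h : SubgaussianRows P ξ A L) (hL : 0 < L) (hL' : 0 < L')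
    (hT : ∀ i, ExpSqLE P L' (T i)) (hTm : ∀ i, Measurable (T i)) (i : Fin n)
    (u v : EuclideanSpace ℝ ι) :
    Integrable (fun ω ↦ (∑ j, ξ i ω j * u j) * Real.exp (T i ω) * ∑ j, ξ i ω j * v j) P := by
  have hu := (h.integral_sq_mul_exp_le hL hL' (i := i) (hT i) (hTm i) u).1
  have hv := (h.integral_sq_mul_exp_le hL hL' (i := i) (hT i) (hTm i) v).1
  have h1 := h.measurable_sum i u
  have h2 := h.measurable_sum i v
  have h3 := hTm i
  refine (hu.add hv).mono' (by fun_prop) (ae_of_all _ fun ω ↦ ?_)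
  simp only [Pi.add_apply, norm_mul, Real.norm_eq_abs, Real.abs_exp]
  rw [← sq_abs (∑ j, ξ i ω j * u j), ← sq_abs (∑ j, ξ i ω j * v j), ← add_mul, mul_right_comm]
  gcongr
  nlinarith [sq_nonneg (|∑ j, ξ i ω j * u j| - |∑ j, ξ i ω j * v j|),
    abs_nonneg (∑ j, ξ i ω j * u j), abs_nonneg (∑ j, ξ i ω j * v j)]

lemma inner_clm_meanGram (h : SubgaussianRows P ξ A L) (hL : 0 < L) (hL' : 0 < L')
    (hT : ∀ i, ExpSqLE P L' (T i)) (hTm : ∀ i, Measurable (T i)) (u v : EuclideanSpace ℝ ι) :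
    inner ℝ u (clm (meanGram P ξ T) v) = (n : ℝ)⁻¹ * ∑ i,
      ∫ ω, (∑ j, ξ i ω j * u j) * Real.exp (T i ω) * (∑ j, ξ i ω j * v j) ∂P := by
  have hint (j k : ι) : Integrable
      (fun ω ↦ gram (fun i ↦ ξ i ω) (fun i ↦ Real.exp (T i ω)) j k) P := by
    refine (integrable_finsetSum _ fun i _ ↦ ?_).const_mul _
    simpa using h.integrable_mul_exp hL hL' hT hTm i (EuclideanSpace.single j 1)
      (EuclideanSpace.single k 1)
  have h1 : inner ℝ u (clm (meanGram P ξ T) v) =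
      ∫ ω, inner ℝ u (clm (gram (fun i ↦ ξ i ω) (fun i ↦ Real.exp (T i ω))) v) ∂P := by
    simp only [Matrix.inner_toEuclideanCLM, dotProduct, Matrix.mulVec]
    rw [integral_finsetSum _ fun j _ ↦ (integrable_finsetSum _ fun k _ ↦
      (hint j k).mul_const _).const_mul _]
    refine Finset.sum_congr rfl fun j _ ↦ ?_
    rw [integral_const_mul, integral_finsetSum _ fun k _ ↦ (hint j k).mul_const _]
    congr 1
    refine Finset.sum_congr rfl fun k _ ↦ ?_
    rw [integral_mul_const]
    rfl
  rw [h1]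
  simp_rw [inner_clm_gram]
  rw [integral_const_mul, integral_finsetSum _ fun i _ ↦ h.integrable_mul_exp hL hL' hT hTm i u v]

lemma norm_clm_meanGram_le (h : SubgaussianRows P ξ A L) (hL : 0 < L) (hL' : 0 < L')
    (hT : ∀ i, ExpSqLE P L' (T i)) (hTm : ∀ i, Measurable (T i)) :
    ‖clm (meanGram P ξ T)‖ ≤ 16 * L ^ 2 * Real.exp (L' ^ 2 / 2) := by
  obtain ⟨N, -, hN1, hNnet⟩ := exists_finset_net (EuclideanSpace ℝ ι)
  set B := 4 * L ^ 2 * Real.exp (L' ^ 2 / 2)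
  have hB : 0 ≤ B := by positivity
  have key (i : Fin n) {u v : EuclideanSpace ℝ ι} (hu : ‖u‖ ≤ 1) (hv : ‖v‖ ≤ 1) :
      |∫ ω, (∑ j, ξ i ω j * u j) * Real.exp (T i ω) * (∑ j, ξ i ω j * v j) ∂P| ≤ B := by
    have hu' := h.integral_sq_mul_exp_le hL hL' (i := i) (hT i) (hTm i) u
    have hv' := h.integral_sq_mul_exp_le hL hL' (i := i) (hT i) (hTm i) v
    have hbd := (hu'.1.add hv'.1).div_const 2
    rw [← Real.norm_eq_abs]
    refine (norm_integral_le_of_norm_le hbd (ae_of_all _ fun ω ↦ ?_)).trans ?_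
    · simp only [Pi.add_apply, norm_mul, Real.norm_eq_abs, Real.abs_exp]
      rw [← sq_abs (∑ j, ξ i ω j * u j), ← sq_abs (∑ j, ξ i ω j * v j), ← add_mul, mul_right_comm,
        mul_div_right_comm]
      gcongr
      nlinarith [sq_nonneg (|∑ j, ξ i ω j * u j| - |∑ j, ξ i ω j * v j|)]
    · simp only [Pi.add_apply]
      rw [integral_div, integral_add hu'.1 hv'.1]
      have e1 : B * ‖u‖ ^ 2 ≤ B := mul_le_of_le_one_right hB (pow_le_one₀ (norm_nonneg _) hu)
      have e2 : B * ‖v‖ ^ 2 ≤ B := mul_le_of_le_one_right hB (pow_le_one₀ (norm_nonneg _) hv)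
      linarith [hu'.2, hv'.2]
  have h4 : 16 * L ^ 2 * Real.exp (L' ^ 2 / 2) = 4 * B := by simp only [B]; ring
  rw [h4]
  refine opNorm_le_of_net _ N hNnet hB fun c hc d hd ↦ ?_
  rw [h.inner_clm_meanGram hL hL' hT hTm, abs_mul, abs_of_nonneg (by positivity)]
  refine (mul_le_mul_of_nonneg_left (Finset.abs_sum_le_sum_abs _ _) (by positivity)).trans ?_
  refine (mul_le_mul_of_nonneg_left (Finset.sum_le_sum fun i _ ↦ key i (hN1 c hc) (hN1 d hd))
    (by positivity)).trans ?_
  rw [Finset.sum_const, Finset.card_univ, Fintype.card_fin, nsmul_eq_mul, ← mul_assoc]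
  rcases eq_or_ne (n : ℝ) 0 with hn | hn
  · simpa [hn] using hB
  · rw [inv_mul_cancel₀ hn, one_mul]

/-- The exponential weights cannot degenerate the Gram matrix on average: by
`exp T ≥ 2 m - m ^ 2 exp (-T)`, a lower bound follows from the upper bound for the weights
`exp (-T)`, with the optimal choice of `m`. -/
lemma isCoerciveMatrix_meanGram (h : SubgaussianRows P ξ A L) (hL : 0 < L) (hL' : 0 < L')
    (hT : ∀ i, ExpSqLE P L' (T i)) (hTm : ∀ i, Measurable (T i)) (hn : n ≠ 0) {c : ℝ} (hc : 0 < c)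
    (hA : IsCoerciveMatrix c A) :
    IsCoerciveMatrix (c ^ 2 / (4 * L ^ 2 * Real.exp (L' ^ 2 / 2))) (meanGram P ξ T) := by
  intro q
  set B := 4 * L ^ 2 * Real.exp (L' ^ 2 / 2)
  have hB : 0 < B := by positivity
  have key (i : Fin n) : c ^ 2 / B * ‖q‖ ^ 2 ≤
      ∫ ω, (∑ j, ξ i ω j * q j) * Real.exp (T i ω) * (∑ j, ξ i ω j * q j) ∂P := by
    have hup := h.integral_sq_mul_exp_le hL hL' (i := i) (hT i).neg (hTm i).neg q
    have hcov := (hA q).trans_eq (h.cov i q q).symm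
    set f : Ω → ℝ := fun ω ↦ ∑ j, ξ i ω j * q j with hf
    have hsq : Integrable (fun ω ↦ f ω * f ω) P := by
      rcases eq_or_ne q 0 with rfl | hq
      · simp [hf]
      · have := (h.expSq_of_norm_le i (norm_pos_iff.2 hq) le_rfl).integrable_sq
          (mul_pos hL (norm_pos_iff.2 hq)) (h.measurable_sum i q)
        simpa only [sq] using this
    set m := c / B
    have hbd : Integrable (fun ω ↦ 2 * m * (f ω * f ω) -
        m ^ 2 * (f ω ^ 2 * Real.exp (-T i ω))) P :=
      (hsq.const_mul _).sub (hup.1.const_mul _)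
    have hmono : ∫ ω, (2 * m * (f ω * f ω) - m ^ 2 * (f ω ^ 2 * Real.exp (-T i ω))) ∂P ≤
        ∫ ω, f ω * Real.exp (T i ω) * f ω ∂P := by
      refine integral_mono hbd (h.integrable_mul_exp hL hL' hT hTm i q q) fun ω ↦ ?_
      have e1 : 2 * m - m ^ 2 * Real.exp (-T i ω) ≤ Real.exp (T i ω) := by
        have e2 : Real.exp (T i ω) - (2 * m - m ^ 2 * Real.exp (-T i ω)) =
            Real.exp (T i ω) * (1 - m * Real.exp (-T i ω)) ^ 2 := by
          have e3 : Real.exp (T i ω) * Real.exp (-T i ω) = 1 := by rw [← Real.exp_add]; simp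
          linear_combination (2 * m - m ^ 2 * Real.exp (-T i ω)) * e3
        have e4 : 0 ≤ Real.exp (T i ω) * (1 - m * Real.exp (-T i ω)) ^ 2 := by positivity
        linarith
      nlinarith [sq_nonneg (f ω), mul_le_mul_of_nonneg_left e1 (sq_nonneg (f ω))]
    rw [integral_sub (hsq.const_mul _) (hup.1.const_mul _), integral_const_mul,
      integral_const_mul] at hmono
    refine le_trans ?_ hmono
    have hm : 0 < m := by positivity
    have e5 : m ^ 2 * ∫ ω, f ω ^ 2 * Real.exp (-T i ω) ∂P ≤ m ^ 2 * (B * ‖q‖ ^ 2) :=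
      mul_le_mul_of_nonneg_left hup.2 (by positivity)
    have e6 : 2 * m * (c * ‖q‖ ^ 2) ≤ 2 * m * ∫ ω, f ω * f ω ∂P :=
      mul_le_mul_of_nonneg_left hcov (by positivity)
    have e7 : c ^ 2 / B * ‖q‖ ^ 2 = 2 * m * (c * ‖q‖ ^ 2) - m ^ 2 * (B * ‖q‖ ^ 2) := by
      simp only [m]; field_simp; ring
    linarith
  rw [h.inner_clm_meanGram hL hL' hT hTm]
  have hn0 : (0 : ℝ) < n := Nat.cast_pos.2 (Nat.pos_of_ne_zero hn)
  rw [le_inv_mul_iff₀ hn0]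
  have := Finset.sum_le_sum fun i (_ : i ∈ Finset.univ) ↦ key i
  rwa [Finset.sum_const, Finset.card_univ, Fintype.card_fin, nsmul_eq_mul] at this

end MeanGram

end SubgaussianRows

end Rows

namespace Model

lemma isSymm_sqrt {p : ℕ} (A : Matrix (Fin p) (Fin p) ℝ) : (CFC.sqrt A).IsSymm := by
  have := (CFC.sqrt_nonneg A).isSelfAdjoint
  rwa [IsSelfAdjoint, Matrix.star_eq_conjTranspose,
    Matrix.conjTranspose_eq_transpose_of_trivial] at this

/-- The symmetric square root turns marginals of `x_i` into marginals of `z_i`. -/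
lemma sum_x_mul {n p : ℕ} {Ω : Type*} (M : Model n p Ω) (i : Fin n) (ω : Ω)
    (q : EuclideanSpace ℝ (Fin p)) :
    ∑ j, M.x i ω j * q j = ∑ j, M.z i ω j * clm (CFC.sqrt M.Sigma) q j := by
  have h := inner_clm_comm (isSymm_sqrt M.Sigma) q (WithLp.toLp 2 (M.z i ω))
  simp only [PiLp.inner_apply, RCLike.inner_apply, conj_trivial] at h
  exact h

variable {n p : ℕ} {Ω : Type*} [MeasurableSpace Ω] {P : Measure Ω} {M : Model n p Ω}
  {K Cmin Cmax : ℝ}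

namespace SubgaussianDesign

lemma isSelfAdjoint_Sigma (h : M.SubgaussianDesign P K Cmin Cmax) : IsSelfAdjoint M.Sigma := by
  rw [IsSelfAdjoint, Matrix.star_eq_conjTranspose, Matrix.conjTranspose_eq_transpose_of_trivial]
  exact h.symm_Sigma

lemma isCoerciveMatrix_Sigma (h : M.SubgaussianDesign P K Cmin Cmax) :
    IsCoerciveMatrix Cmin M.Sigma := by
  intro q
  have h1 : algebraMap ℝ _ Cmin ≤ M.Sigma :=
    algebraMap_le_of_le_spectrum (fun r hr ↦ (h.eigenvalues_Sigma r hr).1) h.isSelfAdjoint_Sigma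
  have h2 := (Matrix.le_iff.1 h1).dotProduct_mulVec_nonneg q.ofLp
  rw [star_trivial, ← Matrix.inner_toEuclideanCLM, map_sub, _root_.sub_apply, inner_sub_right,
    Algebra.algebraMap_eq_smul_one, map_smul, map_one, _root_.smul_apply, inner_smul_right] at h2
  simp only [one_apply_eq_self, real_inner_self_eq_norm_sq] at h2
  linarith

lemma inner_clm_Sigma_le (h : M.SubgaussianDesign P K Cmin Cmax) (q : EuclideanSpace ℝ (Fin p)) :
    inner ℝ q (clm M.Sigma q) ≤ Cmax * ‖q‖ ^ 2 := by
  have h1 : M.Sigma ≤ algebraMap ℝ _ Cmax :=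
    le_algebraMap_of_spectrum_le (fun r hr ↦ (h.eigenvalues_Sigma r hr).2) h.isSelfAdjoint_Sigma
  have h2 := (Matrix.le_iff.1 h1).dotProduct_mulVec_nonneg q.ofLp
  rw [star_trivial, ← Matrix.inner_toEuclideanCLM, map_sub, _root_.sub_apply, inner_sub_right,
    Algebra.algebraMap_eq_smul_one, map_smul, map_one, _root_.smul_apply, inner_smul_right] at h2
  simp only [one_apply_eq_self, real_inner_self_eq_norm_sq] at h2
  linarith

lemma inner_clm_sqrt_clm_sqrt (h : M.SubgaussianDesign P K Cmin Cmax) (hCmin : 0 ≤ Cmin)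
    (u v : EuclideanSpace ℝ (Fin p)) :
    inner ℝ (clm (CFC.sqrt M.Sigma) u) (clm (CFC.sqrt M.Sigma) v) = inner ℝ u (clm M.Sigma v) := by
  have hpos : 0 ≤ M.Sigma := by
    refine (Matrix.nonneg_iff_posSemidef).2 (Matrix.PosSemidef.of_dotProduct_mulVec_nonneg
      h.isSelfAdjoint_Sigma fun x ↦ ?_)
    have := h.isCoerciveMatrix_Sigma (WithLp.toLp 2 x)
    rw [Matrix.inner_toEuclideanCLM] at this
    rw [star_trivial]
    exact le_trans (by positivity) this
  rw [← inner_clm_comm (isSymm_sqrt _), ← clm_mul_apply, CFC.sqrt_mul_sqrt_self _ hpos]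

lemma measurable_x (h : M.SubgaussianDesign P K Cmin Cmax) (i : Fin n) : Measurable (M.x i) := by
  refine measurable_pi_lambda _ fun j ↦ ?_
  simp only [x, Matrix.mulVec, dotProduct]
  exact Finset.measurable_fun_sum _ fun k _ ↦
    ((measurable_pi_apply k).comp (h.measurable_z i)).const_mul _

/-- The rows `x_i` of the design are sub-Gaussian with second moment matrix `Σ`. -/
lemma subgaussianRows (h : M.SubgaussianDesign P K Cmin Cmax) (hK : 0 < K)
    (hCmin : 0 < Cmin) (hCmax : 0 < Cmax) :
    SubgaussianRows P M.x M.Sigma (2 * K * Real.sqrt Cmax) := by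
  have hzm (i : Fin n) (w : EuclideanSpace ℝ (Fin p)) : Measurable fun ω ↦ ∑ j, M.z i ω j * w j :=
    Finset.measurable_fun_sum _ fun j _ ↦
      ((measurable_pi_apply j).comp (h.measurable_z i)).mul_const _
  have hz1 (i : Fin n) (w : EuclideanSpace ℝ (Fin p)) (hw : ‖w‖ = 1) :
      ExpSqLE P (2 * K) fun ω ↦ ∑ j, M.z i ω j * w j :=
    expSqLE_of_psi2Norm_le (hzm i w) hK (h.psi2_z i w hw)
  have hz2 (i : Fin n) (j : Fin p) : MemLp (fun ω ↦ M.z i ω j) 2 P := by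
    have := (hz1 i (EuclideanSpace.single j 1) (by simp)).memLp_two (by positivity) (hzm i _)
    simpa using this
  refine ⟨h.measurable_x, h.indep_z.comp (fun i z ↦ Matrix.mulVec (CFC.sqrt M.Sigma) z) fun i ↦ ?_,
    fun i q hq ↦ ?_, fun i u v ↦ ?_⟩
  · refine measurable_pi_lambda _ fun j ↦ ?_
    simp only [Matrix.mulVec, dotProduct]
    fun_prop
  · simp only [M.sum_x_mul]
    set w := clm (CFC.sqrt M.Sigma) q
    have hw : ‖w‖ ≤ Real.sqrt Cmax := by
      refine Real.le_sqrt_of_sq_le ?_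
      rw [← real_inner_self_eq_norm_sq, h.inner_clm_sqrt_clm_sqrt hCmin.le]
      refine (h.inner_clm_Sigma_le q).trans (mul_le_of_le_one_right hCmax.le ?_)
      exact pow_le_one₀ (norm_nonneg _) hq
    rcases eq_or_ne w 0 with hw0 | hw0
    · simp only [hw0]
      have := h.indep_z.isProbabilityMeasure
      simp [ExpSqLE]
    have hpos : 0 < ‖w‖ := norm_pos_iff.2 hw0
    refine (hz1 i (‖w‖⁻¹ • w) (by
      rw [norm_smul, norm_inv, norm_norm, inv_mul_cancel₀ hpos.ne'])).mono (hzm i w) fun ω ↦ ?_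
    have e : ∑ j, M.z i ω j * (‖w‖⁻¹ • w) j = ‖w‖⁻¹ * ∑ j, M.z i ω j * w j := by
      rw [Finset.mul_sum]
      exact Finset.sum_congr rfl fun j _ ↦ by simp; ring
    rw [e, div_pow, div_pow, mul_pow ‖w‖⁻¹, inv_pow, inv_mul_eq_div, div_div, mul_pow (2 * K),
      mul_comm ((2 * K) ^ 2)]
    gcongr
  · simp only [M.sum_x_mul]
    rw [← h.inner_clm_sqrt_clm_sqrt hCmin.le]
    set a := clm (CFC.sqrt M.Sigma) u
    set b := clm (CFC.sqrt M.Sigma) v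
    have hint (j k : Fin p) : Integrable (fun ω ↦ M.z i ω j * M.z i ω k) P :=
      (hz2 i j).integrable_mul (hz2 i k)
    have e (ω : Ω) : (∑ j, M.z i ω j * a j) * (∑ j, M.z i ω j * b j) =
        ∑ j, ∑ k, a j * b k * (M.z i ω j * M.z i ω k) := by
      rw [Finset.sum_mul_sum]
      exact Finset.sum_congr rfl fun j _ ↦ Finset.sum_congr rfl fun k _ ↦ by ring
    simp_rw [e]
    rw [integral_finsetSum _ fun j _ ↦ integrable_finsetSum _ fun k _ ↦ (hint j k).const_mul _]
    simp only [PiLp.inner_apply, RCLike.inner_apply, conj_trivial]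
    refine Finset.sum_congr rfl fun j _ ↦ ?_
    rw [integral_finsetSum _ fun k _ ↦ (hint j k).const_mul _]
    simp only [integral_const_mul, h.cov_z]
    simp [mul_comm]

lemma isCoerciveMatrix_SigmaSS (h : M.SubgaussianDesign P K Cmin Cmax) :
    IsCoerciveMatrix Cmin M.SigmaSS := by
  intro q
  rw [SigmaSS, inner_clm_submatrix, ← norm_extendZero q]
  exact h.isCoerciveMatrix_Sigma _

lemma isSymm_SigmaSS (h : M.SubgaussianDesign P K Cmin Cmax) : M.SigmaSS.IsSymm :=
  h.symm_Sigma.submatrix _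

lemma norm_clm_SigmaSS_le (h : M.SubgaussianDesign P K Cmin Cmax) (hCmin : 0 ≤ Cmin)
    (hCmax : 0 ≤ Cmax) : ‖clm M.SigmaSS‖ ≤ 4 * Cmax := by
  obtain ⟨N, -, hN1, hNnet⟩ := exists_finset_net (EuclideanSpace ℝ M.S)
  refine opNorm_le_of_net _ N hNnet hCmax fun c hc d hd ↦ ?_
  have hup (q : EuclideanSpace ℝ M.S) (hq : q ∈ N) : inner ℝ q (clm M.SigmaSS q) ≤ Cmax := by
    rw [SigmaSS, inner_clm_submatrix]
    refine (h.inner_clm_Sigma_le _).trans (mul_le_of_le_one_right hCmax ?_)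
    rw [norm_extendZero]
    exact pow_le_one₀ (norm_nonneg _) (hN1 q hq)
  have hpos (q : EuclideanSpace ℝ M.S) : 0 ≤ inner ℝ q (clm M.SigmaSS q) :=
    le_trans (by positivity) (h.isCoerciveMatrix_SigmaSS q)
  have hsymm : inner ℝ d (clm M.SigmaSS c) = inner ℝ c (clm M.SigmaSS d) := by
    rw [inner_clm_comm h.isSymm_SigmaSS, real_inner_comm]
  have h1 := hpos (c + d)
  have h2 := hpos (c - d)
  simp only [map_add, map_sub, inner_add_left, inner_add_right, inner_sub_left, inner_sub_right,
    hsymm] at h1 h2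
  have h3 := hup c hc
  have h4 := hup d hd
  rw [abs_le]
  constructor <;> linarith

end SubgaussianDesign

end Model

end Hippo

namespace Hippo

/-! ### Measurability of least squares -/

section Measurability

variable {𝓧 : Type*} [MeasurableSpace 𝓧] {ι : Type*} {n : ℕ}

lemma measurable_gram_apply {r : 𝓧 → Fin n → ι → ℝ} (hr : ∀ i j, Measurable fun x ↦ r x i j)
    {w : 𝓧 → Fin n → ℝ} (hw : ∀ i, Measurable fun x ↦ w x i) (j k : ι) :
    Measurable fun x ↦ gram (r x) (w x) j k := by
  simp only [gram, Matrix.of_apply]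
  exact (Finset.measurable_fun_sum _ fun i _ ↦ ((hr i j).mul (hw i)).mul (hr i k)).const_mul _

variable [Fintype ι] [DecidableEq ι]

lemma measurable_det {A : 𝓧 → Matrix ι ι ℝ} (hA : ∀ j k, Measurable fun x ↦ A x j k) :
    Measurable fun x ↦ (A x).det := by
  simp_rw [Matrix.det_apply]
  exact Finset.measurable_fun_sum _ fun σ _ ↦
    (Finset.measurable_fun_prod _ fun i _ ↦ hA _ _).const_smul _

lemma measurable_inv_apply {A : 𝓧 → Matrix ι ι ℝ} (hA : ∀ j k, Measurable fun x ↦ A x j k)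
    (j k : ι) : Measurable fun x ↦ (A x)⁻¹ j k := by
  simp only [Matrix.inv_def, Ring.inverse_eq_inv', Matrix.smul_apply, Matrix.adjugate_apply,
    smul_eq_mul]
  refine (measurable_det hA).inv.mul (measurable_det fun a b ↦ ?_)
  simp only [Matrix.updateRow_apply]
  split_ifs
  · exact measurable_const
  · exact hA a b

lemma measurable_clm_apply {A : 𝓧 → Matrix ι ι ℝ} (hA : ∀ j k, Measurable fun x ↦ A x j k)
    {v : 𝓧 → EuclideanSpace ℝ ι} (hv : ∀ k, Measurable fun x ↦ v x k) (j : ι) :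
    Measurable fun x ↦ clm (A x) (v x) j := by
  simp only [Matrix.ofLp_toEuclideanCLM, Matrix.mulVec, dotProduct]
  exact Finset.measurable_fun_sum _ fun k _ ↦ (hA j k).mul (hv k)

lemma measurable_clm_inv_gram_apply {r : 𝓧 → Fin n → ι → ℝ}
    (hr : ∀ i j, Measurable fun x ↦ r x i j) {v : 𝓧 → EuclideanSpace ℝ ι}
    (hv : ∀ k, Measurable fun x ↦ v x k) (j : ι) :
    Measurable fun x ↦ clm (gram (r x) 1)⁻¹ (v x) j :=
  measurable_clm_apply (measurable_inv_apply
    (measurable_gram_apply hr (w := fun _ ↦ 1) fun _ ↦ measurable_const)) hv j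

lemma measurable_leastSquares_apply {r : 𝓧 → Fin n → ι → ℝ}
    (hr : ∀ i j, Measurable fun x ↦ r x i j) {y : 𝓧 → Fin n → ℝ}
    (hy : ∀ i, Measurable fun x ↦ y x i) (j : ι) :
    Measurable fun x ↦ leastSquares (r x) (y x) j := by
  refine measurable_clm_inv_gram_apply hr (fun k ↦ ?_) j
  simp only [crossMoment]
  exact (Finset.measurable_fun_sum _ fun i _ ↦ (hr i k).mul (hy i)).const_mul _

end Measurability

/-! ### Good designs -/

namespace Model

variable {n p : ℕ} {Ω : Type*} (M : Model n p Ω)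

/-- The columns in `S` of a design matrix `x`. -/
def rowsS (x : Fin n → Fin p → ℝ) (i : Fin n) (j : M.S) : ℝ := x i j

/-- The noise scale `exp (x_i' θ / 2)` of a design matrix `x`. -/
noncomputable def scale (x : Fin n → Fin p → ℝ) (i : Fin n) : ℝ :=
  Real.exp ((∑ j, x i j * M.theta j) / 2)

/-- The linear functional `v` of the least squares errors is the sum of the noise variables with
these coefficients. -/
noncomputable def onCoeff (v : EuclideanSpace ℝ M.S) (x : Fin n → Fin p → ℝ) (i : Fin n) : ℝ :=
  (n : ℝ)⁻¹ * (∑ j, M.rowsS x i j * clm (gram (M.rowsS x) 1)⁻¹ v j) * M.scale x i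

/-- The score of the least squares residuals at column `j` is the sum of the noise variables with
these coefficients. -/
noncomputable def offCoeff (j : Fin p) (x : Fin n → Fin p → ℝ) (i : Fin n) : ℝ :=
  (x i j - ∑ k, M.rowsS x i k * leastSquares (M.rowsS x) (fun i ↦ x i j) k) * M.scale x i

lemma measurable_rowsS (i : Fin n) (j : M.S) :
    Measurable fun x : Fin n → Fin p → ℝ ↦ M.rowsS x i j := by
  unfold rowsS; fun_prop

lemma measurable_scale (i : Fin n) : Measurable fun x : Fin n → Fin p → ℝ ↦ M.scale x i := by
  unfold scale; fun_prop

lemma measurable_onCoeff (v : EuclideanSpace ℝ M.S) (i : Fin n) :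
    Measurable fun x : Fin n → Fin p → ℝ ↦ M.onCoeff v x i := by
  refine ((Finset.measurable_fun_sum _ fun j _ ↦ (M.measurable_rowsS i j).mul ?_).const_mul _).mul
    (M.measurable_scale i)
  exact measurable_clm_inv_gram_apply M.measurable_rowsS (v := fun _ ↦ v)
    (fun _ ↦ measurable_const) j

lemma measurable_offCoeff (j : Fin p) (i : Fin n) :
    Measurable fun x : Fin n → Fin p → ℝ ↦ M.offCoeff j x i := by
  refine Measurable.mul (Measurable.sub (by fun_prop) (Finset.measurable_fun_sum _ fun k _ ↦
    (M.measurable_rowsS i k).mul ?_)) (M.measurable_scale i)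
  exact measurable_leastSquares_apply M.measurable_rowsS (y := fun x i ↦ x i j)
    (fun i ↦ by fun_prop) k

lemma inner_leastSquares_err (ω : Ω) (v : EuclideanSpace ℝ M.S) :
    inner ℝ v (leastSquares (M.xS ω) (M.err ω)) =
      ∑ i, M.onCoeff v (fun i ↦ M.x i ω) i * M.eps i ω := by
  rw [inner_leastSquares]
  refine Finset.sum_congr rfl fun i _ ↦ ?_
  rw [err, ← mul_assoc]
  rfl

lemma sum_residual_mul_err (ω : Ω) (j : Fin p) :
    ∑ i, (M.x i ω j - ∑ k, M.xS ω i k * leastSquares (M.xS ω) (fun i ↦ M.x i ω j) k) * M.err ω i =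
      ∑ i, M.offCoeff j (fun i ↦ M.x i ω) i * M.eps i ω := by
  refine Finset.sum_congr rfl fun i _ ↦ ?_
  rw [err, ← mul_assoc]
  rfl

lemma measurable_oracle [MeasurableSpace Ω] (hx : ∀ i, Measurable (M.x i))
    (heps : ∀ i, Measurable (M.eps i)) : Measurable M.oracle := by
  have hx' (i : Fin n) (j : Fin p) : Measurable fun ω ↦ M.x i ω j :=
    (measurable_pi_apply j).comp (hx i)
  have hy (i : Fin n) : Measurable (M.y i) := by
    unfold y logVar
    have := heps i
    fun_prop
  refine (WithLp.measurable_toLp 2 _).comp (measurable_pi_lambda _ fun j ↦ ?_)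
  by_cases hj : j ∈ M.S
  · simp only [hj, dif_pos]
    exact measurable_leastSquares_apply (r := M.xS) (y := fun ω i ↦ M.y i ω) (fun i j ↦ hx' i j)
      hy _
  · simp only [hj, dif_neg, not_false_eq_true]
    exact measurable_const

/-- Designs for which the noise is well behaved: the Gram matrix on the support is `δ`-close to its
mean, the variances of the errors are at most `m`, the columns have squared norm at most `n c`, and
the squared entries on the support are at most `κ`. -/
structure GoodDesign (δ m c κ : ℝ) (x : Fin n → Fin p → ℝ) : Prop where
  gram : ‖clm (gram (M.rowsS x) 1 - M.SigmaSS)‖ ≤ δ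
  scale : ∀ i, M.scale x i ^ 2 ≤ m
  column : ∀ j, ∑ i, x i j ^ 2 ≤ n * c
  entry : ∀ i (j : M.S), x i j ^ 2 ≤ κ

namespace GoodDesign

variable {M} {δ m c κ C : ℝ} {x : Fin n → Fin p → ℝ}

lemma isCoerciveMatrix (h : M.GoodDesign δ m c κ x) (hS : IsCoerciveMatrix C M.SigmaSS)
    (hδ : δ ≤ C / 2) : IsCoerciveMatrix (C / 2) (Hippo.gram (M.rowsS x) 1) :=
  hS.of_close h.gram hδ

lemma isUnit_det (h : M.GoodDesign δ m c κ x) (hS : IsCoerciveMatrix C M.SigmaSS) (hC : 0 < C)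
    (hδ : δ ≤ C / 2) : IsUnit (Hippo.gram (M.rowsS x) 1).det :=
  (h.isCoerciveMatrix hS hδ).isUnit_det (by linarith)

lemma norm_clm_inv_le (h : M.GoodDesign δ m c κ x) (hS : IsCoerciveMatrix C M.SigmaSS)
    (hC : 0 < C) (hδ : δ ≤ C / 2) {v : EuclideanSpace ℝ M.S} (hv : ‖v‖ = 1) :
    ‖clm (Hippo.gram (M.rowsS x) 1)⁻¹ v‖ ≤ 2 / C := by
  have := (h.isCoerciveMatrix hS hδ).norm_inv_le (by linarith) v
  rwa [hv, mul_one, inv_div] at this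

lemma sum_sq_onCoeff_le (h : M.GoodDesign δ m c κ x) (hS : IsCoerciveMatrix C M.SigmaSS)
    (hC : 0 < C) (hδ : δ ≤ C / 2) (hm : 0 ≤ m) {v : EuclideanSpace ℝ M.S} (hv : ‖v‖ = 1) :
    ∑ i, M.onCoeff v x i ^ 2 ≤ 2 * m / (C * n) := by
  set q := clm (Hippo.gram (M.rowsS x) 1)⁻¹ v with hq
  have h1 : ∑ i, M.onCoeff v x i ^ 2 ≤ m * ((n : ℝ)⁻¹ * inner ℝ q v) := by
    have e : inner ℝ q v = inner ℝ q (clm (Hippo.gram (M.rowsS x) 1) q) := by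
      rw [hq, (h.isCoerciveMatrix hS hδ).clm_clm_inv (by linarith)]
    rw [e, inner_clm_gram, Finset.mul_sum, Finset.mul_sum, Finset.mul_sum]
    refine Finset.sum_le_sum fun i _ ↦ ?_
    calc M.onCoeff v x i ^ 2 =
          M.scale x i ^ 2 * ((n : ℝ)⁻¹ * ((n : ℝ)⁻¹ * (∑ j, M.rowsS x i j * q j) ^ 2)) := by
          rw [onCoeff]; ring
      _ ≤ m * ((n : ℝ)⁻¹ * ((n : ℝ)⁻¹ * (∑ j, M.rowsS x i j * q j) ^ 2)) := by
          gcongr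
          exact h.scale i
      _ = _ := by simp only [Pi.one_apply]; ring
  have h2 : inner ℝ q v ≤ 2 / C := by
    have := real_inner_le_norm q v
    rw [hv, mul_one] at this
    exact this.trans (h.norm_clm_inv_le hS hC hδ hv)
  calc _ ≤ _ := h1
    _ ≤ m * ((n : ℝ)⁻¹ * (2 / C)) := by gcongr
    _ = _ := by ring

lemma sum_sq_offCoeff_le (h : M.GoodDesign δ m c κ x) (hS : IsCoerciveMatrix C M.SigmaSS)
    (hC : 0 < C) (hδ : δ ≤ C / 2) (hn : n ≠ 0) (hm : 0 ≤ m) (j : Fin p) :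
    ∑ i, M.offCoeff j x i ^ 2 ≤ m * (n * c) := by
  calc ∑ i, M.offCoeff j x i ^ 2 ≤
      ∑ i, m * (x i j - ∑ k, M.rowsS x i k * leastSquares (M.rowsS x) (fun i ↦ x i j) k) ^ 2 := by
        refine Finset.sum_le_sum fun i _ ↦ ?_
        rw [offCoeff, mul_pow, mul_comm]
        gcongr
        exact h.scale i
    _ ≤ m * ∑ i, x i j ^ 2 := by
        rw [← Finset.mul_sum]
        exact mul_le_mul_of_nonneg_left (sum_sq_residual_le hn (h.isUnit_det hS hC hδ) _) hm
    _ ≤ _ := by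
        gcongr
        exact h.column j

lemma abs_onCoeff_le (h : M.GoodDesign δ m c κ x) (hS : IsCoerciveMatrix C M.SigmaSS)
    (hC : 0 < C) (hδ : δ ≤ C / 2) {v : EuclideanSpace ℝ M.S} (hv : ‖v‖ = 1) (i : Fin n) :
    |M.onCoeff v x i| ≤ (n : ℝ)⁻¹ * (2 / C) * Real.sqrt (M.S.card * κ * m) := by
  set q := clm (Hippo.gram (M.rowsS x) 1)⁻¹ v with hq
  have hsq : (∑ j, M.rowsS x i j * q j) ^ 2 ≤ (M.S.card * κ) * (2 / C) ^ 2 := by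
    refine (Finset.sum_mul_sq_le_sq_mul_sq _ _ _).trans ?_
    rw [← EuclideanSpace.real_norm_sq_eq]
    have e1 : ∑ j, M.rowsS x i j ^ 2 ≤ M.S.card * κ := by
      refine (Finset.sum_le_sum fun j _ ↦ h.entry i j).trans_eq ?_
      simp
    have e0 : 0 ≤ ∑ j, M.rowsS x i j ^ 2 := Finset.sum_nonneg fun _ _ ↦ sq_nonneg _
    have e2 := h.norm_clm_inv_le hS hC hδ hv
    have e3 : 0 ≤ M.S.card * κ := e0.trans e1
    gcongr
  refine abs_le_of_sq_le_sq ?_ (by positivity)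
  have hκ : 0 ≤ M.S.card * κ :=
    nonneg_of_mul_nonneg_left ((sq_nonneg _).trans hsq) (by positivity)
  have hm : 0 ≤ m := (sq_nonneg _).trans (h.scale i)
  calc M.onCoeff v x i ^ 2 = (n : ℝ)⁻¹ ^ 2 * ((∑ j, M.rowsS x i j * q j) ^ 2 * M.scale x i ^ 2) := by
        rw [onCoeff]; ring
    _ ≤ (n : ℝ)⁻¹ ^ 2 * ((M.S.card * κ) * (2 / C) ^ 2 * m) := by
        have := h.scale i
        gcongr
    _ = _ := by
        rw [mul_pow, Real.sq_sqrt (by positivity)]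
        ring

end GoodDesign

variable {M} [MeasurableSpace Ω] {P : Measure Ω} [IsProbabilityMeasure P] {K Cmin Cmax : ℝ}

/-- Random designs are good with high probability. -/
lemma measureReal_not_goodDesign_le (h : M.SubgaussianDesign P K Cmin Cmax) (hK : 0 < K)
    (hCmin : 0 < Cmin) (hCmax : 0 < Cmax) (hn : n ≠ 0) {L Θ : ℝ} (hL : L = 2 * K * Real.sqrt Cmax)
    (hΘ : 0 < Θ) (hθ : ‖M.theta‖ ≤ Θ) {δ : ℝ} (hδ0 : 0 ≤ δ) (hδ : δ ≤ 16) :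
    P.real {ω | ¬ M.GoodDesign (4 * (L ^ 2 * δ))
        (Real.exp (Real.sqrt (2 * (L * Θ) ^ 2 * Real.log n))) (Cmax + L ^ 2)
        (L ^ 2 * (3 * Real.log n)) fun i ↦ M.x i ω} ≤
      25 ^ M.S.card * (2 * Real.exp (-(n * δ ^ 2 / 64))) + 2 / n +
        p * (2 * Real.exp (-(n / 64))) + 2 * M.S.card / n ^ 2 := by
  have hrows : SubgaussianRows P M.x M.Sigma L := hL ▸ h.subgaussianRows hK hCmin hCmax
  have hL0 : 0 < L := by rw [hL]; positivity
  have hn0 : (0 : ℝ) < n := Nat.cast_pos.2 (Nat.pos_of_ne_zero hn)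
  have hexp (k : ℕ) : Real.exp (-(k * Real.log n)) = ((n : ℝ) ^ k)⁻¹ := by
    rw [Real.exp_neg, Real.exp_nat_mul, Real.exp_log hn0]
  set E1 := {ω | 4 * (L ^ 2 * δ) < ‖clm (gram (fun i ↦ M.xS ω i) 1 - M.SigmaSS)‖} with hE1
  set E2 := ⋃ i, {ω | (L * Θ) ^ 2 * (2 * Real.log n) ≤ M.logVar i ω ^ 2} with hE2
  set E3 := ⋃ j, {ω | L ^ 2 * 1 ≤ |inner ℝ (EuclideanSpace.single j (1 : ℝ))
    (clm (gram (fun i ↦ M.x i ω) 1 - M.Sigma) (EuclideanSpace.single j (1 : ℝ)))|} with hE3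
  set E4 := ⋃ i, ⋃ j : M.S, {ω | L ^ 2 * (3 * Real.log n) ≤ M.x i ω j ^ 2} with hE4
  have h1 : P.real E1 ≤ 25 ^ M.S.card * (2 * Real.exp (-(n * δ ^ 2 / 64))) := by
    have := (hrows.restrict M.S).measureReal_norm_gram_sub_gt_le hL0 hn hδ0 hδ
    rwa [Fintype.card_coe] at this
  have h2 : P.real E2 ≤ 2 / n := by
    refine (measureReal_iUnion_fintype_le _).trans ((Finset.sum_le_sum fun i _ ↦
      (hrows.expSq_of_norm_le i hΘ hθ).measureReal_le (by positivity) _).trans_eq ?_)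
    have := hexp 2
    push_cast at this
    rw [this, Finset.sum_const, Finset.card_univ, Fintype.card_fin, nsmul_eq_mul]
    field_simp
  have h3 : P.real E3 ≤ p * (2 * Real.exp (-(n / 64))) := by
    refine (measureReal_iUnion_fintype_le _).trans ((Finset.sum_le_sum fun j _ ↦
      hrows.measureReal_inner_gram_sub_ge_le hL0 hn zero_le_one (by norm_num)
        (by simp) (by simp)).trans_eq ?_)
    simp
  have h4 : P.real E4 ≤ 2 * M.S.card / n ^ 2 := by
    refine (measureReal_iUnion_fintype_le _).trans ((Finset.sum_le_sum fun i _ ↦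
      (measureReal_iUnion_fintype_le _).trans (Finset.sum_le_sum fun j _ ↦ ?_)).trans_eq
      (b := ∑ _i : Fin n, ∑ _j : M.S, 2 * ((n : ℝ) ^ 3)⁻¹) ?_)
    · have := (hrows.expSq i (EuclideanSpace.single (j : Fin p) 1) (by simp)).measureReal_le hL0
        (3 * Real.log n)
      have e := hexp 3
      push_cast at e
      rw [e] at this
      simpa using this
    · simp only [Finset.sum_const, Finset.card_univ, Fintype.card_fin, Fintype.card_coe,
        nsmul_eq_mul]
      field_simp
  have hsub : {ω | ¬ M.GoodDesign (4 * (L ^ 2 * δ))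
        (Real.exp (Real.sqrt (2 * (L * Θ) ^ 2 * Real.log n))) (Cmax + L ^ 2)
        (L ^ 2 * (3 * Real.log n)) fun i ↦ M.x i ω} ⊆ E1 ∪ E2 ∪ E3 ∪ E4 := by
    intro ω hω
    by_contra hcon
    simp only [Set.mem_union, not_or] at hcon
    obtain ⟨⟨⟨hc1, hc2⟩, hc3⟩, hc4⟩ := hcon
    simp only [hE1, hE2, hE3, hE4, Set.mem_iUnion, Set.mem_ofPred_eq, not_exists, not_lt,
      not_le] at hc1 hc2 hc3 hc4
    refine hω ⟨hc1, fun i ↦ ?_, fun j ↦ ?_, fun i j ↦ (hc4 i j).le⟩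
    · rw [scale, ← Real.exp_nat_mul]
      refine Real.exp_le_exp.2 ?_
      have : Real.sqrt (M.logVar i ω ^ 2) ≤ Real.sqrt (2 * (L * Θ) ^ 2 * Real.log n) :=
        Real.sqrt_le_sqrt ((hc2 i).le.trans_eq (by ring))
      rw [Real.sqrt_sq_eq_abs] at this
      have e : ((2 : ℕ) : ℝ) * ((∑ j, M.x i ω j * M.theta j) / 2) = M.logVar i ω := by
        rw [logVar]; push_cast; ring
      rw [e]
      exact (le_abs_self _).trans this
    · have e1 := (abs_lt.1 (hc3 j)).2
      have e0 : inner ℝ (EuclideanSpace.single j (1 : ℝ))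
          (clm (gram (fun i ↦ M.x i ω) 1 - M.Sigma) (EuclideanSpace.single j (1 : ℝ))) =
          inner ℝ (EuclideanSpace.single j (1 : ℝ))
            (clm (gram (fun i ↦ M.x i ω) 1) (EuclideanSpace.single j (1 : ℝ))) -
          inner ℝ (EuclideanSpace.single j (1 : ℝ))
            (clm M.Sigma (EuclideanSpace.single j (1 : ℝ))) := by
        simp only [clm, map_sub, _root_.sub_apply, inner_sub_right]
      rw [e0] at e1
      have e2 := h.inner_clm_Sigma_le (EuclideanSpace.single j 1)
      have e3 : inner ℝ (EuclideanSpace.single j (1 : ℝ))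
          (clm (gram (fun i ↦ M.x i ω) 1) (EuclideanSpace.single j (1 : ℝ))) =
          (n : ℝ)⁻¹ * ∑ i, M.x i ω j ^ 2 := by
        rw [inner_clm_gram]
        simp [sq]
      rw [e3] at e1
      have e4 : ‖(EuclideanSpace.single j (1 : ℝ) : EuclideanSpace ℝ (Fin p))‖ = 1 := by simp
      rw [e4, one_pow, mul_one] at e2
      rw [← inv_mul_le_iff₀ hn0]
      linarith
  refine (measureReal_mono hsub).trans ?_
  refine (measureReal_union_le _ _).trans (add_le_add ?_ h4)
  refine (measureReal_union_le _ _).trans (add_le_add ?_ h3)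
  exact (measureReal_union_le _ _).trans (add_le_add h1 h2)

end Model

end Hippo

namespace Hippo

namespace Model

/-! ### The sandwich variance -/

section

variable {n p : ℕ} {Ω : Type*} {M : Model n p Ω}

lemma DSS_eq_gram (ω : Ω) :
    M.DSS ω = gram (M.xS ω) fun i ↦ Real.exp (M.logVar i ω) := rfl

lemma scale_sq (x : Fin n → Fin p → ℝ) (i : Fin n) :
    M.scale x i ^ 2 = Real.exp (∑ j, x i j * M.theta j) := by
  rw [scale, ← Real.exp_nat_mul]
  congr 1
  push_cast
  ring

variable [MeasurableSpace Ω] {P : Measure Ω} {K Cmin Cmax : ℝ}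

lemma zeta_eq (h : M.SubgaussianDesign P K Cmin Cmax) (v : EuclideanSpace ℝ M.S) :
    M.zeta P v = Real.sqrt (inner ℝ (clm M.SigmaSS⁻¹ v)
      (clm (M.meanDSS P) (clm M.SigmaSS⁻¹ v))) := by
  rw [zeta, ← inner_clm_inv_comm h.isSymm_SigmaSS, ← clm_mul_apply, ← clm_mul_apply,
    Matrix.inner_toEuclideanCLM, mul_assoc]

/-- The constants that control `E D_SS`: an upper bound for its norm and a lower bound for `ζ²`. -/
lemma meanDSS_bounds (h : M.SubgaussianDesign P K Cmin Cmax) (hK : 0 < K)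
    (hCmin : 0 < Cmin) (hCmax : 0 < Cmax) (hn : n ≠ 0) {L Θ : ℝ} (hL : L = 2 * K * Real.sqrt Cmax)
    (hΘ : 0 < Θ) (hθ : ‖M.theta‖ ≤ Θ) :
    ‖clm (M.meanDSS P)‖ ≤ 16 * L ^ 2 * Real.exp ((L * Θ) ^ 2 / 2) ∧
      ∀ v : EuclideanSpace ℝ M.S, ‖v‖ = 1 →
        Cmin ^ 2 / (4 * L ^ 2 * Real.exp ((L * Θ) ^ 2 / 2)) * (1 / (4 * Cmax)) ^ 2 ≤
          inner ℝ (clm M.SigmaSS⁻¹ v) (clm (M.meanDSS P) (clm M.SigmaSS⁻¹ v)) := by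
  have hrows : SubgaussianRows P M.x M.Sigma L := hL ▸ h.subgaussianRows hK hCmin hCmax
  have hL0 : 0 < L := by rw [hL]; positivity
  have hT (i : Fin n) : ExpSqLE P (L * Θ) (M.logVar i) := hrows.expSq_of_norm_le i hΘ hθ
  have hTm (i : Fin n) : Measurable (M.logVar i) := hrows.measurable_sum i M.theta
  have hS := hrows.restrict M.S
  refine ⟨hS.norm_clm_meanGram_le hL0 (by positivity) hT hTm, fun v hv ↦ ?_⟩
  have h1 := hS.isCoerciveMatrix_meanGram hL0 (by positivity) hT hTm hn hCmin
    h.isCoerciveMatrix_SigmaSS (clm M.SigmaSS⁻¹ v)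
  refine le_trans ?_ h1
  gcongr
  have h2 := (clm M.SigmaSS).le_opNorm (clm M.SigmaSS⁻¹ v)
  rw [h.isCoerciveMatrix_SigmaSS.clm_clm_inv hCmin, hv] at h2
  rw [div_le_iff₀ (by positivity), mul_comm]
  exact h2.trans (mul_le_mul_of_nonneg_right (h.norm_clm_SigmaSS_le hCmin.le hCmax.le)
    (norm_nonneg _))

end

variable {n p : ℕ} {Ω : Type*} [MeasurableSpace Ω] {P : Measure Ω} [IsProbabilityMeasure P]
  {M : Model n p Ω} {K Cmin Cmax : ℝ}

/-! ### The oracle property for a fixed sample size -/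

lemma exp_neg_two_mul_log_mul_self {s : ℝ} (hs : 0 < s) :
    s * (2 * Real.exp (-(2 * Real.log s))) = 2 / s := by
  have : Real.exp (-(2 * Real.log s)) = (s ^ 2)⁻¹ := by
    rw [Real.exp_neg, two_mul, Real.exp_add, Real.exp_log hs, sq]
  rw [this]
  field_simp

/-- The oracle estimator is a strict local minimizer with the claimed rate, up to the probability
of bad designs and two union bounds over the noise. The constants `√(8 / Cmin)` and `2 √c` make the
sub-Gaussian exponents equal to `2 log s` and at least `2 log p`. -/
lemma measureReal_not_isOracleLocalMin_le (h : M.SubgaussianDesign P K Cmin Cmax)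
    (hhet : M.IsHeteroscedastic P) (hnoise : M.SubgaussianNoise P) (hCmin : 0 < Cmin) (hn : n ≠ 0)
    (hs : 0 < M.S.card) {a l c₂ c δ κ : ℝ} (ha : 1 < a) (hl : 0 < l) (hc : 0 < c)
    (hδ : δ ≤ Cmin / 2)
    (hβ : ∀ j ∈ M.S, a * l + Real.sqrt (8 / Cmin) * Real.sqrt (Real.exp (Real.sqrt (c₂ *
      Real.log n)) * Real.log (M.S.card : ℝ) / n) < |M.beta j|)
    (hlam : 2 * Real.sqrt c * Real.sqrt (Real.log p * Real.exp (Real.sqrt (c₂ * Real.log n)) / n) ≤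
      l) :
    P.real {ω | ¬ M.IsOracleLocalMin a l c₂ (Real.sqrt (8 / Cmin)) ω (M.oracle ω)} ≤
      3 * P.real {ω | ¬ M.GoodDesign δ (Real.exp (Real.sqrt (c₂ * Real.log n))) c κ
        fun i ↦ M.x i ω} + (2 / M.S.card + 2 / p) := by
  set m := Real.exp (Real.sqrt (c₂ * Real.log n)) with hm
  have hm0 : 0 < m := Real.exp_pos _
  have hn0 : (0 : ℝ) < n := Nat.cast_pos.2 (Nat.pos_of_ne_zero hn)
  have hs0 : (0 : ℝ) < M.S.card := Nat.cast_pos.2 hs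
  have hsp : M.S.card ≤ p := by simpa using Finset.card_le_univ M.S
  have hp0 : (0 : ℝ) < p := Nat.cast_pos.2 (hs.trans_le hsp)
  have hlogs : 0 ≤ Real.log (M.S.card : ℝ) := Real.log_natCast_nonneg _
  have hlogp : 0 ≤ Real.log (p : ℝ) := Real.log_natCast_nonneg _
  set G : Set (Fin n → Fin p → ℝ) := {x | M.GoodDesign δ m c κ x} with hG
  have hSig := h.isCoerciveMatrix_SigmaSS
  set τ := Real.sqrt (8 / Cmin) * Real.sqrt (m * Real.log (M.S.card : ℝ) / n) with hτ
  have hX : Measurable fun ω i ↦ M.x i ω := measurable_pi_lambda _ h.measurable_x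
  have hon := measureReal_exists_abs_sum_ge_le hX hhet.measurable_eps hhet.indep_design_eps
    hhet.indep_eps hnoise (A := fun j : M.S ↦ M.onCoeff (EuclideanSpace.single j 1))
    (fun j i ↦ M.measurable_onCoeff _ i) (G := G) (σ2 := 2 * m / (Cmin * n)) (by positivity)
    (fun x hx j ↦ GoodDesign.sum_sq_onCoeff_le hx hSig hCmin hδ hm0.le (by simp))
    (t := τ) (by positivity)
  have hoff := measureReal_exists_abs_sum_ge_le hX hhet.measurable_eps hhet.indep_design_eps
    hhet.indep_eps hnoise (A := fun j : Fin p ↦ M.offCoeff j)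
    (fun j i ↦ M.measurable_offCoeff _ i) (G := G) (σ2 := m * (n * c)) (by positivity)
    (fun x hx j ↦ GoodDesign.sum_sq_offCoeff_le hx hSig hCmin hδ hn hm0.le j)
    (t := n * l) (by positivity)
  have hon' : -τ ^ 2 / (2 * (2 * m / (Cmin * n))) = -(2 * Real.log (M.S.card : ℝ)) := by
    rw [hτ, mul_pow, Real.sq_sqrt (by positivity), Real.sq_sqrt (by positivity)]
    field_simp
    ring
  have hoff' : -(n * l) ^ 2 / (2 * (m * (n * c))) ≤ -(2 * Real.log p) := by
    have h1 : (2 * Real.sqrt c * Real.sqrt (Real.log p * m / n)) ^ 2 ≤ l ^ 2 := by gcongr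
    rw [mul_pow, mul_pow, Real.sq_sqrt hc.le, Real.sq_sqrt (by positivity)] at h1
    rw [neg_div, neg_le_neg_iff, le_div_iff₀ (by positivity)]
    calc 2 * Real.log p * (2 * (m * (n * c))) = n ^ 2 * (2 ^ 2 * c * (Real.log p * m / n)) := by
          field_simp
      _ ≤ n ^ 2 * l ^ 2 := by gcongr
      _ = _ := by ring
  rw [hon', Fintype.card_coe, exp_neg_two_mul_log_mul_self hs0] at hon
  have hoff2 : (Fintype.card (Fin p) : ℝ) * (2 * Real.exp (-(n * l) ^ 2 / (2 * (m * (n * c))))) ≤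
      2 / p := by
    rw [Fintype.card_fin, ← exp_neg_two_mul_log_mul_self hp0]
    gcongr
  have hsub : {ω | ¬ M.IsOracleLocalMin a l c₂ (Real.sqrt (8 / Cmin)) ω (M.oracle ω)} ⊆
      {ω | (fun i ↦ M.x i ω) ∉ G} ∪
      {ω | ∃ j : M.S, τ ≤ |∑ i, M.onCoeff (EuclideanSpace.single j 1) (fun i ↦ M.x i ω) i *
        M.eps i ω|} ∪
      {ω | ∃ j : Fin p, n * l ≤ |∑ i, M.offCoeff j (fun i ↦ M.x i ω) i * M.eps i ω|} := by
    intro ω hω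
    by_contra hcon
    simp only [Set.mem_union, Set.mem_ofPred_eq, not_or, not_not, not_exists, not_le] at hcon
    obtain ⟨⟨hc1, hc2⟩, hc3⟩ := hcon
    have hgood : M.GoodDesign δ m c κ fun i ↦ M.x i ω := hc1
    refine hω (M.isOracleLocalMin_oracle ω ha hl hn (hgood.isUnit_det hSig hCmin hδ) (fun j ↦ ?_)
      hβ fun j _ ↦ ?_)
    · have h1 := hc2 j
      rw [← M.inner_leastSquares_err] at h1
      have h2 : inner ℝ (EuclideanSpace.single j (1 : ℝ)) (leastSquares (M.xS ω) (M.err ω)) =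
          leastSquares (M.xS ω) (M.err ω) j := by
        rw [EuclideanSpace.inner_single_left]; simp
      rw [h2] at h1
      exact h1.le
    · rw [M.sum_residual_mul_err]
      exact hc3 j
  have hfin := (measureReal_mono hsub).trans ((measureReal_union_le _ _).trans
    (add_le_add ((measureReal_union_le _ _).trans (add_le_add le_rfl hon)) hoff))
  have hGeq : {ω | (fun i ↦ M.x i ω) ∉ G} = {ω | ¬ M.GoodDesign δ m c κ fun i ↦ M.x i ω} := rfl
  rw [hGeq] at hfin
  linarith

/-! ### The characteristic function of the standardized estimator -/

/-- For designs that are good and whose weighted Gram matrix is close to its mean, the standardized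
linear functional is a weighted sum of the noise with small weights and variance close to one. -/
lemma norm_integral_exp_oracle_sub_le (h : M.SubgaussianDesign P K Cmin Cmax)
    (hhet : M.IsHeteroscedastic P) (hnoise : M.SubgaussianNoise P) (hCmin : 0 < Cmin) (hn : n ≠ 0)
    {m c κ δ b z : ℝ} (hδ0 : 0 ≤ δ) (hδ : δ ≤ Cmin / 2) (hb : ‖clm (M.meanDSS P)‖ ≤ b)
    (hz0 : 0 < z) {v : EuclideanSpace ℝ M.S} (hv : ‖v‖ = 1)
    (hz : z ≤ inner ℝ (clm M.SigmaSS⁻¹ v) (clm (M.meanDSS P) (clm M.SigmaSS⁻¹ v))) (t : ℝ) :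
    ‖∫ ω, Complex.exp ((t * (Real.sqrt n / M.zeta P v *
        ∑ j : M.S, v j * (M.oracle ω j - M.beta j)) : ℝ) * Complex.I) ∂P -
        Real.exp (-(t ^ 2 / 2))‖ ≤
      200 * |t| ^ 3 * (2 / (Cmin * Real.sqrt z) * Real.sqrt (M.S.card * κ * m / n)) *
        (1 + (4 / Cmin ^ 2 + 6 * b / Cmin ^ 3) * δ / z) +
      t ^ 2 / 2 * ((4 / Cmin ^ 2 + 6 * b / Cmin ^ 3) * δ / z) +
      2 * (P.real {ω | ¬ M.GoodDesign δ m c κ fun i ↦ M.x i ω} +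
        P.real {ω | δ < ‖clm (M.DSS ω - M.meanDSS P)‖}) := by
  have hn0 : (0 : ℝ) < n := Nat.cast_pos.2 (Nat.pos_of_ne_zero hn)
  have hb0 : 0 ≤ b := (norm_nonneg _).trans hb
  have hSig := h.isCoerciveMatrix_SigmaSS
  have hX : Measurable fun ω i ↦ M.x i ω := measurable_pi_lambda _ h.measurable_x
  have he : Measurable fun ω i ↦ M.eps i ω := measurable_pi_lambda _ hhet.measurable_eps
  set V := inner ℝ (clm M.SigmaSS⁻¹ v) (clm (M.meanDSS P) (clm M.SigmaSS⁻¹ v)) with hV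
  have hV0 : 0 < V := hz0.trans_le hz
  have hζ : M.zeta P v = Real.sqrt V := zeta_eq h v
  set η := (4 / Cmin ^ 2 + 6 * b / Cmin ^ 3) * δ / z with hη
  have hη0 : 0 ≤ η := by positivity
  set A := 2 / (Cmin * Real.sqrt z) * Real.sqrt (M.S.card * κ * m / n) with hA
  set f : (Fin n → Fin p → ℝ) × (Fin n → ℝ) → ℝ := fun w ↦ ∑ j : M.S, v j * (leastSquares
    (M.rowsS w.1) (fun i ↦ ∑ j, M.rowsS w.1 i j * M.betaS j + M.scale w.1 i * w.2 i) j - M.betaS j)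
    with hf
  have hfm : Measurable f := by
    refine Finset.measurable_fun_sum _ fun j _ ↦ ((measurable_leastSquares_apply (fun i j ↦
      (M.measurable_rowsS i j).comp measurable_fst) (fun i ↦ ?_) j).sub_const _).const_mul _
    have h1 : Measurable fun w : (Fin n → Fin p → ℝ) × (Fin n → ℝ) ↦ M.scale w.1 i :=
      (M.measurable_scale i).comp measurable_fst
    have h2 (j : M.S) : Measurable fun w : (Fin n → Fin p → ℝ) × (Fin n → ℝ) ↦
        M.rowsS w.1 i j := (M.measurable_rowsS i j).comp measurable_fst
    fun_prop
  set G : Set (Fin n → Fin p → ℝ) := {x | M.GoodDesign δ m c κ x ∧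
    ‖clm (gram (M.rowsS x) (fun i ↦ M.scale x i ^ 2) - M.meanDSS P)‖ ≤ δ} with hG
  -- On good designs the functional is the weighted sum with coefficients `onCoeff`.
  have hlin (x : Fin n → Fin p → ℝ) (hx : x ∈ G) (e : Fin n → ℝ) :
      f (x, e) = ∑ i, M.onCoeff v x i * e i := by
    have h1 : leastSquares (M.rowsS x)
        (fun i ↦ ∑ j, M.rowsS x i j * M.betaS j + M.scale x i * e i) =
        M.betaS + leastSquares (M.rowsS x) fun i ↦ M.scale x i * e i :=
      leastSquares_add (hx.1.isUnit_det hSig hCmin hδ) _ _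
    have h2 := inner_leastSquares (M.rowsS x) (fun i ↦ M.scale x i * e i) v
    simp only [hf, h1, PiLp.add_apply, add_sub_cancel_left]
    rw [PiLp.inner_apply] at h2
    simp only [RCLike.inner_apply, conj_trivial] at h2
    simp only [mul_comm (v _), h2]
    exact Finset.sum_congr rfl fun i _ ↦ by rw [onCoeff]; ring
  have hsections (x : Fin n → Fin p → ℝ) (hx : x ∈ G) :
      ‖∫ ω, Complex.exp ((t * (Real.sqrt n / M.zeta P v * f (x, fun i ↦ M.eps i ω)) : ℝ) *
        Complex.I) ∂P - Real.exp (-(t ^ 2 / 2))‖ ≤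
      200 * |t| ^ 3 * A * (1 + η) + t ^ 2 / 2 * η := by
    have hcoef (i : Fin n) : |Real.sqrt n / M.zeta P v * M.onCoeff v x i| ≤ A := by
      have h1 := hx.1.abs_onCoeff_le hSig hCmin hδ hv i
      have h2 : Real.sqrt z ≤ M.zeta P v := by rw [hζ]; exact Real.sqrt_le_sqrt hz
      have h3 : 0 < Real.sqrt z := Real.sqrt_pos.2 hz0
      rw [abs_mul, abs_of_nonneg (div_nonneg (Real.sqrt_nonneg _) (h3.le.trans h2))]
      calc _ ≤ Real.sqrt n / Real.sqrt z *
            ((n : ℝ)⁻¹ * (2 / Cmin) * Real.sqrt (M.S.card * κ * m)) := by gcongr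
        _ = A := by
            rw [hA, Real.sqrt_div' _ hn0.le]
            have h4 : Real.sqrt n ≠ 0 := (Real.sqrt_pos.2 hn0).ne'
            have h5 : (n : ℝ)⁻¹ = (Real.sqrt n)⁻¹ * (Real.sqrt n)⁻¹ := by
              rw [← mul_inv, Real.mul_self_sqrt hn0.le]
            rw [h5]
            field_simp
    have hvar : |∑ i, (Real.sqrt n / M.zeta P v * M.onCoeff v x i) ^ 2 - 1| ≤ η := by
      have h1 := hSig.abs_sandwich_sub_le hCmin hx.1.gram hδ hx.2 hb hv
      have h2 : ∑ i, (Real.sqrt n / M.zeta P v * M.onCoeff v x i) ^ 2 =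
          inner ℝ (clm (gram (M.rowsS x) 1)⁻¹ v) (clm (gram (M.rowsS x) fun i ↦ M.scale x i ^ 2)
            (clm (gram (M.rowsS x) 1)⁻¹ v)) / V := by
        simp only [mul_pow (Real.sqrt n / M.zeta P v), ← Finset.mul_sum]
        rw [div_pow, hζ, Real.sq_sqrt hn0.le, Real.sq_sqrt hV0.le]
        simp only [onCoeff, sum_sq_coeff]
        field_simp
      rw [h2, div_sub_one hV0.ne', abs_div, abs_of_pos hV0]
      calc _ ≤ (4 / Cmin ^ 2 + 6 * b / Cmin ^ 3) * δ / V := by gcongr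
        _ ≤ η := by rw [hη]; gcongr
    have h4 := norm_integral_exp_sum_sub_le hhet.measurable_eps hhet.indep_eps hnoise hhet.mean_eps
      hhet.var_eps t hcoef ((abs_nonneg _).trans (hcoef ⟨0, Nat.pos_of_ne_zero hn⟩)) hvar
    convert h4 using 7 with ω
    rw [hlin x hx, Finset.mul_sum]
    congr 2
    exact Finset.sum_congr rfl fun i _ ↦ by ring
  have hmain := norm_integral_prodMk_sub_le hX he hhet.indep_design_eps
    (F := fun w ↦ Complex.exp ((t * (Real.sqrt n / M.zeta P v * f w) : ℝ) * Complex.I))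
    (by fun_prop) (fun w ↦ (Complex.norm_exp_ofReal_mul_I _).le)
    (c := (Real.exp (-(t ^ 2 / 2)) : ℂ)) (by
      rw [Complex.norm_real, Real.norm_of_nonneg (Real.exp_pos _).le, Real.exp_le_one_iff]
      have := sq_nonneg t
      linarith) (G := G) (by positivity) hsections
  have hfω (ω : Ω) : ∑ j : M.S, v j * (M.oracle ω j - M.beta j) =
      f (fun i ↦ M.x i ω, fun i ↦ M.eps i ω) := by
    refine Finset.sum_congr rfl fun j _ ↦ ?_
    rw [M.oracle_of_mem, funext (M.y_eq ω)]
    rfl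
  simp_rw [hfω]
  refine hmain.trans ?_
  gcongr
  have hsub : {ω | (fun i ↦ M.x i ω) ∉ G} ⊆ {ω | ¬ M.GoodDesign δ m c κ fun i ↦ M.x i ω} ∪
      {ω | δ < ‖clm (M.DSS ω - M.meanDSS P)‖} := by
    intro ω hω
    by_contra hcon
    simp only [Set.mem_union, Set.mem_ofPred_eq, not_or, not_not, not_lt] at hcon
    refine hω ⟨hcon.1, ?_⟩
    have := hcon.2
    rw [DSS_eq_gram] at this
    have hw : (fun i ↦ M.scale (fun i ↦ M.x i ω) i ^ 2) = fun i ↦ Real.exp (M.logVar i ω) :=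
      funext fun i ↦ scale_sq _ i
    rw [hw]
    exact this
  exact (measureReal_mono hsub).trans (measureReal_union_le _ _)

end Model

end Hippo

namespace Hippo

/-! ### Growth rates -/

section Rates

lemma tendsto_rpow_sub_one {α : ℝ} (hα : α < 1) :
    Tendsto (fun n : ℕ ↦ (n : ℝ) ^ (α - 1)) atTop (𝓝 0) := by
  have := (tendsto_rpow_neg_atTop (y := 1 - α) (by linarith)).comp tendsto_natCast_atTop_atTop
  simpa [Function.comp_def] using this

variable {s : ℕ → ℕ} {C α : ℝ}

lemma tendsto_card_div (hα : α < 1)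
    (hs : Tendsto (fun n : ℕ ↦ (s n : ℝ) / (n : ℝ) ^ α) atTop (𝓝 C)) :
    Tendsto (fun n : ℕ ↦ (s n : ℝ) / n) atTop (𝓝 0) := by
  have h := hs.mul (tendsto_rpow_sub_one hα)
  rw [mul_zero] at h
  refine h.congr' ?_
  filter_upwards [eventually_gt_atTop 0] with n hn
  have hn0 : (0 : ℝ) < n := Nat.cast_pos.2 hn
  rw [Real.rpow_sub_one hn0.ne']
  have := (Real.rpow_pos_of_pos hn0 α).ne'
  field_simp

lemma tendsto_card_atTop (hα : 0 < α) (hC : 0 < C)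
    (hs : Tendsto (fun n : ℕ ↦ (s n : ℝ) / (n : ℝ) ^ α) atTop (𝓝 C)) :
    Tendsto (fun n : ℕ ↦ (s n : ℝ)) atTop atTop := by
  have h := hs.pos_mul_atTop hC ((tendsto_rpow_atTop hα).comp tendsto_natCast_atTop_atTop)
  refine h.congr' ?_
  filter_upwards [eventually_gt_atTop 0] with n hn
  have hn0 : (0 : ℝ) < n := Nat.cast_pos.2 hn
  have := (Real.rpow_pos_of_pos hn0 α).ne'
  simp only [Function.comp_apply]
  field_simp

/-- `exp √(c log n)` grows more slowly than any power of `n`. -/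
lemma eventually_exp_sqrt_log_le (c : ℝ) {b : ℝ} (hb : 0 < b) :
    ∀ᶠ n : ℕ in atTop, Real.exp (Real.sqrt (c * Real.log n)) ≤ (n : ℝ) ^ b := by
  have hlog : Tendsto (fun n : ℕ ↦ Real.log n) atTop atTop :=
    Real.tendsto_log_atTop.comp tendsto_natCast_atTop_atTop
  filter_upwards [eventually_gt_atTop 0, hlog.eventually_ge_atTop (c / b ^ 2),
    hlog.eventually_ge_atTop 0] with n hn h1 h0
  have hn0 : (0 : ℝ) < n := Nat.cast_pos.2 hn
  rw [Real.rpow_def_of_pos hn0]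
  refine Real.exp_le_exp.2 (Real.sqrt_le_iff.2 ⟨by positivity, ?_⟩)
  rw [div_le_iff₀ (by positivity)] at h1
  nlinarith

lemma tendsto_card_mul_log_mul_exp (hα : α < 1) (c : ℝ)
    (hs : Tendsto (fun n : ℕ ↦ (s n : ℝ) / (n : ℝ) ^ α) atTop (𝓝 C)) :
    Tendsto (fun n : ℕ ↦ (s n : ℝ) * Real.log n * Real.exp (Real.sqrt (c * Real.log n)) / n) atTop
      (𝓝 0) := by
  set b := (1 - α) / 2 with hb
  have hb0 : 0 < b := by rw [hb]; linarith
  have hlog : Tendsto (fun n : ℕ ↦ Real.log n / (n : ℝ) ^ b) atTop (𝓝 0) :=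
    (isLittleO_log_rpow_atTop hb0).tendsto_div_nhds_zero.comp tendsto_natCast_atTop_atTop
  have h := hs.mul hlog
  rw [mul_zero] at h
  refine squeeze_zero' ?_ ?_ h
  · exact Eventually.of_forall fun n ↦ by
      have := Real.log_natCast_nonneg n
      positivity
  · filter_upwards [eventually_gt_atTop 0, eventually_exp_sqrt_log_le c hb0] with n hn hexp
    have hn0 : (0 : ℝ) < n := Nat.cast_pos.2 hn
    have hlog0 := Real.log_natCast_nonneg n
    have hsplit : (n : ℝ) = (n : ℝ) ^ α * (n : ℝ) ^ b * (n : ℝ) ^ b := by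
      rw [← Real.rpow_add hn0, ← Real.rpow_add hn0]
      have : α + b + b = 1 := by rw [hb]; ring
      rw [this, Real.rpow_one]
    have h1 : 0 < (n : ℝ) ^ α := Real.rpow_pos_of_pos hn0 α
    have h2 : 0 < (n : ℝ) ^ b := Real.rpow_pos_of_pos hn0 b
    calc _ ≤ (s n : ℝ) * Real.log n * (n : ℝ) ^ b / n := by gcongr
      _ = (s n : ℝ) * Real.log n * (n : ℝ) ^ b / ((n : ℝ) ^ α * (n : ℝ) ^ b * (n : ℝ) ^ b) := by
          rw [← hsplit]
      _ = _ := by field_simp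

lemma tendsto_exp_neg_const_mul {c : ℝ} (hc : 0 < c) :
    Tendsto (fun n : ℕ ↦ Real.exp (-(c * n))) atTop (𝓝 0) :=
  Real.tendsto_exp_neg_atTop_nhds_zero.comp
    (tendsto_natCast_atTop_atTop.const_mul_atTop hc)

/-- Net cardinalities are negligible in front of exponential tails since `s / n → 0`. -/
lemma tendsto_pow_card_mul_exp {c : ℝ} (hc : 0 < c)
    (hs : Tendsto (fun n : ℕ ↦ (s n : ℝ) / n) atTop (𝓝 0)) :
    Tendsto (fun n : ℕ ↦ (25 : ℝ) ^ s n * (2 * Real.exp (-(n * c)))) atTop (𝓝 0) := by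
  have hlog : 0 < Real.log 25 := Real.log_pos (by norm_num)
  have h := (tendsto_exp_neg_const_mul (c := c / 2) (by positivity)).const_mul 2
  rw [mul_zero] at h
  refine squeeze_zero' (Eventually.of_forall fun n ↦ by positivity) ?_ h
  filter_upwards [eventually_gt_atTop 0, hs.eventually (gt_mem_nhds
    (show (0 : ℝ) < c / (2 * Real.log 25) by positivity))] with n hn hsn
  have hn0 : (0 : ℝ) < n := Nat.cast_pos.2 hn
  rw [div_lt_iff₀ hn0] at hsn
  have e1 : (25 : ℝ) ^ s n = Real.exp (s n * Real.log 25) := by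
    rw [Real.exp_nat_mul, Real.exp_log (by norm_num)]
  have e2 : (s n : ℝ) * Real.log 25 ≤ c / 2 * n := by
    calc _ ≤ c / (2 * Real.log 25) * n * Real.log 25 := by gcongr
      _ = _ := by field_simp
  rw [e1, mul_left_comm, ← Real.exp_add]
  gcongr
  linarith

lemma tendsto_card_mul_exp {p : ℕ → ℕ} {α₀ c : ℝ} (hα₀ : α₀ < 1) (hc : 0 < c)
    (hp : (fun n ↦ Real.log (p n)) =O[atTop] fun n : ℕ ↦ (n : ℝ) ^ α₀) :
    Tendsto (fun n : ℕ ↦ (p n : ℝ) * (2 * Real.exp (-(n * c)))) atTop (𝓝 0) := by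
  obtain ⟨B, hB0, hB⟩ := hp.exists_pos
  have h := (tendsto_exp_neg_const_mul (c := c / 2) (by positivity)).const_mul 2
  rw [mul_zero] at h
  refine squeeze_zero' (Eventually.of_forall fun n ↦ by positivity) ?_ h
  filter_upwards [eventually_gt_atTop 0, hB.bound, (tendsto_rpow_sub_one hα₀).eventually
    (gt_mem_nhds (show (0 : ℝ) < c / (2 * B) by positivity))] with n hn hpn hsmall
  have hn0 : (0 : ℝ) < n := Nat.cast_pos.2 hn
  have hpow : 0 < (n : ℝ) ^ α₀ := Real.rpow_pos_of_pos hn0 α₀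
  rw [Real.norm_of_nonneg hpow.le, Real.norm_of_nonneg (Real.log_natCast_nonneg _)] at hpn
  rw [Real.rpow_sub_one hn0.ne', div_lt_iff₀ hn0] at hsmall
  have e1 : Real.log (p n) ≤ c / 2 * n := by
    calc _ ≤ B * (n : ℝ) ^ α₀ := hpn
      _ ≤ B * (c / (2 * B) * n) := by gcongr
      _ = _ := by field_simp
  have e2 : (p n : ℝ) ≤ Real.exp (c / 2 * n) := by
    rcases Nat.eq_zero_or_pos (p n) with h0 | h0
    · rw [h0, Nat.cast_zero]; positivity
    · rw [← Real.exp_log (Nat.cast_pos.2 h0 : (0 : ℝ) < p n)]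
      exact Real.exp_le_exp.2 e1
  calc _ ≤ Real.exp (c / 2 * n) * (2 * Real.exp (-(n * c))) := by gcongr
    _ = 2 * Real.exp (-(c / 2 * n)) := by
        rw [mul_left_comm, ← Real.exp_add]
        ring_nf

end Rates

/-! ### Sequences of models -/

lemma eventually_lt_abs_beta {p : ℕ → ℕ} {Ω : ℕ → Type*} {M : ∀ n, Model n (p n) (Ω n)}
    {lam τ : ℕ → ℝ} {a : ℝ} (ha : 0 < a)
    (hpos : ∀ᶠ n in atTop, 0 < lam n)
    (hlam : lam =o[atTop] fun n ↦ (M n).betaMin) (hτ : τ =o[atTop] lam) :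
    ∀ᶠ n in atTop, ∀ j ∈ (M n).S, a * lam n + τ n < |(M n).beta j| := by
  filter_upwards [hpos, hlam.def (show 0 < 1 / (2 * (a + 1)) by positivity), hτ.def one_pos] with n
    h0 h1 h2 j hj
  have hmin : 0 ≤ (M n).betaMin := Real.iInf_nonneg fun _ ↦ abs_nonneg _
  have hle : (M n).betaMin ≤ |(M n).beta j| :=
    ciInf_le (f := fun j : (M n).S ↦ |(M n).beta j|) (Set.finite_range _).bddBelow ⟨j, hj⟩
  rw [Real.norm_of_nonneg h0.le, Real.norm_of_nonneg hmin, one_div_mul_eq_div,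
    le_div_iff₀ (by positivity)] at h1
  rw [Real.norm_of_nonneg h0.le, one_mul] at h2
  have h3 := (le_abs_self _).trans h2
  nlinarith

section Sequences

variable {p : ℕ → ℕ} {Ω : ℕ → Type*} [∀ n, MeasurableSpace (Ω n)] {P : ∀ n, Measure (Ω n)}
  [∀ n, IsProbabilityMeasure (P n)] {M : ∀ n, Model n (p n) (Ω n)} {K Cmin Cmax : ℝ}

lemma tendsto_measure_iff_measureReal {A : ∀ n, Set (Ω n)} :
    Tendsto (fun n ↦ P n (A n)) atTop (𝓝 0) ↔ Tendsto (fun n ↦ (P n).real (A n)) atTop (𝓝 0) := by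
  rw [← ENNReal.tendsto_toReal_iff (fun n ↦ measure_ne_top _ _) ENNReal.zero_ne_top]
  rfl

lemma tendsto_measureReal_not_goodDesign (hdes : ∀ n, (M n).SubgaussianDesign (P n) K Cmin Cmax)
    (hK : 0 < K) (hCmin : 0 < Cmin) (hCmax : 0 < Cmax) {L Θ : ℝ} (hL : L = 2 * K * Real.sqrt Cmax)
    (hΘ : 0 < Θ) (hθ : ∀ n, ‖(M n).theta‖ ≤ Θ) {C α α₀ : ℝ} (hα : α < 1) (hα₀ : α₀ < 1)
    (hs : Tendsto (fun n : ℕ ↦ ((M n).S.card : ℝ) / (n : ℝ) ^ α) atTop (𝓝 C))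
    (hp : (fun n ↦ Real.log (p n)) =O[atTop] fun n : ℕ ↦ (n : ℝ) ^ α₀) {δ : ℝ} (hδ0 : 0 < δ)
    (hδ : δ ≤ 16) :
    Tendsto (fun n : ℕ ↦ (P n).real {ω | ¬ (M n).GoodDesign (4 * (L ^ 2 * δ))
        (Real.exp (Real.sqrt (2 * (L * Θ) ^ 2 * Real.log n))) (Cmax + L ^ 2)
        (L ^ 2 * (3 * Real.log n)) fun i ↦ (M n).x i ω}) atTop (𝓝 0) := by
  have hs1 := tendsto_card_div hα hs
  have hinv : Tendsto (fun n : ℕ ↦ (1 : ℝ) / n) atTop (𝓝 0) :=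
    tendsto_const_div_atTop_nhds_zero_nat 1
  have h1 := tendsto_pow_card_mul_exp (c := δ ^ 2 / 64) (by positivity) hs1
  have h2 : Tendsto (fun n : ℕ ↦ (2 : ℝ) / n) atTop (𝓝 0) := tendsto_const_div_atTop_nhds_zero_nat 2
  have h3 := tendsto_card_mul_exp (c := 1 / 64) hα₀ (by positivity) hp
  have h4 : Tendsto (fun n : ℕ ↦ 2 * ((M n).S.card : ℝ) / n ^ 2) atTop (𝓝 0) := by
    have := (hs1.const_mul 2).mul hinv
    rw [mul_zero] at this
    refine this.congr fun n ↦ ?_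
    ring
  have hsum := ((h1.add h2).add h3).add h4
  simp only [add_zero] at hsum
  refine squeeze_zero' (Eventually.of_forall fun n ↦ measureReal_nonneg) ?_ hsum
  filter_upwards [eventually_ne_atTop 0] with n hn
  refine ((M n).measureReal_not_goodDesign_le (hdes n) hK hCmin hCmax hn hL hΘ (hθ n) hδ0.le
    hδ).trans_eq ?_
  ring_nf

/-- Lévy's continuity theorem for real random variables on varying probability spaces. -/
lemma tendstoInDistribution_gaussian_of_charFun {Z : ∀ n, Ω n → ℝ} (hZ : ∀ n, Measurable (Z n))
    (h : ∀ t : ℝ, Tendsto (fun n ↦ ‖∫ ω, Complex.exp ((t * Z n ω : ℝ) * Complex.I) ∂(P n) -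
      Real.exp (-(t ^ 2 / 2))‖) atTop (𝓝 0)) :
    TendstoInDistribution Z atTop (id : ℝ → ℝ) P (gaussianReal 0 1) where
  forall_aemeasurable n := (hZ n).aemeasurable
  aemeasurable_limit := aemeasurable_id
  tendsto := by
    refine ProbabilityMeasure.tendsto_iff_tendsto_charFun.2 fun t ↦ ?_
    have e1 (n : ℕ) : charFun ((P n).map (Z n)) t =
        ∫ ω, Complex.exp ((t * Z n ω : ℝ) * Complex.I) ∂(P n) := by
      rw [charFun_apply_real, integral_map (hZ n).aemeasurable (by fun_prop)]
      simp
    have e2 : charFun ((gaussianReal 0 1).map id) t = (Real.exp (-(t ^ 2 / 2)) : ℂ) := by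
      rw [Measure.map_id, charFun_gaussianReal]
      push_cast
      congr 1
      simp
    simp only [ProbabilityMeasure.coe_mk, e1, e2]
    exact tendsto_iff_norm_sub_tendsto_zero.2 (h t)

/-- Asymptotic normality of the oracle estimator. -/
lemma tendstoInDistribution_oracle (hhet : ∀ n, (M n).IsHeteroscedastic (P n))
    (hdes : ∀ n, (M n).SubgaussianDesign (P n) K Cmin Cmax)
    (hnoise : ∀ n, (M n).SubgaussianNoise (P n))
    (hK : 0 < K) (hCmin : 0 < Cmin) (hCmax : 0 < Cmax) {Θ : ℝ}
    (hΘ : 0 < Θ) (hθ : ∀ n, ‖(M n).theta‖ ≤ Θ) {C α α₀ : ℝ} (hα : α < 1) (hα₀ : α₀ < 1)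
    (hs : Tendsto (fun n : ℕ ↦ ((M n).S.card : ℝ) / (n : ℝ) ^ α) atTop (𝓝 C))
    (hp : (fun n ↦ Real.log (p n)) =O[atTop] fun n : ℕ ↦ (n : ℝ) ^ α₀)
    (hD : ∀ δ : ℝ, 0 < δ → Tendsto (fun n ↦ P n {ω | δ <
      ‖Matrix.toEuclideanCLM (𝕜 := ℝ) ((M n).DSS ω - (M n).meanDSS (P n))‖}) atTop (𝓝 0))
    (v : ∀ n, EuclideanSpace ℝ (M n).S) (hv : ∀ᶠ n in atTop, ‖v n‖ = 1) :
    TendstoInDistribution (fun (n : ℕ) (ω : Ω n) ↦ Real.sqrt n / (M n).zeta (P n) (v n) *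
      ∑ j : (M n).S, v n j * ((M n).oracle ω j - (M n).beta j))
      atTop (id : ℝ → ℝ) P (gaussianReal 0 1) := by
  obtain ⟨L, hL⟩ : ∃ L, L = 2 * K * Real.sqrt Cmax := ⟨_, rfl⟩
  have hL0 : 0 < L := by rw [hL]; positivity
  set b := 16 * L ^ 2 * Real.exp ((L * Θ) ^ 2 / 2) with hb
  set z := Cmin ^ 2 / (4 * L ^ 2 * Real.exp ((L * Θ) ^ 2 / 2)) * (1 / (4 * Cmax)) ^ 2 with hz
  have hb0 : 0 < b := by positivity
  have hz0 : 0 < z := by positivity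
  refine tendstoInDistribution_gaussian_of_charFun (fun n ↦ ?_) fun t ↦ ?_
  · have h1 := (M n).measurable_oracle (hdes n).measurable_x (hhet n).measurable_eps
    have h2 (j : Fin (p n)) : Measurable fun ω ↦ (M n).oracle ω j :=
      (measurable_pi_apply j).comp ((WithLp.measurable_ofLp 2 _).comp h1)
    fun_prop
  set H := (4 / Cmin ^ 2 + 6 * b / Cmin ^ 3) / z with hH
  -- The largest weight tends to zero.
  have hA : Tendsto (fun n : ℕ ↦ 2 / (Cmin * Real.sqrt z) * Real.sqrt ((M n).S.card *
      (L ^ 2 * (3 * Real.log n)) * Real.exp (Real.sqrt (2 * (L * Θ) ^ 2 * Real.log n)) / n)) atTop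
      (𝓝 0) := by
    have h1 := (tendsto_card_mul_log_mul_exp hα (2 * (L * Θ) ^ 2) hs).const_mul (3 * L ^ 2)
    have h2 := ((Real.continuous_sqrt.tendsto _).comp h1).const_mul (2 / (Cmin * Real.sqrt z))
    simp only [mul_zero, Real.sqrt_zero] at h2
    refine h2.congr fun n ↦ ?_
    simp only [Function.comp_apply]
    congr 2
    ring
  refine Metric.tendsto_atTop'.2 fun ε hε ↦ ?_
  -- Choose the closeness `4 L² δ` of the Gram matrices so that the variance error is small.
  have hsmall (c : ℝ) {d : ℝ} (hd : 0 < d) : ∀ᶠ δ in 𝓝[>] (0 : ℝ), c * δ < d :=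
    ((Continuous.tendsto' (by fun_prop) 0 0 (by simp) : Tendsto (fun δ : ℝ ↦ c * δ) (𝓝 0)
      (𝓝 0)).mono_left nhdsWithin_le_nhds).eventually (gt_mem_nhds hd)
  obtain ⟨δ, ⟨⟨hδ1, hδ2⟩, hδ3⟩, hδ0⟩ := ((((hsmall 1 (show (0 : ℝ) < 16 by norm_num)).and
    (hsmall (4 * L ^ 2) (show 0 < Cmin / 2 by positivity))).and
    (hsmall (t ^ 2 / 2 * (H * (4 * L ^ 2))) (show 0 < ε / 2 by positivity))).and
    self_mem_nhdsWithin).exists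
  have hδ0' : 0 < δ := hδ0
  have hgood := tendsto_measureReal_not_goodDesign hdes hK hCmin hCmax hL hΘ hθ hα hα₀ hs hp hδ0'
    (by linarith)
  have hDr := tendsto_measure_iff_measureReal.1 (hD (4 * (L ^ 2 * δ)) (by positivity))
  have hlim := (((hA.const_mul (200 * |t| ^ 3)).mul_const (1 + H * (4 * (L ^ 2 * δ)))).add_const
    (t ^ 2 / 2 * (H * (4 * (L ^ 2 * δ))))).add ((hgood.add hDr).const_mul 2)
  have hlt : 200 * |t| ^ 3 * 0 * (1 + H * (4 * (L ^ 2 * δ))) + t ^ 2 / 2 * (H * (4 * (L ^ 2 * δ))) +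
      2 * (0 + 0) < ε := by
    have : t ^ 2 / 2 * (H * (4 * (L ^ 2 * δ))) = t ^ 2 / 2 * (H * (4 * L ^ 2)) * δ := by ring
    rw [this]
    simp only [mul_zero, zero_mul, zero_add, add_zero]
    linarith
  obtain ⟨N, hN⟩ := eventually_atTop.1 ((hlim.eventually (gt_mem_nhds hlt)).and
    (hv.and (eventually_ne_atTop 0)))
  refine ⟨N, fun n hn ↦ ?_⟩
  obtain ⟨hn1, hn2, hn3⟩ := hN n hn.le
  rw [dist_zero_right, norm_norm]
  have hbounds := Model.meanDSS_bounds (hdes n) hK hCmin hCmax hn3 hL hΘ (hθ n)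
  have key := Model.norm_integral_exp_oracle_sub_le (hdes n) (hhet n) (hnoise n) hCmin hn3
    (m := Real.exp (Real.sqrt (2 * (L * Θ) ^ 2 * Real.log n))) (c := Cmax + L ^ 2)
    (κ := L ^ 2 * (3 * Real.log n)) (δ := 4 * (L ^ 2 * δ)) (by positivity) (by linarith)
    hbounds.1 hz0 hn2 (hbounds.2 _ hn2) t
  have e : (4 / Cmin ^ 2 + 6 * b / Cmin ^ 3) * (4 * (L ^ 2 * δ)) / z = H * (4 * (L ^ 2 * δ)) := by
    rw [hH]; ring
  rw [← hb, e] at key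
  exact key.trans_lt hn1

end Sequences

end Hippo

theorem theorem1 (K Cmin Cmax βbar θbar : ℝ) (hK : 0 < K) (hCmin : 0 < Cmin) (hCmax : 0 < Cmax) :
    ∃ c₁ c₂ c₃ : ℝ, 0 < c₁ ∧ 0 < c₂ ∧ 0 < c₃ ∧
      ∀ (C_S α_S C_T α_T α₀ a : ℝ),
        0 < C_S → α_S ∈ Set.Ioo (0 : ℝ) 1 → 0 < C_T → α_T ∈ Set.Ioo (0 : ℝ) (1 / 3) →
        α₀ ∈ Set.Ioo (0 : ℝ) 1 → 1 < a →
      ∀ (p : ℕ → ℕ) (Ω : ℕ → Type*) [∀ n, MeasurableSpace (Ω n)]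
        (P : ∀ n, Measure (Ω n)) [∀ n, IsProbabilityMeasure (P n)]
        (M : ∀ n, Hippo.Model n (p n) (Ω n)) (lam : ℕ → ℝ),
        (∀ n, (M n).IsHeteroscedastic (P n)) →
        (∀ n, (M n).SubgaussianDesign (P n) K Cmin Cmax) →
        (∀ n, (M n).SubgaussianNoise (P n)) →
        (∀ n, ‖(M n).beta‖ ≤ βbar ∧ ‖(M n).theta‖ ≤ θbar) →
        Tendsto (fun n : ℕ => ((M n).S.card : ℝ) / (n : ℝ) ^ α_S) atTop (𝓝 C_S) →
        Tendsto (fun n : ℕ => ((M n).T.card : ℝ) / (n : ℝ) ^ α_T) atTop (𝓝 C_T) →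
        (∀ᶠ n : ℕ in atTop,
          c₁ * Real.sqrt (Real.log (p n) * Real.exp (Real.sqrt (c₂ * Real.log n)) / n) ≤ lam n) →
        lam =o[atTop] (fun n => (M n).betaMin) →
        (fun n : ℕ => c₃ * Real.sqrt (Real.log ((M n).S.card : ℝ) *
          Real.exp (Real.sqrt (c₂ * Real.log n)) / n)) =o[atTop] lam →
        (fun n => Real.log (p n)) =O[atTop] (fun n : ℕ => (n : ℝ) ^ α₀) →
        ∃ βhat : ∀ n, Ω n → EuclideanSpace ℝ (Fin (p n)),
          (∀ n, Measurable (βhat n)) ∧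
          Tendsto (fun n => P n {ω | ¬ (M n).IsOracleLocalMin a (lam n) c₂ c₃ ω (βhat n ω)})
            atTop (𝓝 0) ∧
          (Hippo.WeightedGramRegular P M →
            ∀ v : ∀ n, EuclideanSpace ℝ (M n).S, (∀ᶠ n in atTop, ‖v n‖ = 1) →
              TendstoInDistribution
                (fun (n : ℕ) (ω : Ω n) => Real.sqrt n / (M n).zeta (P n) (v n) *
                  ∑ j : (M n).S, v n j * (βhat n ω j - (M n).beta j))
                atTop (id : ℝ → ℝ) P (gaussianReal 0 1)) := by
  set L := 2 * K * Real.sqrt Cmax with hL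
  have hL0 : 0 < L := by positivity
  set Θ := |θbar| + 1 with hΘ
  have hΘ0 : 0 < Θ := by positivity
  refine ⟨2 * Real.sqrt (Cmax + L ^ 2), 2 * (L * Θ) ^ 2, Real.sqrt (8 / Cmin), by positivity,
    by positivity, by positivity, ?_⟩
  intro C_S α_S C_T α_T α₀ a hCS hαS hCT hαT hα₀ ha p Ω _ P _ M lam hhet hdes hnoise hbd hS hT hlam
    hβ hrate hp
  have hθ (n : ℕ) : ‖(M n).theta‖ ≤ Θ := (hbd n).2.trans ((le_abs_self _).trans (by linarith))
  refine ⟨fun n ↦ (M n).oracle, fun n ↦ (M n).measurable_oracle (hdes n).measurable_x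
    (hhet n).measurable_eps, ?_, fun hreg v hv ↦ Hippo.tendstoInDistribution_oracle hhet hdes
    hnoise hK hCmin hCmax hΘ0 hθ hαS.2 hα₀.2 hS hp hreg.2 v hv⟩
  have hs := Hippo.tendsto_card_atTop hαS.1 hCS hS
  have hsp (n : ℕ) : ((M n).S.card : ℝ) ≤ p n := by
    exact_mod_cast (by simpa using Finset.card_le_univ (M n).S)
  have hpt : Tendsto (fun n ↦ (p n : ℝ)) atTop atTop := tendsto_atTop_mono hsp hs
  have hlampos : ∀ᶠ n in atTop, 0 < lam n := by
    filter_upwards [hlam, hpt.eventually_gt_atTop 1, eventually_gt_atTop 0] with n h1 h2 h3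
    have hn0 : (0 : ℝ) < n := Nat.cast_pos.2 h3
    have := Real.log_pos h2
    exact lt_of_lt_of_le (by positivity) h1
  have hsignal := Hippo.eventually_lt_abs_beta (show 0 < a by linarith) hlampos hβ hrate
  obtain ⟨δ, hδ0, hδ1, hδ2⟩ : ∃ δ : ℝ, 0 < δ ∧ δ ≤ 16 ∧ 4 * (L ^ 2 * δ) ≤ Cmin / 2 := by
    refine ⟨min 16 (Cmin / (8 * L ^ 2)), by positivity, min_le_left _ _, ?_⟩
    calc 4 * (L ^ 2 * min 16 (Cmin / (8 * L ^ 2))) ≤ 4 * (L ^ 2 * (Cmin / (8 * L ^ 2))) := by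
          gcongr
          exact min_le_right _ _
      _ = Cmin / 2 := by field_simp; ring
  have hgood := Hippo.tendsto_measureReal_not_goodDesign hdes hK hCmin hCmax hL hΘ0 hθ hαS.2
    hα₀.2 hS hp hδ0 hδ1
  refine Hippo.tendsto_measure_iff_measureReal.2 ?_
  have hlim := (hgood.const_mul 3).add ((hs.const_div_atTop 2).add (hpt.const_div_atTop 2))
  simp only [mul_zero, add_zero] at hlim
  refine squeeze_zero' (Eventually.of_forall fun n ↦ measureReal_nonneg) ?_ hlim
  filter_upwards [hlam, hlampos, hsignal, hs.eventually_gt_atTop 0, eventually_ne_atTop 0] with n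
    h1 h2 h3 h4 h5
  refine Hippo.Model.measureReal_not_isOracleLocalMin_le (hdes n) (hhet n) (hnoise n) hCmin h5
    (Nat.cast_pos.1 h4) ha h2 (by positivity) hδ2 (fun j hj ↦ ?_) h1
  have h6 := h3 j hj
  rwa [mul_comm (Real.log _)] at h6
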